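/- **Setting.** Let $\Gamma\subset\mathbb R^2$ be a smooth tropical curve of bidegree $(3,3)$ in the max convention, i.e. the corner locus of $F(x,y)=\max_{0\le i,j\le 3}(a_{ij}+ix+jy)$ with $a_{ij}\in\mathbb R$, whose dual Newton subdivision is a unimodular triangulation of the square $[0,3]^2$. For $p\in\mathbb R^2$ let $p^\vee$ be the set of exponents $(i,j)$ attaining the maximum at $p$; the chamber $(i,j)^\vee$ of $\mathbb R^2\smallsetminus\Gamma$ is the set of $p$ with $p^\vee=\{(i,j)\}$. A point $(v_0,\ell)\in\mathbb R^2\times\mathbb R=\mathbb R^3$ encodes the tropical $(1,1)$-curve $\Lambda$ with lowest vertex $v_0$ whose edge has signed length $\ell$: the other vertex is $v_1=v_0+\ell(1,1)$ if $\ell\ge 0$ and $v_1=v_0-\ell(-1,1)$ if $\ell\le 0$ (so $\Lambda$ is $4$-valent if $\ell=0$). The curve $\Lambda$ is *tritangent* to $\Gamma$ if the connected components of $\Lambda\cap\Gamma$ have total stable intersection multiplicities $(2,2,2)$, $(2,4)$ or $(6)$. A *tritangent class* $\Omega$ of $\Gamma$ is a connected component of the set of all $(v_0,\ell)\in\mathbb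 R^3$ encoding curves tritangent to $\Gamma$. Endow $\Omega$ with any structure of a finite polyhedral complex compatible with $\Gamma$: for all members in the relative interior of a given cell, $v_0$ lies in a fixed piece of the subdivision of $\mathbb R^2$ by $\Gamma$ into chambers, open edges and vertices, and so does $v_1$. The *bounded complex* $\Omega^b$ is obtained from $\Omega$ by removing all cells whose relative interior contains a point $(v_0,\ell)$ satisfying one of the following: * $\ell>0$ and $v_0\in(0,0)^\vee$; or $\ell>0$ and $v_1\in(3,3)^\vee$; or $\ell<0$ and $v_0\in(3,0)^\vee$; or $\ell<0$ and $v_1\in(0,3)^\vee$; * $\ell>0$, $v_0^\vee\supseteq\{(1,0),(0,1)\}$ and $(i,2-i)\notin v_0^\vee$ for $i=0,1,2$; * $\ell>0$, $v_1^\vee\supseteq\{(2,3),(3,2)\}$ and $(1+i,3-i)\notin v_1^\vee$ for $i=0,1,2$; * $\ell<0$, $v_0^\vee\supseteq\{(2,0),(3,1)\}$ and $(1+i,i)\notin v_0^\vee$ for $i=0,1,2$; * $\ell<0$, $v_1^\vee\supseteq\{(0,2),(1,3)\}$ and $(i,1+i)\notin v_1^\vee$ for $i=0,1,2$. A tritangent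 $\Lambda$ is *special* if two of its tangencies lie in the interior of the same leg of $\Lambda$: that is, there are two distinct components of $\Lambda\cap\Gamma$ such that the stable intersection of $\Lambda$ and $\Gamma$ on each of them is a divisor $p_1+p_2$ (possibly $p_1=p_2$) supported on one and the same leg, and in both cases the tangency point, which is the midpoint of $p_1$ and $p_2$, lies in the interior of that leg. The *non-special bounded complex* $\Omega^b_{ns}$ is obtained from $\Omega^b$ by removing all cells that contain a special tritangent in their relative interior. **Theorem.** For every smooth tropical $(3,3)$-curve $\Gamma$ and every tritangent class $\Omega$ of $\Gamma$, the (support of the) non-special bounded complex $\Omega^b_{ns}$ is path-connected; in particular it is non-empty. -/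

import Mathlib

noncomputable section

namespace Tritangent

/-! ### Tropical curves of bidegree `(n, n)` (max convention) -/

/-- Exponents `(i, j)` with `0 ≤ i, j ≤ n`: the lattice points of the square of side length `n`. -/
abbrev Expo (n : ℕ) := Fin (n + 1) × Fin (n + 1)

/-- Value at `p = (x, y)` of the tropical monomial `a_{ij} + i x + j y`. -/
def monomialValue {n : ℕ} (a : Expo n → ℝ) (m : Expo n) (p : ℝ × ℝ) : ℝ :=
  a m + ((m.1 : ℕ) : ℝ) * p.1 + ((m.2 : ℕ) : ℝ) * p.2

open Classical in
/-- The lattice points of the cell `p^∨` of the Newton subdivision dual to the point `p`: the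
exponents at which the tropical polynomial `max_{i,j} (a_{ij} + i x + j y)` is attained at `p`. -/
def dualCell {n : ℕ} (a : Expo n → ℝ) (p : ℝ × ℝ) : Finset (Expo n) :=
  Finset.univ.filter fun m => ∀ m', monomialValue a m' p ≤ monomialValue a m p

theorem dualCell_nonempty {n : ℕ} (a : Expo n → ℝ) (p : ℝ × ℝ) : (dualCell a p).Nonempty := by
  obtain ⟨m, -, hm⟩ := Finset.exists_max_image (Finset.univ : Finset (Expo n))
    (fun m => monomialValue a m p) Finset.univ_nonempty
  refine ⟨m, ?_⟩
  simp only [dualCell, Finset.mem_filter, Finset.mem_univ, true_and]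
  exact fun m' => hm m' (Finset.mem_univ m')

/-- The tropical curve in `ℝ²`: the corner locus of `max_{i,j} (a_{ij} + i x + j y)`. -/
def curve {n : ℕ} (a : Expo n → ℝ) : Set (ℝ × ℝ) :=
  {p | (dualCell a p).Nontrivial}

/-- The determinant of `r - q` and `s - q`. -/
def det3 {n : ℕ} (q r s : Expo n) : ℤ :=
  (((r.1 : ℕ) : ℤ) - ((q.1 : ℕ) : ℤ)) * (((s.2 : ℕ) : ℤ) - ((q.2 : ℕ) : ℤ)) -
    (((r.2 : ℕ) : ℤ) - ((q.2 : ℕ) : ℤ)) * (((s.1 : ℕ) : ℤ) - ((q.1 : ℕ) : ℤ))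

/-- The curve is smooth: every two-dimensional cell of its dual Newton subdivision is a unimodular
triangle (so the subdivision is a unimodular triangulation of the square). -/
def IsSmooth {n : ℕ} (a : Expo n → ℝ) : Prop :=
  ∀ p : ℝ × ℝ, ∀ q ∈ dualCell a p, ∀ r ∈ dualCell a p, ∀ s ∈ dualCell a p,
    det3 q r s ≠ 0 → |det3 q r s| = 1 ∧ dualCell a p = {q, r, s}

/-! ### `(1,1)`-curves encoded by the lowest vertex and the signed length of the edge -/

/-- The parameter space `ℝ³`, with points `(v₀, ℓ)`. -/
abbrev Param := (ℝ × ℝ) × ℝ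

/-- The lowest vertex `v₀`. -/
def vert0 (q : Param) : ℝ × ℝ := q.1

/-- The other vertex: `v₀ + ℓ (1, 1)` if `ℓ ≥ 0`, and `v₀ - ℓ (-1, 1)` if `ℓ ≤ 0`. -/
def vert1 (q : Param) : ℝ × ℝ := (q.1.1 + q.2, q.1.2 + |q.2|)

/-- Coefficients of the tropical polynomial `max {0, B + x, C + y, D + x + y}` whose corner locus
is the `(1,1)`-curve with vertices `vert0 q` and `vert1 q`. -/
def lineCoeff (q : Param) : Expo 1 → ℝ := fun m =>
  -(((m.1 : ℕ) : ℝ) * q.1.1) - ((m.2 : ℕ) : ℝ) * (q.1.2 - min q.2 0)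
    - ((m.1 : ℕ) : ℝ) * ((m.2 : ℕ) : ℝ) * q.2

/-- The tropical `(1,1)`-curve `Λ` encoded by `q`. -/
def lam (q : Param) : Set (ℝ × ℝ) := curve (lineCoeff q)

/-- The four legs of a `(1,1)`-curve: negative horizontal, negative vertical, positive horizontal
and positive vertical. -/
inductive Leg
  | negHor
  | negVert
  | posHor
  | posVert

/-- The direction of a leg. -/
def legDir : Leg → ℝ × ℝ
  | .negHor => (-1, 0)
  | .negVert => (0, -1)
  | .posHor => (1, 0)
  | .posVert => (0, 1)

open Classical in
/-- The vertex of the `(1,1)`-curve to which a leg is attached. -/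
def legVertex (q : Param) : Leg → ℝ × ℝ
  | .negHor => if 0 ≤ q.2 then vert0 q else vert1 q
  | .negVert => vert0 q
  | .posHor => if 0 ≤ q.2 then vert1 q else vert0 q
  | .posVert => vert1 q

/-- The leg, including the vertex to which it is attached. -/
def closedLeg (q : Param) (L : Leg) : Set (ℝ × ℝ) :=
  {p | ∃ t : ℝ, 0 ≤ t ∧ p = legVertex q L + t • legDir L}

/-- The interior of the leg. -/
def openLeg (q : Param) (L : Leg) : Set (ℝ × ℝ) :=
  {p | ∃ t : ℝ, 0 < t ∧ p = legVertex q L + t • legDir L}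

/-! ### Stable intersections and tritangency -/

/-- The ordered pairs `(r, s)` that are edges of the convex hull of `A` traversed with the hull on
their left. If `A` is a triangle these are its three sides; if `A` has two points, the segment
occurs once in each direction; if `A` is a point there are none. -/
def orientedEdges {n : ℕ} (A : Finset (Expo n)) : Finset (Expo n × Expo n) :=
  (A ×ˢ A).filter fun e => e.1 ≠ e.2 ∧ ∀ u ∈ A, 0 ≤ det3 e.1 e.2 u

/-- Pairing of the exponent `m` with the outer normal of the oriented edge `e`. -/
def normalPairing {n k : ℕ} (e : Expo n × Expo n) (m : Expo k) : ℤ :=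
  (((e.2.2 : ℕ) : ℤ) - ((e.1.2 : ℕ) : ℤ)) * ((m.1 : ℕ) : ℤ) -
    (((e.2.1 : ℕ) : ℤ) - ((e.1.1 : ℕ) : ℤ)) * ((m.2 : ℕ) : ℤ)

/-- Stable intersection multiplicity at `p` of the smooth curve `curve a` with `curve b`. It is the
sum, over the edges of `curve a` emanating from `p` (whose primitive directions are the outer
normals of the edges of the dual cell), of the outgoing slope along that edge of the tropical
polynomial with coefficients `b`; equivalently, the mixed area of the two dual cells at `p`. -/
def stableMult {n k : ℕ} (a : Expo n → ℝ) (b : Expo k → ℝ) (p : ℝ × ℝ) : ℤ :=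
  ∑ e ∈ orientedEdges (dualCell a p),
    (dualCell b p).sup' (dualCell_nonempty b p) (normalPairing e)

/-- The connected components of `Λ ∩ Γ`. -/
def interComponents (a : Expo 3 → ℝ) (q : Param) : Set (Set (ℝ × ℝ)) :=
  {C | ∃ p ∈ lam q ∩ curve a, C = connectedComponentIn (lam q ∩ curve a) p}

/-- Total stable intersection multiplicity on `C`. -/
def totalMult (a : Expo 3 → ℝ) (q : Param) (C : Set (ℝ × ℝ)) : ℤ :=
  ∑ᶠ (p : ℝ × ℝ) (_ : p ∈ C), stableMult a (lineCoeff q) p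

/-- The `(1,1)`-curve encoded by `q` is tritangent to `Γ = curve a`. -/
def IsTritangent (a : Expo 3 → ℝ) (q : Param) : Prop :=
  (∃ C₁ C₂ C₃ : Set (ℝ × ℝ), C₁ ≠ C₂ ∧ C₁ ≠ C₃ ∧ C₂ ≠ C₃ ∧
      interComponents a q = {C₁, C₂, C₃} ∧
      totalMult a q C₁ = 2 ∧ totalMult a q C₂ = 2 ∧ totalMult a q C₃ = 2) ∨
  (∃ C₁ C₂ : Set (ℝ × ℝ), C₁ ≠ C₂ ∧ interComponents a q = {C₁, C₂} ∧
      totalMult a q C₁ = 2 ∧ totalMult a q C₂ = 4) ∨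
  (∃ C : Set (ℝ × ℝ), interComponents a q = {C} ∧ totalMult a q C = 6)

/-- Tritangent classes: the connected components of the set of all tritangents in `ℝ³`. -/
def IsTritangentClass (a : Expo 3 → ℝ) (Ω : Set Param) : Prop :=
  ∃ q, IsTritangent a q ∧ Ω = connectedComponentIn {q' | IsTritangent a q'} q

/-! ### Special tritangents -/

open Classical in
/-- `P` is the tangency point carried by the component `C` of `Λ ∩ Γ`, and it lies in the interior
of the leg `L`: the stable intersection of `Λ` and `Γ` on `C` is a divisor `p₁ + p₂` of degree two
(possibly `p₁ = p₂`) supported on `L`, and `P` is the midpoint of `p₁` and `p₂`. -/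
def IsLegTangency (a : Expo 3 → ℝ) (q : Param) (L : Leg) (C : Set (ℝ × ℝ)) (P : ℝ × ℝ) : Prop :=
  C ∈ interComponents a q ∧ P ∈ openLeg q L ∧
    ∃ p₁ ∈ C ∩ closedLeg q L, ∃ p₂ ∈ C ∩ closedLeg q L,
      (∀ p ∈ C, stableMult a (lineCoeff q) p =
        (if p = p₁ then 1 else 0) + (if p = p₂ then 1 else 0)) ∧
      P = midpoint ℝ p₁ p₂

/-- A special tritangent: two of its tangencies lie in the interior of the same leg. (Two tangencies
in the interior of one leg always lie on two different components of `Λ ∩ Γ`, both of multiplicity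
two.) -/
def IsSpecial (a : Expo 3 → ℝ) (q : Param) : Prop :=
  IsTritangent a q ∧ ∃ L : Leg, ∃ C₁ C₂ : Set (ℝ × ℝ), ∃ P₁ P₂ : ℝ × ℝ, C₁ ≠ C₂ ∧
    IsLegTangency a q L C₁ P₁ ∧ IsLegTangency a q L C₂ P₂

/-! ### Polyhedral complexes -/

/-- A (closed, convex) polyhedron: a finite intersection of closed half-spaces. -/
def IsPolyhedron (C : Set Param) : Prop :=
  ∃ H : Finset ((Param →ₗ[ℝ] ℝ) × ℝ), C = {x | ∀ h ∈ H, h.1 x ≤ h.2}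

/-- A finite polyhedral complex in `ℝ³`. -/
structure PolyComplex where
  /-- the cells -/
  cells : Set (Set Param)
  finite : cells.Finite
  polyhedron : ∀ C ∈ cells, IsPolyhedron C
  nonempty : ∀ C ∈ cells, C.Nonempty
  face_mem : ∀ C ∈ cells, ∀ F, F.Nonempty → IsExposed ℝ C F → F ∈ cells
  inter_face : ∀ C ∈ cells, ∀ D ∈ cells, (C ∩ D).Nonempty →
    IsExposed ℝ C (C ∩ D) ∧ IsExposed ℝ D (C ∩ D)

/-- The complex is compatible with the subdivision of `ℝ²` by `Γ` into chambers, open edges and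
vertices: for all members in the relative interior of a given cell, the vertex `v₀` lies in the same
piece of the subdivision, and so does the vertex `v₁`. -/
def PolyComplex.IsCompatible (K : PolyComplex) (a : Expo 3 → ℝ) : Prop :=
  ∀ C ∈ K.cells, ∀ q ∈ intrinsicInterior ℝ C, ∀ q' ∈ intrinsicInterior ℝ C,
    dualCell a (vert0 q) = dualCell a (vert0 q') ∧ dualCell a (vert1 q) = dualCell a (vert1 q')

/-! ### The bounded complex and the non-special bounded complex -/

/-- Trivalent members with a vertex in one of the four corner chambers of `ℝ² ∖ Γ` (the union of
the conditions defining the four collections `𝒰`). -/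
def InCornerChamber (a : Expo 3 → ℝ) (q : Param) : Prop :=
  (0 < q.2 ∧ dualCell a (vert0 q) = {(0, 0)}) ∨
  (0 < q.2 ∧ dualCell a (vert1 q) = {(3, 3)}) ∨
  (q.2 < 0 ∧ dualCell a (vert0 q) = {(3, 0)}) ∨
  (q.2 < 0 ∧ dualCell a (vert1 q) = {(0, 3)})

/-- Trivalent members with a vertex on the edge of `Γ` of slope `±1` cutting off a corner chamber,
different from the endpoint of this edge away from that chamber (the union of the conditions
defining the four collections `ℛ`). -/
def OnCornerEdge (a : Expo 3 → ℝ) (q : Param) : Prop :=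
  (0 < q.2 ∧ (1, 0) ∈ dualCell a (vert0 q) ∧ (0, 1) ∈ dualCell a (vert0 q) ∧
    (0, 2) ∉ dualCell a (vert0 q) ∧ (1, 1) ∉ dualCell a (vert0 q) ∧
    (2, 0) ∉ dualCell a (vert0 q)) ∨
  (0 < q.2 ∧ (2, 3) ∈ dualCell a (vert1 q) ∧ (3, 2) ∈ dualCell a (vert1 q) ∧
    (1, 3) ∉ dualCell a (vert1 q) ∧ (2, 2) ∉ dualCell a (vert1 q) ∧
    (3, 1) ∉ dualCell a (vert1 q)) ∨
  (q.2 < 0 ∧ (2, 0) ∈ dualCell a (vert0 q) ∧ (3, 1) ∈ dualCell a (vert0 q) ∧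
    (1, 0) ∉ dualCell a (vert0 q) ∧ (2, 1) ∉ dualCell a (vert0 q) ∧
    (3, 2) ∉ dualCell a (vert0 q)) ∨
  (q.2 < 0 ∧ (0, 2) ∈ dualCell a (vert1 q) ∧ (1, 3) ∈ dualCell a (vert1 q) ∧
    (0, 1) ∉ dualCell a (vert1 q) ∧ (1, 2) ∉ dualCell a (vert1 q) ∧
    (2, 3) ∉ dualCell a (vert1 q))

/-- The cells of the bounded complex `Ω^b`. -/
def PolyComplex.boundedCells (K : PolyComplex) (a : Expo 3 → ℝ) : Set (Set Param) :=
  {C ∈ K.cells | ¬ ∃ q ∈ intrinsicInterior ℝ C, InCornerChamber a q ∨ OnCornerEdge a q}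

/-- The cells of the non-special bounded complex: special cells, i.e. cells of `Ω^b` with a special
tritangent in their relative interior, are removed from `Ω^b`. -/
def PolyComplex.nonSpecialBoundedCells (K : PolyComplex) (a : Expo 3 → ℝ) : Set (Set Param) :=
  {C ∈ K.boundedCells a | ¬ ∃ q ∈ intrinsicInterior ℝ C, IsSpecial a q}

/-- The support of a collection of cells. -/
def support (S : Set (Set Param)) : Set Param := ⋃₀ S

end Tritangent

end

noncomputable section

open Set Filter Topology

namespace Tritangent

/-! ### Active exponents -/

/-! Restricted to a leg or to the edge of `Λ`, the tropical polynomial of `Γ` is convex and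
piecewise linear. Its break points, counted with the jump of the slope (`root`), number three on a
leg and six on the edge. After those that fall outside a piece are moved to the nearest vertex,
their sum minus six times each vertex is the stable intersection (`stableMult_eq_rootCount`).
Cutting `Λ` at a point off `Γ` therefore leaves on either side a multiplicity determined by the
slope at the cut.

Tritangency means that every component has even multiplicity (`isTritangent_iff_even`). This is
equivalent to the local condition `Par`: at points off `Γ` the slope is odd on legs and even on a
nondegenerate edge. Cutting gives one direction (`IsTritangent.par`). For the other, parity forces
`Λ` to follow `Γ` between certain consecutive roots, so that roots lie in a component in pairs
(`Par.isTritangent`).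

For members satisfying `Par` the removed families become open conditions on vertices. Being special
means that some leg starts in the interior of a ray of `Γ` pointing against it (`isSpecial_iff`).
Belonging to a corner family means that all exponents active at a vertex have slope at most one
along the edge (`corner_iff`). The other members, `IsGood`, form a closed set. Compatibility forces
goodness to be constant on relative interiors of cells, so the support in question is exactly the
set of good members of `Ω` (`PolyComplex.support_nonSpecialBoundedCells`).

It remains to map `Ω` continuously onto its good members, fixing them. The class is closed, and
path-connected as the connected support of a finite complex. A vertex in a corner is slid along the
edge until it leaves the corner or the edge contracts (`Admissible.cornerStep`). Next, a special
member is pushed along its leg to the end of the ray, with the edge shortened where necessary to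
keep one exponent active along it (`push_spec`). Both moves preserve `Par` until their endpoint, so
they stay in `Ω`; the symmetries of the square reduce them to one corner and one ray. A continuous
image of a path-connected set is path-connected (`isPathConnected_good`). -/

theorem mem_dualCell {n : ℕ} {a : Expo n → ℝ} {p : ℝ × ℝ} {m : Expo n} :
    m ∈ dualCell a p ↔ ∀ m', monomialValue a m' p ≤ monomialValue a m p := by
  simp [dualCell]

theorem monomialValue_eq_of_mem {n : ℕ} {a : Expo n → ℝ} {p : ℝ × ℝ} {m m' : Expo n}
    (h : m ∈ dualCell a p) (h' : m' ∈ dualCell a p) :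
    monomialValue a m p = monomialValue a m' p :=
  le_antisymm (mem_dualCell.1 h' m) (mem_dualCell.1 h m')

theorem mem_dualCell_of_eq {n : ℕ} {a : Expo n → ℝ} {p : ℝ × ℝ} {m m' : Expo n}
    (h : m ∈ dualCell a p) (h' : monomialValue a m p = monomialValue a m' p) :
    m' ∈ dualCell a p :=
  mem_dualCell.2 fun r => h' ▸ mem_dualCell.1 h r

theorem continuous_monomialValue {n : ℕ} (a : Expo n → ℝ) (m : Expo n) :
    Continuous (monomialValue a m) := by
  unfold monomialValue; fun_prop

/-- A strict inequality between monomials persists nearby, so no new exponent becomes active: the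
dual cell is upper semicontinuous. All openness arguments below rest on this. -/
theorem eventually_dualCell_subset {n : ℕ} (a : Expo n → ℝ) (p : ℝ × ℝ) :
    ∀ᶠ p' in 𝓝 p, dualCell a p' ⊆ dualCell a p := by
  have h : ∀ m : Expo n, ∀ᶠ p' in 𝓝 p, m ∈ dualCell a p' → m ∈ dualCell a p := by
    intro m
    by_cases hm : m ∈ dualCell a p
    · exact Eventually.of_forall fun _ _ => hm
    · have hm' := hm
      rw [mem_dualCell] at hm'
      push Not at hm'
      obtain ⟨m', h'⟩ := hm'
      filter_upwards [(continuous_monomialValue a m).continuousAt.eventually_lt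
        (continuous_monomialValue a m').continuousAt h'] with x hx hmx
      exact absurd (mem_dualCell.1 hmx m') (not_le.2 hx)
  filter_upwards [eventually_all.2 h] with x hx m hm using hx m hm

theorem isOpen_dualCell_forall {n : ℕ} (a : Expo n → ℝ) (P : Expo n → Prop) :
    IsOpen {p : ℝ × ℝ | ∀ m ∈ dualCell a p, P m} := by
  rw [isOpen_iff_mem_nhds]
  intro p hp
  filter_upwards [eventually_dualCell_subset a p] with x hx m hm using hp m (hx hm)

theorem isClosed_mem_dualCell {n : ℕ} (a : Expo n → ℝ) (m : Expo n) :
    IsClosed {p : ℝ × ℝ | m ∈ dualCell a p} := by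
  have : {p : ℝ × ℝ | m ∈ dualCell a p}ᶜ = {p : ℝ × ℝ | ∀ r ∈ dualCell a p, r ≠ m} := by
    ext p
    simp only [mem_compl_iff, mem_ofPred_eq]
    exact ⟨fun h r hr e => h (e ▸ hr), fun h hm => h m hm rfl⟩
  exact ⟨this ▸ isOpen_dualCell_forall a _⟩

theorem notMem_curve_iff {n : ℕ} {a : Expo n → ℝ} {p : ℝ × ℝ} :
    p ∉ curve a ↔ ∃ m, dualCell a p = {m} := by
  obtain ⟨m, hm⟩ := dualCell_nonempty a p
  constructor
  · intro h
    refine ⟨m, Finset.eq_singleton_iff_unique_mem.2 ⟨hm, fun r hr => ?_⟩⟩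
    by_contra hne
    exact h ⟨r, hr, m, hm, hne⟩
  · rintro ⟨r, hr⟩ h
    have h' : (dualCell a p).Nontrivial := h
    rw [hr] at h'
    exact Finset.not_nontrivial_singleton h'

theorem isClosed_curve {n : ℕ} (a : Expo n → ℝ) : IsClosed (curve a) := by
  constructor
  rw [isOpen_iff_mem_nhds]
  intro p hp
  obtain ⟨m, hm⟩ := notMem_curve_iff.1 hp
  filter_upwards [eventually_dualCell_subset a p] with x hx
  refine notMem_curve_iff.2 ⟨m, ?_⟩
  rw [hm] at hx
  exact Finset.Nonempty.subset_singleton_iff (dualCell_nonempty a x) |>.1 hx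

/-! ### The tropical polynomial along a line -/

/-- Along the direction `d` the monomial `m` has slope `σ m` up to a common constant, and the
values of `σ` range from `0` to `N`. -/
structure IsSlope (d : ℝ × ℝ) (σ : Expo 3 → ℕ) (N : ℕ) : Prop where
  slope : ∃ c : ℝ, ∀ m : Expo 3, ((m.1 : ℕ) : ℝ) * d.1 + ((m.2 : ℕ) : ℝ) * d.2 = σ m + c
  le : ∀ m, σ m ≤ N
  zero : ∃ m, σ m = 0
  top : ∃ m, σ m = N

theorem IsSlope.value_sub {d : ℝ × ℝ} {σ : Expo 3 → ℕ} {N : ℕ} (h : IsSlope d σ N)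
    (a : Expo 3 → ℝ) (v : ℝ × ℝ) (t : ℝ) (m m' : Expo 3) :
    monomialValue a m (v + t • d) - monomialValue a m' (v + t • d) =
      monomialValue a m v - monomialValue a m' v + t * ((σ m : ℝ) - σ m') := by
  obtain ⟨c, hc⟩ := h.slope
  have h1 := hc m
  have h2 := hc m'
  simp only [monomialValue, Prod.fst_add, Prod.snd_add, Prod.smul_fst, Prod.smul_snd, smul_eq_mul]
  linear_combination t * h1 - t * h2

/-- Convexity of a maximum of affine functions. -/
theorem IsSlope.mono {d : ℝ × ℝ} {σ : Expo 3 → ℕ} {N : ℕ} (h : IsSlope d σ N)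
    {a : Expo 3 → ℝ} {v : ℝ × ℝ} {t t' : ℝ} (ht : t < t') {m m' : Expo 3}
    (hm : m ∈ dualCell a (v + t • d)) (hm' : m' ∈ dualCell a (v + t' • d)) : σ m ≤ σ m' := by
  have h1 := mem_dualCell.1 hm m'
  have h2 := mem_dualCell.1 hm' m
  have e1 := h.value_sub a v t m m'
  have e2 := h.value_sub a v t' m m'
  have h3 : (t' - t) * ((σ m : ℝ) - σ m') ≤ 0 := by linarith
  have : (σ m : ℝ) - σ m' ≤ 0 := by
    by_contra hc
    push Not at hc
    nlinarith [mul_pos (sub_pos.2 ht) hc]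
  exact_mod_cast sub_nonpos.1 this

/-- The parameter on the line `v + t d` at which the largest active slope becomes at least `k`. -/
def root (a : Expo 3 → ℝ) (σ : Expo 3 → ℕ) (k : ℕ) (v : ℝ × ℝ) : ℝ :=
  if h : (Finset.univ.filter fun m => k ≤ σ m).Nonempty ∧
      (Finset.univ.filter fun m => σ m < k).Nonempty then
    (Finset.univ.filter fun m => k ≤ σ m).inf' h.1 fun m =>
      (Finset.univ.filter fun m => σ m < k).sup' h.2 fun m' =>
        (monomialValue a m' v - monomialValue a m v) / ((σ m : ℝ) - σ m')
  else 0

theorem continuous_root (a : Expo 3 → ℝ) (σ : Expo 3 → ℕ) (k : ℕ) : Continuous (root a σ k) := by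
  by_cases h : (Finset.univ.filter fun m => k ≤ σ m).Nonempty ∧
      (Finset.univ.filter fun m => σ m < k).Nonempty
  · have : root a σ k = fun v => (Finset.univ.filter fun m => k ≤ σ m).inf' h.1 fun m =>
        (Finset.univ.filter fun m => σ m < k).sup' h.2 fun m' =>
        (monomialValue a m' v - monomialValue a m v) / ((σ m : ℝ) - σ m') := by
      ext v; simp only [root, dif_pos h]
    rw [this]
    refine Continuous.finset_inf'_apply _ fun m _ => Continuous.finset_sup'_apply _ fun m' _ => ?_
    exact ((continuous_monomialValue a m').sub (continuous_monomialValue a m)).div_const _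
  · have : root a σ k = fun _ => 0 := by
      ext v; simp only [root, dif_neg h]
    rw [this]; exact continuous_const

/-- The quotient in `root` is the time at which `m` overtakes `m'`, so the root has been passed when
some exponent of slope at least `k` beats all those of smaller slope. That exponent need not be
active itself, but then an active one of slope at least `k` exists. -/
theorem IsSlope.root_le_iff {d : ℝ × ℝ} {σ : Expo 3 → ℕ} {N : ℕ} (h : IsSlope d σ N)
    (a : Expo 3 → ℝ) (v : ℝ × ℝ) {k : ℕ} (hk : 1 ≤ k) (hkN : k ≤ N) (t : ℝ) :
    root a σ k v ≤ t ↔ ∃ m ∈ dualCell a (v + t • d), k ≤ σ m := by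
  have hne : (Finset.univ.filter fun m => k ≤ σ m).Nonempty ∧
      (Finset.univ.filter fun m => σ m < k).Nonempty := by
    obtain ⟨m, hm⟩ := h.top
    obtain ⟨m', hm'⟩ := h.zero
    exact ⟨⟨m, by simp; omega⟩, ⟨m', by simp; omega⟩⟩
  rw [root, dif_pos hne, Finset.inf'_le_iff]
  have key : ∀ m m', k ≤ σ m → σ m' < k →
      ((monomialValue a m' v - monomialValue a m v) / ((σ m : ℝ) - σ m') ≤ t ↔
        monomialValue a m' (v + t • d) ≤ monomialValue a m (v + t • d)) := by
    intro m m' h1 h2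
    have : (0 : ℝ) < (σ m : ℝ) - σ m' := by
      have : σ m' < σ m := by omega
      have : (σ m' : ℝ) < σ m := by exact_mod_cast this
      linarith
    rw [div_le_iff₀ this]
    have := h.value_sub a v t m m'
    constructor <;> intro h <;> linarith
  constructor
  · rintro ⟨m, hm, hle⟩
    simp only [Finset.mem_filter, Finset.mem_univ, true_and] at hm
    obtain ⟨r, hr⟩ := dualCell_nonempty a (v + t • d)
    by_cases hrk : k ≤ σ r
    · exact ⟨r, hr, hrk⟩
    · have := (Finset.sup'_le_iff _ _).1 hle r (by simpa using hrk)
      rw [key m r hm (by omega)] at this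
      exact ⟨m, mem_dualCell_of_eq hr (le_antisymm this (mem_dualCell.1 hr m)), hm⟩
  · rintro ⟨m, hm, hmk⟩
    refine ⟨m, by simpa using hmk, Finset.sup'_le _ _ fun m' hm' => ?_⟩
    simp only [Finset.mem_filter, Finset.mem_univ, true_and] at hm'
    exact (key m m' hmk hm').2 (mem_dualCell.1 hm m')

theorem continuous_line (v d : ℝ × ℝ) : Continuous fun t : ℝ => v + t • d := by fun_prop

/-- If all active slopes at `t` are at least `k`, upper semicontinuity gives the same slightly
earlier, so the root lies strictly before `t`. -/
theorem IsSlope.root_lt_iff {d : ℝ × ℝ} {σ : Expo 3 → ℕ} {N : ℕ} (h : IsSlope d σ N)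
    (a : Expo 3 → ℝ) (v : ℝ × ℝ) {k : ℕ} (hk : 1 ≤ k) (hkN : k ≤ N) (t : ℝ) :
    root a σ k v < t ↔ ∀ m ∈ dualCell a (v + t • d), k ≤ σ m := by
  constructor
  · intro hlt m hm
    obtain ⟨r, hr, hrk⟩ := (h.root_le_iff a v hk hkN _).1 (le_refl (root a σ k v))
    exact hrk.trans (h.mono hlt hr hm)
  · intro hall
    have ev := ((isOpen_dualCell_forall a (fun m => k ≤ σ m)).preimage
      (continuous_line v d)).mem_nhds (show t ∈ _ from hall)
    obtain ⟨ε, hε, hb⟩ := Metric.mem_nhds_iff.1 ev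
    have hmem : t - ε / 2 ∈ Metric.ball t ε := by
      rw [Metric.mem_ball, Real.dist_eq]
      rw [show t - ε / 2 - t = -(ε / 2) by ring, abs_neg, abs_of_pos (by linarith)]
      linarith
    have := hb hmem
    obtain ⟨m, hm⟩ := dualCell_nonempty a (v + (t - ε / 2) • d)
    have := (h.root_le_iff a v hk hkN _).2 ⟨m, hm, this m hm⟩
    linarith

/-- The numbers of roots up to `t` and before `t` are the extremal active slopes. -/
theorem IsSlope.card_root_le {d : ℝ × ℝ} {σ : Expo 3 → ℕ} {N : ℕ} (h : IsSlope d σ N)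
    (a : Expo 3 → ℝ) (v : ℝ × ℝ) (t : ℝ) :
    ((Finset.Icc 1 N).filter fun k => root a σ k v ≤ t).card =
      (dualCell a (v + t • d)).sup' (dualCell_nonempty _ _) σ := by
  obtain ⟨m, hm, he⟩ := Finset.exists_mem_eq_sup' (dualCell_nonempty a (v + t • d)) σ
  have : ((Finset.Icc 1 N).filter fun k => root a σ k v ≤ t) = Finset.Icc 1 (σ m) := by
    ext k
    simp only [Finset.mem_filter, Finset.mem_Icc]
    constructor
    · rintro ⟨⟨h1, h2⟩, h3⟩
      obtain ⟨r, hr, hrk⟩ := (h.root_le_iff a v h1 h2 t).1 h3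
      exact ⟨h1, hrk.trans (he ▸ Finset.le_sup' σ hr)⟩
    · rintro ⟨h1, h2⟩
      have := h2.trans (h.le m)
      exact ⟨⟨h1, this⟩, (h.root_le_iff a v h1 this t).2 ⟨m, hm, h2⟩⟩
  rw [this, he, Nat.card_Icc]; omega

theorem IsSlope.root_mono {d : ℝ × ℝ} {σ : Expo 3 → ℕ} {N : ℕ} (h : IsSlope d σ N)
    (a : Expo 3 → ℝ) (v : ℝ × ℝ) {k l : ℕ} (hk : 1 ≤ k) (hkl : k ≤ l) (hl : l ≤ N) :
    root a σ k v ≤ root a σ l v := by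
  obtain ⟨m, hm, h1⟩ := (h.root_le_iff a v (hk.trans hkl) hl _).1 le_rfl
  exact (h.root_le_iff a v hk (hkl.trans hl) _).2 ⟨m, hm, hkl.trans h1⟩

/-! ### Slopes along the pieces of a `(1,1)`-curve, and mixed areas -/

/-- The slope of the exponent `m` along a leg, outwards and shifted to the range `0, …, 3`. -/
def legSlope : Leg → Expo 3 → ℕ
  | .negHor, m => 3 - m.1
  | .negVert, m => 3 - m.2
  | .posHor, m => m.1
  | .posVert, m => m.2

/-- The slope of the exponent `m` in the direction `(1, 1)` (if `b`), or `(-1, 1)` shifted to the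
range `0, …, 6`. -/
def diagSlope : Bool → Expo 3 → ℕ
  | true, m => m.1 + m.2
  | false, m => 3 + m.2 - m.1

/-- The sum defining the stable intersection multiplicity, for the dual cells `A` and `B`. -/
def mixed (A : Finset (Expo 3)) (B : Finset (Expo 1)) (hB : B.Nonempty) : ℤ :=
  ∑ e ∈ orientedEdges A, B.sup' hB (normalPairing e)

/-- Points, segments and unimodular triangles. -/
def IsSimplexCell (A : Finset (Expo 3)) : Prop :=
  (∃ q, A = {q}) ∨ (∃ q r, q ≠ r ∧ A = {q, r}) ∨ ∃ q r s, det3 q r s = 1 ∧ A = {q, r, s}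

/-- The dual cell of a leg. -/
def legCell : Leg → Finset (Expo 1)
  | .negHor => {(0, 0), (0, 1)}
  | .negVert => {(0, 0), (1, 0)}
  | .posHor => {(1, 0), (1, 1)}
  | .posVert => {(0, 1), (1, 1)}

/-- The dual cell of the edge, of slope `1` if `b` and of slope `-1` otherwise. -/
def edgeCell : Bool → Finset (Expo 1)
  | true => {(1, 0), (0, 1)}
  | false => {(0, 0), (1, 1)}

/-- The dual cell of the lowest vertex. -/
def lowCell : Bool → Finset (Expo 1)
  | true => {(0, 0), (1, 0), (0, 1)}
  | false => {(0, 0), (1, 0), (1, 1)}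

/-- The dual cell of the highest vertex. -/
def highCell : Bool → Finset (Expo 1)
  | true => {(1, 0), (0, 1), (1, 1)}
  | false => {(0, 0), (0, 1), (1, 1)}

/-- The horizontal leg at the lowest vertex. -/
def lowLeg : Bool → Leg
  | true => .negHor
  | false => .posHor

/-- The horizontal leg at the highest vertex. -/
def highLeg : Bool → Leg
  | true => .posHor
  | false => .negHor

theorem legCell_nonempty (L : Leg) : (legCell L).Nonempty := by
  cases L <;> exact Finset.insert_nonempty _ _

theorem edgeCell_nonempty (b : Bool) : (edgeCell b).Nonempty := by
  cases b <;> exact Finset.insert_nonempty _ _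

theorem lowCell_nonempty (b : Bool) : (lowCell b).Nonempty := by
  cases b <;> exact Finset.insert_nonempty _ _

theorem highCell_nonempty (b : Bool) : (highCell b).Nonempty := by
  cases b <;> exact Finset.insert_nonempty _ _

set_option maxHeartbeats 4000000 in
-- Mixed area is symmetric: the sum over the edges of `Γ` can be replaced by a sum, over the
-- directions in which `Λ` leaves the point, of the largest outgoing slope of the polynomial of `Γ`.
-- The constant subtracted here and in the next lemmas is the total of the shifts that make these
-- slopes nonnegative. Only finitely many simplices occur, and each one is checked.
theorem mixed_leg {A : Finset (Expo 3)} (hA : IsSimplexCell A) (L : Leg) :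
    mixed A (legCell L) (legCell_nonempty L) =
      ((A.sup (legSlope L) + A.sup (fun m => 3 - legSlope L m) : ℕ) : ℤ) - 3 := by
  rcases hA with ⟨q, rfl⟩ | ⟨q, r, h, rfl⟩ | ⟨q, r, s, h, rfl⟩
  · revert q; unfold mixed; cases L <;> decide +kernel
  · revert q r; unfold mixed; cases L <;> decide +kernel
  · revert q r s; unfold mixed; cases L <;> decide +kernel

set_option maxHeartbeats 4000000 in
theorem mixed_edge {A : Finset (Expo 3)} (hA : IsSimplexCell A) (b : Bool) :
    mixed A (edgeCell b) (edgeCell_nonempty b) =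
      ((A.sup (diagSlope b) + A.sup (fun m => 6 - diagSlope b m) : ℕ) : ℤ) - 6 := by
  rcases hA with ⟨q, rfl⟩ | ⟨q, r, h, rfl⟩ | ⟨q, r, s, h, rfl⟩
  · revert q; unfold mixed; cases b <;> decide +kernel
  · revert q r; unfold mixed; cases b <;> decide +kernel
  · revert q r s; unfold mixed; cases b <;> decide +kernel

set_option maxHeartbeats 4000000 in
theorem mixed_low {A : Finset (Expo 3)} (hA : IsSimplexCell A) (b : Bool) :
    mixed A (lowCell b) (lowCell_nonempty b) =
      ((A.sup (legSlope (lowLeg b)) + A.sup (legSlope .negVert) + A.sup (diagSlope b) : ℕ) : ℤ)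
        - 6 := by
  rcases hA with ⟨q, rfl⟩ | ⟨q, r, h, rfl⟩ | ⟨q, r, s, h, rfl⟩
  · revert q; unfold mixed; cases b <;> decide +kernel
  · revert q r; unfold mixed; cases b <;> decide +kernel
  · revert q r s; unfold mixed; cases b <;> decide +kernel

set_option maxHeartbeats 4000000 in
theorem mixed_high {A : Finset (Expo 3)} (hA : IsSimplexCell A) (b : Bool) :
    mixed A (highCell b) (highCell_nonempty b) =
      ((A.sup (legSlope (highLeg b)) + A.sup (legSlope .posVert) +
        A.sup (fun m => 6 - diagSlope b m) : ℕ) : ℤ) - 6 := by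
  rcases hA with ⟨q, rfl⟩ | ⟨q, r, h, rfl⟩ | ⟨q, r, s, h, rfl⟩
  · revert q; unfold mixed; cases b <;> decide +kernel
  · revert q r; unfold mixed; cases b <;> decide +kernel
  · revert q r s; unfold mixed; cases b <;> decide +kernel

set_option maxHeartbeats 4000000 in
theorem mixed_square {A : Finset (Expo 3)} (hA : IsSimplexCell A) :
    mixed A Finset.univ Finset.univ_nonempty =
      ((A.sup (legSlope .negHor) + A.sup (legSlope .negVert) + A.sup (legSlope .posHor) +
        A.sup (legSlope .posVert) : ℕ) : ℤ) - 6 := by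
  rcases hA with ⟨q, rfl⟩ | ⟨q, r, h, rfl⟩ | ⟨q, r, s, h, rfl⟩
  · revert q; unfold mixed; decide +kernel
  · revert q r; unfold mixed; decide +kernel
  · revert q r s; unfold mixed; decide +kernel

theorem stableMult_eq_mixed {a : Expo 3 → ℝ} {b : Expo 1 → ℝ} {p : ℝ × ℝ} {B : Finset (Expo 1)}
    (h : dualCell b p = B) (hB : B.Nonempty) : stableMult a b p = mixed (dualCell a p) B hB := by
  subst h; rfl

/-! ### Smoothness -/

theorem det3_eq_zero_slope {m m' r : Expo 3} :
    det3 m m' r = 0 ↔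
      (((m'.2 : ℕ) : ℝ) - (m.2 : ℕ)) * ((r.1 : ℕ) : ℝ) - (((m'.1 : ℕ) : ℝ) - (m.1 : ℕ)) * ((r.2 : ℕ) : ℝ)
      = (((m'.2 : ℕ) : ℝ) - (m.2 : ℕ)) * ((m.1 : ℕ) : ℝ) -
        (((m'.1 : ℕ) : ℝ) - (m.1 : ℕ)) * ((m.2 : ℕ) : ℝ) := by
  have : ((det3 m m' r : ℤ) : ℝ) = -(((((m'.2 : ℕ) : ℝ) - (m.2 : ℕ)) * ((r.1 : ℕ) : ℝ) -
      (((m'.1 : ℕ) : ℝ) - (m.1 : ℕ)) * ((r.2 : ℕ) : ℝ)) -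
      ((((m'.2 : ℕ) : ℝ) - (m.2 : ℕ)) * ((m.1 : ℕ) : ℝ) -
        (((m'.1 : ℕ) : ℝ) - (m.1 : ℕ)) * ((m.2 : ℕ) : ℝ))) := by
    simp only [det3]; push_cast; ring
  rw [← @Int.cast_eq_zero ℝ, this, neg_eq_zero, sub_eq_zero]

/-- Two active exponents of a smooth curve form an edge of a unimodular triangle, and no other
active exponent is collinear with them. -/
theorem IsSmooth.exists_triangle {a : Expo 3 → ℝ} (ha : IsSmooth a) {p : ℝ × ℝ} {m m' : Expo 3}
    (hne : m ≠ m') (hm : m ∈ dualCell a p) (hm' : m' ∈ dualCell a p) :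
    ∃ r, |det3 m m' r| = 1 ∧ ∀ s ∈ dualCell a p, det3 m m' s = 0 → s = m ∨ s = m' := by
  -- The direction `d` is orthogonal to `m' - m`, oriented so that some exponent lies strictly
  -- further along it. Moving along `d` keeps `m` and `m'` tied.
  obtain ⟨d, hd, r₀, hr₀⟩ : ∃ d : ℝ × ℝ,
      (∀ s : Expo 3, det3 m m' s = 0 ↔ ((s.1 : ℕ) : ℝ) * d.1 + ((s.2 : ℕ) : ℝ) * d.2 =
        ((m.1 : ℕ) : ℝ) * d.1 + ((m.2 : ℕ) : ℝ) * d.2) ∧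
      ∃ r : Expo 3, ((m.1 : ℕ) : ℝ) * d.1 + ((m.2 : ℕ) : ℝ) * d.2 <
        ((r.1 : ℕ) : ℝ) * d.1 + ((r.2 : ℕ) : ℝ) * d.2 := by
    set A : ℝ := ((m'.2 : ℕ) : ℝ) - (m.2 : ℕ)
    set B : ℝ := ((m'.1 : ℕ) : ℝ) - (m.1 : ℕ)
    have hdet : ∀ s : Expo 3, det3 m m' s = 0 ↔ A * ((s.1 : ℕ) : ℝ) - B * ((s.2 : ℕ) : ℝ) =
        A * ((m.1 : ℕ) : ℝ) - B * ((m.2 : ℕ) : ℝ) := fun s => det3_eq_zero_slope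
    obtain ⟨r, hr⟩ : ∃ r, det3 m m' r ≠ 0 := by
      clear hdet hm hm'
      clear_value A B
      revert m m'; decide +kernel
    rw [Ne, hdet] at hr
    rcases lt_or_gt_of_ne hr with h | h
    · refine ⟨(-A, B), fun s => ?_, r, ?_⟩
      · rw [hdet]; constructor <;> intro h <;> linarith
      · simp only; linarith
    · refine ⟨(A, -B), fun s => ?_, r, ?_⟩
      · rw [hdet]; constructor <;> intro h <;> linarith
      · simp only; linarith
  set φ : Expo 3 → ℝ := fun s => ((s.1 : ℕ) : ℝ) * d.1 + ((s.2 : ℕ) : ℝ) * d.2 with hφ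
  have hval : ∀ s t, monomialValue a s (p + t • d) = monomialValue a s p + t * φ s := by
    intro s t
    simp only [monomialValue, hφ, Prod.fst_add, Prod.snd_add, Prod.smul_fst, Prod.smul_snd,
      smul_eq_mul]
    ring
  -- The exponent `r` is the first to catch up with `m`. There the dual cell is two-dimensional and
  -- still contains all active exponents collinear with `m` and `m'`, so smoothness applies.
  obtain ⟨r, hr, hmin⟩ := Finset.exists_min_image (Finset.univ.filter fun s => φ m < φ s)
    (fun s => (monomialValue a m p - monomialValue a s p) / (φ s - φ m)) ⟨r₀, by simpa using hr₀⟩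
  simp only [Finset.mem_filter, Finset.mem_univ, true_and] at hr hmin
  set t := (monomialValue a m p - monomialValue a r p) / (φ r - φ m) with ht
  have ht0 : 0 ≤ t := div_nonneg (sub_nonneg.2 (mem_dualCell.1 hm r)) (by linarith)
  have hmt : m ∈ dualCell a (p + t • d) := by
    rw [mem_dualCell]
    intro s
    rw [hval, hval]
    rcases lt_or_ge (φ m) (φ s) with h | h
    · have := hmin s h
      rw [le_div_iff₀ (by linarith)] at this
      linarith
    · have := mem_dualCell.1 hm s
      have := mul_le_mul_of_nonneg_left h ht0
      linarith
  have hrt : r ∈ dualCell a (p + t • d) := by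
    refine mem_dualCell_of_eq hmt ?_
    rw [hval, hval]
    have : t * (φ r - φ m) = monomialValue a m p - monomialValue a r p :=
      div_mul_cancel₀ _ (by linarith)
    linarith
  have hcol : ∀ s ∈ dualCell a p, det3 m m' s = 0 → s ∈ dualCell a (p + t • d) := by
    intro s hs h0
    refine mem_dualCell_of_eq hmt ?_
    rw [hval, hval, monomialValue_eq_of_mem hm hs, show φ s = φ m from (hd s).1 h0]
  have hm't := hcol m' hm' (by simp only [det3]; ring)
  have hdetr : det3 m m' r ≠ 0 := fun h => hr.ne' ((hd r).1 h)
  obtain ⟨h1, h2⟩ := ha _ m hmt m' hm't r hrt hdetr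
  refine ⟨r, h1, fun s hs h0 => ?_⟩
  have := hcol s hs h0
  rw [h2] at this
  simp only [Finset.mem_insert, Finset.mem_singleton] at this
  rcases this with h | h | h
  · exact Or.inl h
  · exact Or.inr h
  · exact absurd (h ▸ h0) hdetr

/-- Smoothness speaks only of two-dimensional cells; a collinear cell has at most two elements
because it is contained in a side of a unimodular triangle. -/
theorem IsSmooth.isSimplexCell {a : Expo 3 → ℝ} (ha : IsSmooth a) (p : ℝ × ℝ) :
    IsSimplexCell (dualCell a p) := by
  by_cases hp : p ∈ curve a
  · obtain ⟨m, hm, m', hm', hne⟩ := hp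
    by_cases hcol : ∀ s ∈ dualCell a p, det3 m m' s = 0
    · obtain ⟨r, -, h⟩ := ha.exists_triangle hne hm hm'
      refine Or.inr (Or.inl ⟨m, m', hne, ?_⟩)
      ext s
      simp only [Finset.mem_insert, Finset.mem_singleton]
      refine ⟨fun hs => h s hs (hcol s hs), ?_⟩
      rintro (rfl | rfl) <;> assumption
    · push Not at hcol
      obtain ⟨s, hs, hdet⟩ := hcol
      obtain ⟨h1, h2⟩ := ha p m hm m' hm' s hs hdet
      rcases (abs_eq (by norm_num)).1 h1 with h | h
      · exact Or.inr (Or.inr ⟨m, m', s, h, h2⟩)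
      · refine Or.inr (Or.inr ⟨m', m, s, ?_, ?_⟩)
        · have : det3 m' m s = - det3 m m' s := by simp only [det3]; ring
          rw [this, h]; rfl
        · rw [h2, Finset.insert_comm]
  · obtain ⟨m, hm⟩ := notMem_curve_iff.1 hp
    exact Or.inl ⟨m, hm⟩

/-! ### The pieces of a `(1,1)`-curve -/

/-- The point at distance `t` on a leg. -/
def legPt (q : Param) (L : Leg) (t : ℝ) : ℝ × ℝ := legVertex q L + t • legDir L

/-- Whether the edge has slope `1`. -/
def edgeSign (q : Param) : Bool := decide (0 ≤ q.2)

/-- The direction of the edge, upwards. -/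
def edgeDir (b : Bool) : ℝ × ℝ := (if b then 1 else -1, 1)

/-- The point of the edge with height `t` over the lowest vertex. -/
def edgePt (q : Param) (t : ℝ) : ℝ × ℝ := vert0 q + t • edgeDir (edgeSign q)

theorem isSlope_leg (L : Leg) : IsSlope (legDir L) (legSlope L) 3 := by
  have hs : ∀ i : Fin 4, ((3 - (i : ℕ) : ℕ) : ℝ) = 3 - (i : ℕ) := fun i => by
    rw [Nat.cast_sub (by omega)]; norm_num
  cases L
  · exact ⟨⟨-3, fun m => by simp only [legSlope, legDir, hs]; ring⟩,
      fun m => by simp only [legSlope]; omega, ⟨(3, 0), rfl⟩, ⟨(0, 0), rfl⟩⟩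
  · exact ⟨⟨-3, fun m => by simp only [legSlope, legDir, hs]; ring⟩,
      fun m => by simp only [legSlope]; omega, ⟨(0, 3), rfl⟩, ⟨(0, 0), rfl⟩⟩
  · exact ⟨⟨0, fun m => by simp [legSlope, legDir]⟩, fun m => by simp only [legSlope]; omega,
      ⟨(0, 0), rfl⟩, ⟨(3, 0), rfl⟩⟩
  · exact ⟨⟨0, fun m => by simp [legSlope, legDir]⟩, fun m => by simp only [legSlope]; omega,
      ⟨(0, 0), rfl⟩, ⟨(0, 3), rfl⟩⟩

theorem isSlope_diag (b : Bool) : IsSlope (edgeDir b) (diagSlope b) 6 := by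
  cases b
  · refine ⟨⟨-3, fun m => ?_⟩, fun m => by simp only [diagSlope]; omega,
      ⟨(3, 0), rfl⟩, ⟨(0, 3), rfl⟩⟩
    simp only [edgeDir, diagSlope, Bool.false_eq_true, if_false]
    rw [Nat.cast_sub (by omega)]
    push_cast; ring
  · exact ⟨⟨0, fun m => by simp [edgeDir, diagSlope]⟩, fun m => by simp only [diagSlope]; omega,
      ⟨(0, 0), rfl⟩, ⟨(3, 3), rfl⟩⟩

theorem edgePt_zero (q : Param) : edgePt q 0 = vert0 q := by simp [edgePt]

theorem legPt_zero (q : Param) (L : Leg) : legPt q L 0 = legVertex q L := by simp [legPt]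

theorem edgePt_abs (q : Param) : edgePt q |q.2| = vert1 q := by
  rcases le_or_gt 0 q.2 with h | h
  · simp [edgePt, edgeDir, edgeSign, vert1, vert0, h, Prod.ext_iff, abs_of_nonneg h]
  · simp [edgePt, edgeDir, edgeSign, vert1, vert0, not_le.2 h, Prod.ext_iff, abs_of_neg h]

theorem expo_one_cases (m : Expo 1) : m = (0, 0) ∨ m = (1, 0) ∨ m = (0, 1) ∨ m = (1, 1) := by
  revert m; decide

/-- In the coordinates `w`, `h` the four monomials are `0`, `w`, `h` and `w + h - q.2`. When `q.2 <
0` the height `h` is measured from the upper vertex, which explains the term `min q.2 0`. -/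
theorem mem_dualCell_lineCoeff {q : Param} {p : ℝ × ℝ} {w h : ℝ} (hw : p.1 - q.1.1 = w)
    (hh : p.2 - q.1.2 + min q.2 0 = h) :
    ((0, 0) ∈ dualCell (lineCoeff q) p ↔ w ≤ 0 ∧ h ≤ 0 ∧ w + h ≤ q.2) ∧
    ((1, 0) ∈ dualCell (lineCoeff q) p ↔ 0 ≤ w ∧ h ≤ w ∧ h ≤ q.2) ∧
    ((0, 1) ∈ dualCell (lineCoeff q) p ↔ 0 ≤ h ∧ w ≤ h ∧ w ≤ q.2) ∧
    ((1, 1) ∈ dualCell (lineCoeff q) p ↔ q.2 ≤ w + h ∧ q.2 ≤ h ∧ q.2 ≤ w) := by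
  have hall : ∀ m, m ∈ dualCell (lineCoeff q) p ↔
      monomialValue (lineCoeff q) (0, 0) p ≤ monomialValue (lineCoeff q) m p ∧
      monomialValue (lineCoeff q) (1, 0) p ≤ monomialValue (lineCoeff q) m p ∧
      monomialValue (lineCoeff q) (0, 1) p ≤ monomialValue (lineCoeff q) m p ∧
      monomialValue (lineCoeff q) (1, 1) p ≤ monomialValue (lineCoeff q) m p := by
    intro m
    rw [mem_dualCell]
    constructor
    · exact fun h => ⟨h _, h _, h _, h _⟩
    · rintro ⟨h0, h1, h2, h3⟩ m'
      rcases expo_one_cases m' with rfl | rfl | rfl | rfl <;> assumption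
  have e0 : monomialValue (lineCoeff q) (0, 0) p = 0 := by simp [monomialValue, lineCoeff]
  have e1 : monomialValue (lineCoeff q) (1, 0) p = w := by
    simp [monomialValue, lineCoeff]; linarith
  have e2 : monomialValue (lineCoeff q) (0, 1) p = h := by
    simp [monomialValue, lineCoeff]; linarith
  have e3 : monomialValue (lineCoeff q) (1, 1) p = w + h - q.2 := by
    simp [monomialValue, lineCoeff]; linarith
  simp only [hall, e0, e1, e2, e3]
  refine ⟨?_, ?_, ?_, ?_⟩ <;> constructor <;> rintro ⟨h1, h2, h3⟩ <;>
    (try obtain ⟨h3, h4⟩ := h3) <;> refine ⟨?_, ?_, ?_⟩ <;> (try refine ⟨?_, ?_⟩) <;> linarith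

theorem dualCell_lineCoeff_eq {q : Param} {p : ℝ × ℝ} {w h : ℝ} {B : Finset (Expo 1)}
    (hw : p.1 - q.1.1 = w) (hh : p.2 - q.1.2 + min q.2 0 = h)
    (h0 : (w ≤ 0 ∧ h ≤ 0 ∧ w + h ≤ q.2) ↔ (0, 0) ∈ B)
    (h1 : (0 ≤ w ∧ h ≤ w ∧ h ≤ q.2) ↔ (1, 0) ∈ B)
    (h2 : (0 ≤ h ∧ w ≤ h ∧ w ≤ q.2) ↔ (0, 1) ∈ B)
    (h3 : (q.2 ≤ w + h ∧ q.2 ≤ h ∧ q.2 ≤ w) ↔ (1, 1) ∈ B) : dualCell (lineCoeff q) p = B := by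
  obtain ⟨e0, e1, e2, e3⟩ := mem_dualCell_lineCoeff hw hh
  ext m
  rcases expo_one_cases m with rfl | rfl | rfl | rfl
  · rw [e0, h0]
  · rw [e1, h1]
  · rw [e2, h2]
  · rw [e3, h3]

theorem dualCell_lineCoeff_legPt (q : Param) (L : Leg) {t : ℝ} (ht : 0 < t) :
    dualCell (lineCoeff q) (legPt q L t) = legCell L := by
  rcases le_or_gt 0 q.2 with h | h
  · have hm := min_eq_right h
    have ha := abs_of_nonneg h
    cases L
    · refine dualCell_lineCoeff_eq (w := -t) (h := 0) ?_ ?_ ?_ ?_ ?_ ?_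
      · simp [hm, ha, h, legPt, legVertex, vert0, vert1, legDir] <;> ring
      · simp [hm, ha, h, legPt, legVertex, vert0, vert1, legDir] <;> ring
      all_goals
        first
        | exact iff_of_true ⟨by linarith, by linarith, by linarith⟩ (by decide)
        | exact iff_of_false (fun c => by linarith [c.1, c.2.1, c.2.2]) (by decide)
    · refine dualCell_lineCoeff_eq (w := 0) (h := -t) ?_ ?_ ?_ ?_ ?_ ?_
      · simp [hm, ha, h, legPt, legVertex, vert0, vert1, legDir] <;> ring
      · simp [hm, ha, h, legPt, legVertex, vert0, vert1, legDir] <;> ring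
      all_goals
        first
        | exact iff_of_true ⟨by linarith, by linarith, by linarith⟩ (by decide)
        | exact iff_of_false (fun c => by linarith [c.1, c.2.1, c.2.2]) (by decide)
    · refine dualCell_lineCoeff_eq (w := q.2 + t) (h := q.2) ?_ ?_ ?_ ?_ ?_ ?_
      · simp [hm, ha, h, legPt, legVertex, vert0, vert1, legDir] <;> ring
      · simp [hm, ha, h, legPt, legVertex, vert0, vert1, legDir] <;> ring
      all_goals
        first
        | exact iff_of_true ⟨by linarith, by linarith, by linarith⟩ (by decide)
        | exact iff_of_false (fun c => by linarith [c.1, c.2.1, c.2.2]) (by decide)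
    · refine dualCell_lineCoeff_eq (w := q.2) (h := q.2 + t) ?_ ?_ ?_ ?_ ?_ ?_
      · simp [hm, ha, h, legPt, legVertex, vert0, vert1, legDir] <;> ring
      · simp [hm, ha, h, legPt, legVertex, vert0, vert1, legDir] <;> ring
      all_goals
        first
        | exact iff_of_true ⟨by linarith, by linarith, by linarith⟩ (by decide)
        | exact iff_of_false (fun c => by linarith [c.1, c.2.1, c.2.2]) (by decide)
  · have hm := min_eq_left h.le
    have ha := abs_of_neg h
    have h' := not_le.2 h
    cases L
    · refine dualCell_lineCoeff_eq (w := q.2 - t) (h := 0) ?_ ?_ ?_ ?_ ?_ ?_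
      · simp [hm, ha, h', legPt, legVertex, vert0, vert1, legDir] <;> ring
      · simp [hm, ha, h', legPt, legVertex, vert0, vert1, legDir] <;> ring
      all_goals
        first
        | exact iff_of_true ⟨by linarith, by linarith, by linarith⟩ (by decide)
        | exact iff_of_false (fun c => by linarith [c.1, c.2.1, c.2.2]) (by decide)
    · refine dualCell_lineCoeff_eq (w := 0) (h := q.2 - t) ?_ ?_ ?_ ?_ ?_ ?_
      · simp [hm, ha, h', legPt, legVertex, vert0, vert1, legDir] <;> ring
      · simp [hm, ha, h', legPt, legVertex, vert0, vert1, legDir] <;> ring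
      all_goals
        first
        | exact iff_of_true ⟨by linarith, by linarith, by linarith⟩ (by decide)
        | exact iff_of_false (fun c => by linarith [c.1, c.2.1, c.2.2]) (by decide)
    · refine dualCell_lineCoeff_eq (w := t) (h := q.2) ?_ ?_ ?_ ?_ ?_ ?_
      · simp [hm, ha, h', legPt, legVertex, vert0, vert1, legDir] <;> ring
      · simp [hm, ha, h', legPt, legVertex, vert0, vert1, legDir] <;> ring
      all_goals
        first
        | exact iff_of_true ⟨by linarith, by linarith, by linarith⟩ (by decide)
        | exact iff_of_false (fun c => by linarith [c.1, c.2.1, c.2.2]) (by decide)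
    · refine dualCell_lineCoeff_eq (w := q.2) (h := t) ?_ ?_ ?_ ?_ ?_ ?_
      · simp [hm, ha, h', legPt, legVertex, vert0, vert1, legDir] <;> ring
      · simp [hm, ha, h', legPt, legVertex, vert0, vert1, legDir] <;> ring
      all_goals
        first
        | exact iff_of_true ⟨by linarith, by linarith, by linarith⟩ (by decide)
        | exact iff_of_false (fun c => by linarith [c.1, c.2.1, c.2.2]) (by decide)

theorem dualCell_lineCoeff_edgePt (q : Param) {t : ℝ} (ht : 0 < t) (ht' : t < |q.2|) :
    dualCell (lineCoeff q) (edgePt q t) = edgeCell (edgeSign q) := by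
  rcases le_or_gt 0 q.2 with h | h
  · have hm := min_eq_right h
    have ha := abs_of_nonneg h
    have hs : edgeSign q = true := decide_eq_true h
    rw [ha] at ht'
    rw [hs]
    refine dualCell_lineCoeff_eq (w := t) (h := t) ?_ ?_ ?_ ?_ ?_ ?_
    · simp [hm, hs, edgePt, vert0, edgeDir, add_comm, h] <;> ring
    · simp [hm, hs, edgePt, vert0, edgeDir, add_comm, h] <;> ring
    all_goals
      first
      | exact iff_of_true ⟨by linarith, by linarith, by linarith⟩ (by decide)
      | exact iff_of_false (fun c => by linarith [c.1, c.2.1, c.2.2]) (by decide)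
  · have hm := min_eq_left h.le
    have ha := abs_of_neg h
    have hs : edgeSign q = false := decide_eq_false (not_le.2 h)
    rw [ha] at ht'
    rw [hs]
    refine dualCell_lineCoeff_eq (w := -t) (h := q.2 + t) ?_ ?_ ?_ ?_ ?_ ?_
    · simp [hm, hs, edgePt, vert0, edgeDir, add_comm] <;> ring
    · simp [hm, hs, edgePt, vert0, edgeDir, add_comm] <;> ring
    all_goals
      first
      | exact iff_of_true ⟨by linarith, by linarith, by linarith⟩ (by decide)
      | exact iff_of_false (fun c => by linarith [c.1, c.2.1, c.2.2]) (by decide)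

theorem dualCell_lineCoeff_vert0 (q : Param) (hq : q.2 ≠ 0) :
    dualCell (lineCoeff q) (vert0 q) = lowCell (edgeSign q) := by
  rcases le_or_gt 0 q.2 with h | h
  · have hm := min_eq_right h
    have ha := abs_of_nonneg h
    have hs : edgeSign q = true := decide_eq_true h
    have hq' := lt_of_le_of_ne h (Ne.symm hq)
    rw [hs]
    refine dualCell_lineCoeff_eq (w := 0) (h := 0) ?_ ?_ ?_ ?_ ?_ ?_
    · simp [hm, vert0, h] <;> ring
    · simp [hm, vert0, h] <;> ring
    all_goals
      first
      | exact iff_of_true ⟨by linarith, by linarith, by linarith⟩ (by decide)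
      | exact iff_of_false (fun c => by linarith [c.1, c.2.1, c.2.2]) (by decide)
  · have hm := min_eq_left h.le
    have ha := abs_of_neg h
    have hs : edgeSign q = false := decide_eq_false (not_le.2 h)
    rw [hs]
    refine dualCell_lineCoeff_eq (w := 0) (h := q.2) ?_ ?_ ?_ ?_ ?_ ?_
    · simp [hm, vert0] <;> ring
    · simp [hm, vert0] <;> ring
    all_goals
      first
      | exact iff_of_true ⟨by linarith, by linarith, by linarith⟩ (by decide)
      | exact iff_of_false (fun c => by linarith [c.1, c.2.1, c.2.2]) (by decide)

theorem dualCell_lineCoeff_vert1 (q : Param) (hq : q.2 ≠ 0) :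
    dualCell (lineCoeff q) (vert1 q) = highCell (edgeSign q) := by
  rcases le_or_gt 0 q.2 with h | h
  · have hm := min_eq_right h
    have ha := abs_of_nonneg h
    have hs : edgeSign q = true := decide_eq_true h
    have hq' := lt_of_le_of_ne h (Ne.symm hq)
    rw [hs]
    refine dualCell_lineCoeff_eq (w := q.2) (h := q.2) ?_ ?_ ?_ ?_ ?_ ?_
    · simp [hm, ha, vert1, h] <;> ring
    · simp [hm, ha, vert1, h] <;> ring
    all_goals
      first
      | exact iff_of_true ⟨by linarith, by linarith, by linarith⟩ (by decide)
      | exact iff_of_false (fun c => by linarith [c.1, c.2.1, c.2.2]) (by decide)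
  · have hm := min_eq_left h.le
    have ha := abs_of_neg h
    have hs : edgeSign q = false := decide_eq_false (not_le.2 h)
    rw [hs]
    refine dualCell_lineCoeff_eq (w := q.2) (h := 0) ?_ ?_ ?_ ?_ ?_ ?_
    · simp [hm, ha, vert1] <;> ring
    · simp [hm, ha, vert1] <;> ring
    all_goals
      first
      | exact iff_of_true ⟨by linarith, by linarith, by linarith⟩ (by decide)
      | exact iff_of_false (fun c => by linarith [c.1, c.2.1, c.2.2]) (by decide)

theorem dualCell_lineCoeff_center (q : Param) (hq : q.2 = 0) :
    dualCell (lineCoeff q) (vert0 q) = Finset.univ := by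
  refine dualCell_lineCoeff_eq (w := 0) (h := 0) ?_ ?_ ?_ ?_ ?_ ?_
  · simp [hq, vert0] <;> ring
  · simp [hq, vert0] <;> ring
  all_goals
    first
    | exact iff_of_true ⟨by linarith, by linarith, by linarith⟩ (by decide)
    | exact iff_of_false (fun c => by linarith [c.1, c.2.1, c.2.2]) (by decide)

/-- Every point of a `(1,1)`-curve lies in the interior of a leg or of the edge, or is a vertex. -/
theorem mem_lam_cases {q : Param} {p : ℝ × ℝ} (hp : p ∈ lam q) :
    (∃ L t, 0 < t ∧ p = legPt q L t) ∨ (∃ t, 0 < t ∧ t < |q.2| ∧ p = edgePt q t) ∨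
      p = vert0 q ∨ p = vert1 q := by
  have hpairs : ((0, 0) ∈ dualCell (lineCoeff q) p ∧ (1, 0) ∈ dualCell (lineCoeff q) p) ∨
      ((0, 0) ∈ dualCell (lineCoeff q) p ∧ (0, 1) ∈ dualCell (lineCoeff q) p) ∨
      ((0, 0) ∈ dualCell (lineCoeff q) p ∧ (1, 1) ∈ dualCell (lineCoeff q) p) ∨
      ((1, 0) ∈ dualCell (lineCoeff q) p ∧ (0, 1) ∈ dualCell (lineCoeff q) p) ∨
      ((1, 0) ∈ dualCell (lineCoeff q) p ∧ (1, 1) ∈ dualCell (lineCoeff q) p) ∨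
      ((0, 1) ∈ dualCell (lineCoeff q) p ∧ (1, 1) ∈ dualCell (lineCoeff q) p) := by
    obtain ⟨m, hm, m', hm', hne⟩ := hp
    rcases expo_one_cases m with rfl | rfl | rfl | rfl <;>
      rcases expo_one_cases m' with rfl | rfl | rfl | rfl <;>
      first
      | exact absurd rfl hne
      | simp only [Finset.mem_coe] at hm hm'
        simp only [hm, hm', and_self, and_true, true_and, true_or, or_true]
  obtain ⟨h0, h1, h2, h3⟩ := mem_dualCell_lineCoeff (q := q) (p := p) rfl rfl
  rw [h0, h1, h2, h3] at hpairs
  clear hp h0 h1 h2 h3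
  obtain ⟨x, y⟩ := p
  obtain ⟨⟨u, v⟩, l⟩ := q
  simp only at hpairs ⊢
  rcases le_or_gt 0 l with h | h
  · have hm := min_eq_right h
    rw [hm] at hpairs
    have key : (y = v ∧ x < u) ∨ (x = u ∧ y < v) ∨ (y = v + l ∧ u + l < x) ∨
        (x = u + l ∧ v + l < y) ∨ (u < x ∧ x < u + l ∧ y = v + (x - u)) ∨
        (x = u ∧ y = v) ∨ (x = u + l ∧ y = v + l) := by
      rcases hpairs with ⟨h1, h2⟩ | ⟨h1, h2⟩ | ⟨h1, h2⟩ | ⟨h1, h2⟩ | ⟨h1, h2⟩ | ⟨h1, h2⟩ <;>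
        obtain ⟨h3, h4, h5⟩ := h1 <;> obtain ⟨h6, h7, h8⟩ := h2
      · have hx : x = u := by linarith
        rcases (show y ≤ v by linarith).lt_or_eq with hy | hy
        · exact Or.inr (Or.inl ⟨hx, hy⟩)
        · exact Or.inr (Or.inr (Or.inr (Or.inr (Or.inr (Or.inl ⟨hx, hy⟩)))))
      · have hy : y = v := by linarith
        rcases (show x ≤ u by linarith).lt_or_eq with hx | hx
        · exact Or.inl ⟨hy, hx⟩
        · exact Or.inr (Or.inr (Or.inr (Or.inr (Or.inr (Or.inl ⟨hx, hy⟩)))))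
      · exact Or.inr (Or.inr (Or.inr (Or.inr (Or.inr (Or.inl ⟨by linarith, by linarith⟩)))))
      · have hy : y = v + (x - u) := by linarith
        rcases (show u ≤ x by linarith).eq_or_lt with hx | hx
        · exact Or.inr (Or.inr (Or.inr (Or.inr (Or.inr (Or.inl ⟨by linarith, by linarith⟩)))))
        · rcases (show x ≤ u + l by linarith).eq_or_lt with hx' | hx'
          · exact Or.inr (Or.inr (Or.inr (Or.inr (Or.inr (Or.inr ⟨hx', by linarith⟩)))))
          · exact Or.inr (Or.inr (Or.inr (Or.inr (Or.inl ⟨hx, hx', hy⟩))))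
      · have hy : y = v + l := by linarith
        rcases (show u + l ≤ x by linarith).eq_or_lt with hx | hx
        · exact Or.inr (Or.inr (Or.inr (Or.inr (Or.inr (Or.inr ⟨hx.symm, hy⟩)))))
        · exact Or.inr (Or.inr (Or.inl ⟨hy, hx⟩))
      · have hx : x = u + l := by linarith
        rcases (show v + l ≤ y by linarith).eq_or_lt with hy | hy
        · exact Or.inr (Or.inr (Or.inr (Or.inr (Or.inr (Or.inr ⟨hx, hy.symm⟩)))))
        · exact Or.inr (Or.inr (Or.inr (Or.inl ⟨hx, hy⟩)))
    simp only [edgePt, legPt, edgeDir, edgeSign, legVertex, vert0, vert1, h, abs_of_nonneg h]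
    rcases key with h | h | h | h | h | h | h
    · exact Or.inl ⟨.negHor, u - x, by linarith, by simp [legDir, h.1]⟩
    · exact Or.inl ⟨.negVert, v - y, by linarith, by simp [legDir, h.1]⟩
    · exact Or.inl ⟨.posHor, x - (u + l), by linarith, by simp [legDir, h.1]⟩
    · exact Or.inl ⟨.posVert, y - (v + l), by linarith, by simp [legDir, h.1]⟩
    · exact Or.inr (Or.inl ⟨x - u, by linarith, by linarith, by simp [h.2.2]⟩)
    · exact Or.inr (Or.inr (Or.inl (by simp [h])))
    · exact Or.inr (Or.inr (Or.inr (by simp [h])))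
  · have hm := min_eq_left h.le
    rw [hm] at hpairs
    have key : (y = v - l ∧ x < u + l) ∨ (x = u ∧ y < v) ∨ (y = v ∧ u < x) ∨
        (x = u + l ∧ v - l < y) ∨ (u + l < x ∧ x < u ∧ y = v + (u - x)) ∨
        (x = u ∧ y = v) ∨ (x = u + l ∧ y = v - l) := by
      rcases hpairs with ⟨h1, h2⟩ | ⟨h1, h2⟩ | ⟨h1, h2⟩ | ⟨h1, h2⟩ | ⟨h1, h2⟩ | ⟨h1, h2⟩ <;>
        obtain ⟨h3, h4, h5⟩ := h1 <;> obtain ⟨h6, h7, h8⟩ := h2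
      · have hx : x = u := by linarith
        rcases (show y ≤ v by linarith).lt_or_eq with hy | hy
        · exact Or.inr (Or.inl ⟨hx, hy⟩)
        · exact Or.inr (Or.inr (Or.inr (Or.inr (Or.inr (Or.inl ⟨hx, hy⟩)))))
      · have hy : y = v - l := by linarith
        rcases (show x ≤ u + l by linarith).lt_or_eq with hx | hx
        · exact Or.inl ⟨hy, hx⟩
        · exact Or.inr (Or.inr (Or.inr (Or.inr (Or.inr (Or.inr ⟨hx, hy⟩)))))
      · have hy : y = v + (u - x) := by linarith
        rcases (show x ≤ u by linarith).eq_or_lt with hx | hx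
        · exact Or.inr (Or.inr (Or.inr (Or.inr (Or.inr (Or.inl ⟨hx, by linarith⟩)))))
        · rcases (show u + l ≤ x by linarith).eq_or_lt with hx' | hx'
          · exact Or.inr (Or.inr (Or.inr (Or.inr (Or.inr (Or.inr ⟨hx'.symm, by linarith⟩)))))
          · exact Or.inr (Or.inr (Or.inr (Or.inr (Or.inl ⟨hx', hx, hy⟩))))
      · linarith
      · have hy : y = v := by linarith
        rcases (show u ≤ x by linarith).eq_or_lt with hx | hx
        · exact Or.inr (Or.inr (Or.inr (Or.inr (Or.inr (Or.inl ⟨hx.symm, hy⟩)))))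
        · exact Or.inr (Or.inr (Or.inl ⟨hy, hx⟩))
      · have hx : x = u + l := by linarith
        rcases (show v - l ≤ y by linarith).eq_or_lt with hy | hy
        · exact Or.inr (Or.inr (Or.inr (Or.inr (Or.inr (Or.inr ⟨hx, hy.symm⟩)))))
        · exact Or.inr (Or.inr (Or.inr (Or.inl ⟨hx, hy⟩)))
    have h' := not_le.2 h
    simp only [edgePt, legPt, edgeDir, edgeSign, legVertex, vert0, vert1, h', abs_of_neg h]
    rcases key with h | h | h | h | h | h | h
    · exact Or.inl ⟨.negHor, u + l - x, by linarith, by simp [legDir, h.1]; ring⟩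
    · exact Or.inl ⟨.negVert, v - y, by linarith, by simp [legDir, h.1]⟩
    · exact Or.inl ⟨.posHor, x - u, by linarith, by simp [legDir, h.1]⟩
    · exact Or.inl ⟨.posVert, y - (v - l), by linarith, by simp [legDir, h.1]; ring⟩
    · exact Or.inr (Or.inl ⟨u - x, by linarith, by linarith, by simp [h.2.2]⟩)
    · exact Or.inr (Or.inr (Or.inl (by simp [h])))
    · exact Or.inr (Or.inr (Or.inr (by simp [h]; ring)))

set_option maxHeartbeats 4000000 in
theorem mixed_singleton {A : Finset (Expo 3)} (hA : IsSimplexCell A) (m : Expo 1) :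
    mixed A {m} (Finset.singleton_nonempty m) = 0 := by
  rcases hA with ⟨q, rfl⟩ | ⟨q, r, h, rfl⟩ | ⟨q, r, s, h, rfl⟩
  · revert q m; unfold mixed; decide +kernel
  · revert q r m; unfold mixed; decide +kernel
  · revert q r s m; unfold mixed; decide +kernel

/-- The roots at or after `t` are those whose index exceeds the smallest active slope. -/
theorem IsSlope.card_root_ge {d : ℝ × ℝ} {σ : Expo 3 → ℕ} {N : ℕ} (h : IsSlope d σ N)
    (a : Expo 3 → ℝ) (v : ℝ × ℝ) (t : ℝ) :
    ((Finset.Icc 1 N).filter fun k => t ≤ root a σ k v).card =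
      (dualCell a (v + t • d)).sup fun m => N - σ m := by
  obtain ⟨m, hm, he⟩ := Finset.exists_min_image _ σ (dualCell_nonempty a (v + t • d))
  have h1 : ((Finset.Icc 1 N).filter fun k => t ≤ root a σ k v) = Finset.Icc (σ m + 1) N := by
    ext k
    simp only [Finset.mem_filter, Finset.mem_Icc]
    constructor
    · rintro ⟨⟨h1, h2⟩, h3⟩
      refine ⟨?_, h2⟩
      by_contra hc
      exact absurd h3 (not_le.2 ((h.root_lt_iff a v h1 h2 t).2 fun r hr => by
        have := he r hr; omega))
    · rintro ⟨h1, h2⟩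
      refine ⟨⟨by omega, h2⟩, ?_⟩
      by_contra hc
      have := (h.root_lt_iff a v (by omega) h2 t).1 (not_le.1 hc) m hm
      omega
  rw [h1, Nat.card_Icc]
  apply le_antisymm
  · have : N - σ m ≤ _ := Finset.le_sup (f := fun m => N - σ m) hm
    omega
  · refine Finset.sup_le fun r hr => ?_
    have := he r hr
    omega

theorem IsSlope.card_root_le' {d : ℝ × ℝ} {σ : Expo 3 → ℕ} {N : ℕ} (h : IsSlope d σ N)
    (a : Expo 3 → ℝ) (v : ℝ × ℝ) (t : ℝ) :
    ((Finset.Icc 1 N).filter fun k => root a σ k v ≤ t).card =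
      (dualCell a (v + t • d)).sup σ := by
  rw [h.card_root_le, Finset.sup'_eq_sup]

/-- The multiplicity of a root is the jump of the slope, maximum minus minimum. The minimum enters
through the maximum of `N - σ m`, hence the `N` on the left. -/
theorem IsSlope.card_root_eq {d : ℝ × ℝ} {σ : Expo 3 → ℕ} {N : ℕ} (h : IsSlope d σ N)
    (a : Expo 3 → ℝ) (v : ℝ × ℝ) (t : ℝ) :
    ((Finset.Icc 1 N).filter fun k => root a σ k v = t).card + N =
      (dualCell a (v + t • d)).sup σ + (dualCell a (v + t • d)).sup fun m => N - σ m := by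
  rw [← h.card_root_le', ← h.card_root_ge, ← Finset.card_union_add_card_inter,
    ← Finset.filter_or, ← Finset.filter_and]
  have h1 : (Finset.Icc 1 N).filter (fun k => root a σ k v ≤ t ∨ t ≤ root a σ k v) =
      Finset.Icc 1 N := Finset.filter_true_of_mem fun k _ => le_total _ _
  have h2 : ∀ k, (root a σ k v ≤ t ∧ t ≤ root a σ k v) ↔ root a σ k v = t :=
    fun k => antisymm_iff
  simp only [h1, h2, Nat.card_Icc]
  omega

/-! ### The stable intersection as a divisor -/

/-- The `k`-th root on a leg, moved to the vertex if it lies behind it. -/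
def legRootPt (a : Expo 3 → ℝ) (q : Param) (L : Leg) (k : ℕ) : ℝ × ℝ :=
  legPt q L (max (root a (legSlope L) k (legVertex q L)) 0)

/-- The `k`-th root on the edge, moved to a vertex if it lies outside. -/
def edgeRootPt (a : Expo 3 → ℝ) (q : Param) (k : ℕ) : ℝ × ℝ :=
  edgePt q (max (min (root a (diagSlope (edgeSign q)) k (vert0 q)) |q.2|) 0)

open Classical in
/-- The number of roots on a leg which are placed at `p`. -/
def legCount (a : Expo 3 → ℝ) (q : Param) (L : Leg) (p : ℝ × ℝ) : ℕ :=
  ((Finset.Icc 1 3).filter fun k => legRootPt a q L k = p).card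

open Classical in
/-- The number of roots on the edge which are placed at `p`. -/
def edgeCount (a : Expo 3 → ℝ) (q : Param) (p : ℝ × ℝ) : ℕ :=
  ((Finset.Icc 1 6).filter fun k => edgeRootPt a q k = p).card

theorem legPt_inj {q : Param} {L : Leg} {t t' : ℝ} : legPt q L t = legPt q L t' ↔ t = t' := by
  refine ⟨fun h => ?_, fun h => by rw [h]⟩
  simp only [legPt, add_right_inj, Prod.ext_iff] at h
  cases L <;> simpa [legDir] using h

theorem edgePt_inj {q : Param} {t t' : ℝ} : edgePt q t = edgePt q t' ↔ t = t' := by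
  refine ⟨fun h => ?_, fun h => by rw [h]⟩
  simp only [edgePt, add_right_inj, Prod.ext_iff] at h
  simpa [edgeDir] using h.2

theorem legVertex_lowLeg (q : Param) : legVertex q (lowLeg (edgeSign q)) = vert0 q := by
  rcases le_or_gt 0 q.2 with h | h
  · simp [edgeSign, h, lowLeg, legVertex]
  · simp [edgeSign, not_le.2 h, lowLeg, legVertex]

theorem legVertex_highLeg (q : Param) : legVertex q (highLeg (edgeSign q)) = vert1 q := by
  rcases le_or_gt 0 q.2 with h | h
  · simp [edgeSign, h, highLeg, legVertex]
  · simp [edgeSign, not_le.2 h, highLeg, legVertex]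

theorem leg_cases (b : Bool) (L : Leg) :
    L = lowLeg b ∨ L = .negVert ∨ L = highLeg b ∨ L = .posVert := by
  cases b <;> cases L <;> simp [lowLeg, highLeg]

theorem legVertex_eq (q : Param) (L : Leg) : legVertex q L = vert0 q ∨ legVertex q L = vert1 q := by
  rcases leg_cases (edgeSign q) L with rfl | rfl | rfl | rfl
  · exact Or.inl (legVertex_lowLeg q)
  · exact Or.inl rfl
  · exact Or.inr (legVertex_highLeg q)
  · exact Or.inr rfl

theorem vert1_eq_vert0 {q : Param} : vert1 q = vert0 q ↔ q.2 = 0 := by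
  rw [← edgePt_abs, ← edgePt_zero, edgePt_inj, abs_eq_zero]

/-- At a vertex at least three monomials of `Λ` are active, inside a leg or the edge exactly two.
Dual cells thus tell the pieces of `Λ` apart, which replaces coordinate computations in the
disjointness lemmas below. -/
theorem card_cell_vert0 (q : Param) : 2 < (dualCell (lineCoeff q) (vert0 q)).card := by
  by_cases h : q.2 = 0
  · rw [dualCell_lineCoeff_center q h]; decide
  · rw [dualCell_lineCoeff_vert0 q h]; cases edgeSign q <;> decide

theorem card_cell_vert1 (q : Param) : 2 < (dualCell (lineCoeff q) (vert1 q)).card := by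
  by_cases h : q.2 = 0
  · rw [vert1_eq_vert0.2 h]; exact card_cell_vert0 q
  · rw [dualCell_lineCoeff_vert1 q h]; cases edgeSign q <;> decide

theorem card_cell_legVertex (q : Param) (L : Leg) :
    2 < (dualCell (lineCoeff q) (legVertex q L)).card := by
  rcases legVertex_eq q L with h | h <;> rw [h]
  · exact card_cell_vert0 q
  · exact card_cell_vert1 q

theorem card_legCell (L : Leg) : (legCell L).card = 2 := by cases L <;> rfl

theorem card_edgeCell (b : Bool) : (edgeCell b).card = 2 := by cases b <;> rfl

theorem legCell_injective {L L' : Leg} (h : legCell L = legCell L') : L = L' := by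
  cases L <;> cases L' <;> first | rfl | (exact absurd h (by decide))

theorem legCell_ne_edgeCell (L : Leg) (b : Bool) : legCell L ≠ edgeCell b := by
  cases L <;> cases b <;> decide

theorem legPt_eq_legPt {q : Param} {L L' : Leg} {t t' : ℝ} (ht : 0 < t) (ht' : 0 ≤ t')
    (h : legPt q L t = legPt q L' t') : L = L' := by
  rcases ht'.eq_or_lt with rfl | ht'
  · rw [legPt_zero] at h
    have := card_cell_legVertex q L'
    rw [← h, dualCell_lineCoeff_legPt q L ht, card_legCell] at this
    omega
  · apply legCell_injective
    rw [← dualCell_lineCoeff_legPt q L ht, h, dualCell_lineCoeff_legPt q L' ht']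

theorem legPt_ne_vert {q : Param} {L : Leg} {t : ℝ} (ht : 0 < t) :
    legPt q L t ≠ vert0 q ∧ legPt q L t ≠ vert1 q := by
  refine ⟨fun h => ?_, fun h => ?_⟩
  · have := card_cell_vert0 q
    rw [← h, dualCell_lineCoeff_legPt q L ht, card_legCell] at this
    omega
  · have := card_cell_vert1 q
    rw [← h, dualCell_lineCoeff_legPt q L ht, card_legCell] at this
    omega

theorem legPt_ne_edgePt {q : Param} {L : Leg} {t t' : ℝ} (ht : 0 < t) (h0 : 0 ≤ t')
    (h1 : t' ≤ |q.2|) : legPt q L t ≠ edgePt q t' := by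
  rcases h0.eq_or_lt with rfl | h0
  · rw [edgePt_zero]; exact (legPt_ne_vert ht).1
  rcases h1.eq_or_lt with rfl | h1
  · rw [edgePt_abs]; exact (legPt_ne_vert ht).2
  intro h
  apply legCell_ne_edgeCell L (edgeSign q)
  rw [← dualCell_lineCoeff_legPt q L ht, h, dualCell_lineCoeff_edgePt q h0 h1]

theorem edgePt_ne_vert {q : Param} {t : ℝ} (h0 : 0 < t) (h1 : t < |q.2|) :
    edgePt q t ≠ vert0 q ∧ edgePt q t ≠ vert1 q := by
  rw [← edgePt_abs, ← edgePt_zero, Ne, Ne, edgePt_inj, edgePt_inj]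
  exact ⟨h0.ne', h1.ne⟩

theorem legCount_legPt (a : Expo 3 → ℝ) (q : Param) (L : Leg) {t : ℝ} (ht : 0 < t) :
    legCount a q L (legPt q L t) + 3 = (dualCell a (legPt q L t)).sup (legSlope L) +
      (dualCell a (legPt q L t)).sup fun m => 3 - legSlope L m := by
  rw [legPt, ← (isSlope_leg L).card_root_eq, ← legPt, legCount]
  congr 2
  ext k
  simp only [Finset.mem_filter, legRootPt, legPt_inj]
  refine and_congr_right fun _ => ?_
  constructor
  · intro h
    rcases max_choice (root a (legSlope L) k (legVertex q L)) 0 with h' | h'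
    · rw [← h', h]
    · rw [h'] at h; exact absurd h ht.ne
  · rintro h
    rw [h, max_eq_left ht.le]

/-- All roots at or behind the vertex are placed there, so their number is the largest active slope.
-/
theorem legCount_vertex (a : Expo 3 → ℝ) (q : Param) (L : Leg) :
    legCount a q L (legVertex q L) = (dualCell a (legVertex q L)).sup (legSlope L) := by
  have := (isSlope_leg L).card_root_le' a (legVertex q L) 0
  rw [zero_smul, add_zero] at this
  rw [← this, legCount]
  congr 1
  ext k
  simp only [Finset.mem_filter, legRootPt, ← legPt_zero, legPt_inj]
  simp only [legPt_zero, max_eq_right_iff]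

theorem legCount_eq_zero {a : Expo 3 → ℝ} {q : Param} {L : Leg} {p : ℝ × ℝ}
    (h : ∀ t, 0 ≤ t → p ≠ legPt q L t) : legCount a q L p = 0 := by
  rw [legCount, Finset.card_eq_zero, Finset.filter_eq_empty_iff]
  exact fun k _ hk => h _ (le_max_right _ _) hk.symm

theorem edgeCount_edgePt (a : Expo 3 → ℝ) (q : Param) {t : ℝ} (ht : 0 < t) (ht' : t < |q.2|) :
    edgeCount a q (edgePt q t) + 6 = (dualCell a (edgePt q t)).sup (diagSlope (edgeSign q)) +
      (dualCell a (edgePt q t)).sup fun m => 6 - diagSlope (edgeSign q) m := by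
  rw [edgePt, ← (isSlope_diag (edgeSign q)).card_root_eq, ← edgePt, edgeCount]
  congr 2
  ext k
  simp only [Finset.mem_filter, edgeRootPt, edgePt_inj]
  refine and_congr_right fun _ => ?_
  set r := root a (diagSlope (edgeSign q)) k (vert0 q)
  constructor
  · intro h
    rcases max_choice (min r |q.2|) 0 with h' | h'
    · rw [h'] at h
      rcases min_choice r |q.2| with h' | h'
      · rw [← h', h]
      · rw [h'] at h; exact absurd h ht'.ne'
    · rw [h'] at h; exact absurd h ht.ne
  · rintro h
    rw [h, min_eq_left ht'.le, max_eq_left ht.le]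

theorem edgeCount_vert0 (a : Expo 3 → ℝ) (q : Param) (hq : q.2 ≠ 0) :
    edgeCount a q (vert0 q) = (dualCell a (vert0 q)).sup (diagSlope (edgeSign q)) := by
  have := (isSlope_diag (edgeSign q)).card_root_le' a (vert0 q) 0
  rw [zero_smul, add_zero] at this
  rw [← this, edgeCount]
  congr 1
  ext k
  simp only [Finset.mem_filter, edgeRootPt, ← edgePt_zero, edgePt_inj]
  simp only [edgePt_zero, max_eq_right_iff, min_le_iff, abs_nonpos_iff, hq, or_false]

theorem edgeCount_vert1 (a : Expo 3 → ℝ) (q : Param) (hq : q.2 ≠ 0) :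
    edgeCount a q (vert1 q) =
      (dualCell a (vert1 q)).sup fun m => 6 - diagSlope (edgeSign q) m := by
  rw [← edgePt_abs, edgePt, ← (isSlope_diag (edgeSign q)).card_root_ge, edgeCount, ← edgePt]
  congr 1
  ext k
  have h0 := abs_pos.2 hq
  simp only [Finset.mem_filter, edgeRootPt, edgePt_inj]
  refine and_congr_right fun _ => ?_
  set r := root a (diagSlope (edgeSign q)) k (vert0 q)
  rw [max_eq_iff]
  constructor
  · rintro (⟨h, -⟩ | ⟨h, -⟩)
    · exact min_eq_right_iff.1 h
    · exact absurd h h0.ne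
  · intro h
    exact Or.inl ⟨min_eq_right h, h0.le.trans_eq (min_eq_right h).symm⟩

/-- A degenerate edge has all six roots at the center, where they cancel one of the two subtractions
of six. -/
theorem edgeCount_center (a : Expo 3 → ℝ) (q : Param) (hq : q.2 = 0) :
    edgeCount a q (vert0 q) = 6 := by
  rw [edgeCount, Finset.filter_true_of_mem]
  · rfl
  · intro k _
    rw [edgeRootPt, ← edgePt_zero, edgePt_inj, edgePt_zero, max_eq_right_iff, hq, abs_zero]
    exact min_le_right _ _

theorem edgeCount_eq_zero {a : Expo 3 → ℝ} {q : Param} {p : ℝ × ℝ}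
    (h : ∀ t, 0 ≤ t → t ≤ |q.2| → p ≠ edgePt q t) : edgeCount a q p = 0 := by
  rw [edgeCount, Finset.card_eq_zero, Finset.filter_eq_empty_iff]
  exact fun k _ hk => h _ (le_max_right _ _) (max_le (min_le_right _ _) (abs_nonneg _)) hk.symm

theorem legPt_mem_lam (q : Param) (L : Leg) {t : ℝ} (ht : 0 ≤ t) : legPt q L t ∈ lam q := by
  have : 2 ≤ (dualCell (lineCoeff q) (legPt q L t)).card := by
    rcases ht.eq_or_lt with rfl | ht
    · rw [legPt_zero]; exact (card_cell_legVertex q L).le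
    · rw [dualCell_lineCoeff_legPt q L ht, card_legCell]
  exact Finset.one_lt_card_iff_nontrivial.1 this

theorem edgePt_mem_lam (q : Param) {t : ℝ} (ht : 0 ≤ t) (ht' : t ≤ |q.2|) : edgePt q t ∈ lam q := by
  have : 2 ≤ (dualCell (lineCoeff q) (edgePt q t)).card := by
    rcases ht.eq_or_lt with rfl | ht
    · rw [edgePt_zero]; exact (card_cell_vert0 q).le
    rcases ht'.eq_or_lt with rfl | ht'
    · rw [edgePt_abs]; exact (card_cell_vert1 q).le
    · rw [dualCell_lineCoeff_edgePt q ht ht', card_edgeCell]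
  exact Finset.one_lt_card_iff_nontrivial.1 this

theorem vert0_mem_lam (q : Param) : vert0 q ∈ lam q :=
  edgePt_zero q ▸ edgePt_mem_lam q le_rfl (abs_nonneg _)

theorem vert1_mem_lam (q : Param) : vert1 q ∈ lam q :=
  edgePt_abs q ▸ edgePt_mem_lam q (abs_nonneg _) le_rfl

/-- The sum of the numbers of roots placed at `p`. -/
def rootCount (a : Expo 3 → ℝ) (q : Param) (p : ℝ × ℝ) : ℕ :=
  legCount a q .negHor p + legCount a q .negVert p + legCount a q .posHor p +
    legCount a q .posVert p + edgeCount a q p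

theorem rootCount_eq (a : Expo 3 → ℝ) (q : Param) (p : ℝ × ℝ) (b : Bool) :
    rootCount a q p = legCount a q (lowLeg b) p + legCount a q .negVert p +
      legCount a q (highLeg b) p + legCount a q .posVert p + edgeCount a q p := by
  cases b <;> simp only [rootCount, lowLeg, highLeg]; omega

theorem legCount_eq_zero_of_legPt {a : Expo 3 → ℝ} {q : Param} {L L' : Leg} {t : ℝ} (ht : 0 < t)
    (h : L' ≠ L) : legCount a q L' (legPt q L t) = 0 :=
  legCount_eq_zero fun _ ht' e => h (legPt_eq_legPt ht ht' e).symm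

theorem rootCount_legPt (a : Expo 3 → ℝ) (q : Param) (L : Leg) {t : ℝ} (ht : 0 < t) :
    rootCount a q (legPt q L t) = legCount a q L (legPt q L t) := by
  have he : edgeCount a q (legPt q L t) = 0 :=
    edgeCount_eq_zero fun _ h0 h1 => legPt_ne_edgePt ht h0 h1
  have hl := fun L' (h : L' ≠ L) => legCount_eq_zero_of_legPt (a := a) (q := q) ht h
  cases L <;> simp [rootCount, he, hl]

theorem rootCount_edgePt (a : Expo 3 → ℝ) (q : Param) {t : ℝ} (ht : 0 < t) (ht' : t < |q.2|) :
    rootCount a q (edgePt q t) = edgeCount a q (edgePt q t) := by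
  have hl : ∀ L, legCount a q L (edgePt q t) = 0 := by
    intro L
    refine legCount_eq_zero fun s hs => ?_
    rcases hs.eq_or_lt with rfl | hs
    · rw [legPt_zero]
      rcases legVertex_eq q L with h | h <;> rw [h]
      · exact (edgePt_ne_vert ht ht').1
      · exact (edgePt_ne_vert ht ht').2
    · exact (legPt_ne_edgePt hs ht.le ht'.le).symm
  simp [rootCount, hl]

theorem legCount_vert_ne {a : Expo 3 → ℝ} {q : Param} {L : Leg} {p : ℝ × ℝ}
    (hp : p = vert0 q ∨ p = vert1 q) (h : p ≠ legVertex q L) : legCount a q L p = 0 := by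
  refine legCount_eq_zero fun s hs e => ?_
  rcases hs.eq_or_lt with rfl | hs
  · rw [legPt_zero] at e; exact h e
  · rcases hp with rfl | rfl
    · exact (legPt_ne_vert hs).1 e.symm
    · exact (legPt_ne_vert hs).2 e.symm

open Classical in
/-- The stable intersection is the divisor of all roots, minus six times each vertex. -/
theorem stableMult_eq_rootCount {a : Expo 3 → ℝ} (ha : IsSmooth a) (q : Param) (p : ℝ × ℝ) :
    stableMult a (lineCoeff q) p =
      (rootCount a q p : ℤ) - (if p = vert0 q then 6 else 0) - (if p = vert1 q then 6 else 0) := by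
  have hA := ha.isSimplexCell p
  by_cases hp : p ∈ lam q
  · rcases mem_lam_cases hp with ⟨L, t, ht, rfl⟩ | ⟨t, ht, ht', rfl⟩ | h
    · rw [if_neg (legPt_ne_vert ht).1, if_neg (legPt_ne_vert ht).2, rootCount_legPt a q L ht,
        stableMult_eq_mixed (dualCell_lineCoeff_legPt q L ht) (legCell_nonempty L), mixed_leg hA]
      have := legCount_legPt a q L ht
      omega
    · rw [if_neg (edgePt_ne_vert ht ht').1, if_neg (edgePt_ne_vert ht ht').2,
        rootCount_edgePt a q ht ht',
        stableMult_eq_mixed (dualCell_lineCoeff_edgePt q ht ht') (edgeCell_nonempty _),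
        mixed_edge hA]
      have := edgeCount_edgePt a q ht ht'
      omega
    · rw [rootCount_eq a q p (edgeSign q)]
      have l1 := legCount_vertex a q (lowLeg (edgeSign q))
      have l2 := legCount_vertex a q .negVert
      have l3 := legCount_vertex a q (highLeg (edgeSign q))
      have l4 := legCount_vertex a q .posVert
      have n1 := legCount_vert_ne (a := a) (L := lowLeg (edgeSign q)) h
      have n2 := legCount_vert_ne (a := a) (L := .negVert) h
      have n3 := legCount_vert_ne (a := a) (L := highLeg (edgeSign q)) h
      have n4 := legCount_vert_ne (a := a) (L := .posVert) h
      rw [legVertex_lowLeg] at l1 n1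
      rw [legVertex_highLeg] at l3 n3
      change legCount a q .negVert (vert0 q) = (dualCell a (vert0 q)).sup _ at l2
      change legCount a q .posVert (vert1 q) = (dualCell a (vert1 q)).sup _ at l4
      change p ≠ vert0 q → _ at n2
      change p ≠ vert1 q → _ at n4
      by_cases hq : q.2 = 0
      · have h1 : vert1 q = vert0 q := vert1_eq_vert0.2 hq
        have hpv : p = vert0 q := by rcases h with h | h <;> simp [h, h1]
        rw [h1] at l3 l4
        subst hpv
        rw [stableMult_eq_mixed (dualCell_lineCoeff_center q hq) Finset.univ_nonempty,
          mixed_square hA, if_pos rfl, if_pos h1.symm, l1, l2, l3, l4,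
          edgeCount_center a q hq]
        cases edgeSign q <;> simp only [lowLeg, highLeg] <;> push_cast <;> ring
      · have h1 : vert1 q ≠ vert0 q := fun e => hq (vert1_eq_vert0.1 e)
        rcases h with rfl | rfl
        · rw [stableMult_eq_mixed (dualCell_lineCoeff_vert0 q hq) (lowCell_nonempty _),
            mixed_low hA, if_pos rfl, if_neg h1.symm, l1, l2, n3 h1.symm, n4 h1.symm,
            edgeCount_vert0 a q hq]
          push_cast; ring
        · rw [stableMult_eq_mixed (dualCell_lineCoeff_vert1 q hq) (highCell_nonempty _),
            mixed_high hA, if_neg h1, if_pos rfl, l3, l4, n1 h1, n2 h1,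
            edgeCount_vert1 a q hq]
          push_cast; ring
  · obtain ⟨m, hm⟩ := notMem_curve_iff.1 hp
    have h0 : p ≠ vert0 q := fun h => hp (h ▸ vert0_mem_lam q)
    have h1 : p ≠ vert1 q := fun h => hp (h ▸ vert1_mem_lam q)
    rw [stableMult_eq_mixed hm (Finset.singleton_nonempty m), mixed_singleton hA, if_neg h0,
      if_neg h1]
    have hl : ∀ L, legCount a q L p = 0 := fun L =>
      legCount_eq_zero fun t ht h => hp (h ▸ legPt_mem_lam q L ht)
    have he : edgeCount a q p = 0 :=
      edgeCount_eq_zero fun t ht ht' h => hp (h ▸ edgePt_mem_lam q ht ht')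
    simp [rootCount, hl, he]

/-- The parity condition characterizing tritangents: wherever the curve leaves `Γ`, the slope of the
tropical polynomial is odd on the legs (after the shift in `legSlope`) and even on the edge. -/
def Par (a : Expo 3 → ℝ) (q : Param) : Prop :=
  (∀ L t, 0 ≤ t → ∀ m, dualCell a (legPt q L t) = {m} → Odd (legSlope L m)) ∧
  (q.2 ≠ 0 → ∀ t, 0 ≤ t → t ≤ |q.2| → ∀ m, dualCell a (edgePt q t) = {m} →
    Even (diagSlope (edgeSign q) m))

/-! ### Total multiplicities -/

open Classical in
/-- The number of roots on a leg which are placed in `C`. -/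
def legIn (a : Expo 3 → ℝ) (q : Param) (L : Leg) (C : Set (ℝ × ℝ)) : ℕ :=
  ((Finset.Icc 1 3).filter fun k => legRootPt a q L k ∈ C).card

open Classical in
/-- The number of roots on the edge which are placed in `C`. -/
def edgeIn (a : Expo 3 → ℝ) (q : Param) (C : Set (ℝ × ℝ)) : ℕ :=
  ((Finset.Icc 1 6).filter fun k => edgeRootPt a q k ∈ C).card

open Classical in
/-- A finite set of points which contains the stable intersection. -/
def rootPts (a : Expo 3 → ℝ) (q : Param) : Finset (ℝ × ℝ) :=
  (Finset.Icc 1 3).image (legRootPt a q .negHor) ∪ (Finset.Icc 1 3).image (legRootPt a q .negVert) ∪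
  (Finset.Icc 1 3).image (legRootPt a q .posHor) ∪ (Finset.Icc 1 3).image (legRootPt a q .posVert) ∪
  (Finset.Icc 1 6).image (edgeRootPt a q) ∪ {vert0 q, vert1 q}

theorem legRootPt_mem_rootPts (a : Expo 3 → ℝ) (q : Param) (L : Leg) {k : ℕ}
    (hk : k ∈ Finset.Icc 1 3) : legRootPt a q L k ∈ rootPts a q := by
  have := Finset.mem_image_of_mem (legRootPt a q L) hk
  cases L <;> simp only [rootPts, Finset.mem_union] <;> tauto

theorem edgeRootPt_mem_rootPts (a : Expo 3 → ℝ) (q : Param) {k : ℕ}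
    (hk : k ∈ Finset.Icc 1 6) : edgeRootPt a q k ∈ rootPts a q := by
  have := Finset.mem_image_of_mem (edgeRootPt a q) hk
  simp only [rootPts, Finset.mem_union]; tauto

theorem vert_mem_rootPts (a : Expo 3 → ℝ) (q : Param) :
    vert0 q ∈ rootPts a q ∧ vert1 q ∈ rootPts a q := by
  simp [rootPts]

open Classical in
theorem sum_card_fiber {α β : Type*} (K : Finset α) (S : Finset β) (f : α → β)
    (hf : ∀ k ∈ K, f k ∈ S) (C : Set β) :
    ∑ p ∈ S, (if p ∈ C then ((K.filter fun k => f k = p).card : ℤ) else 0) =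
      (K.filter fun k => f k ∈ C).card := by
  rw [Finset.card_eq_sum_card_fiberwise (f := f) (t := S)
    (fun k hk => hf k (Finset.mem_filter.1 hk).1)]
  push_cast
  refine Finset.sum_congr rfl fun p _ => ?_
  rw [Finset.filter_filter]
  split_ifs with h
  · congr 2
    ext k
    simp only [Finset.mem_filter]
    exact ⟨fun ⟨h1, h2⟩ => ⟨h1, h2 ▸ h, h2⟩, fun ⟨h1, _, h2⟩ => ⟨h1, h2⟩⟩
  · rw [Finset.filter_false_of_mem]
    · simp
    · rintro k _ ⟨h1, h2⟩
      exact h (h2 ▸ h1)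

theorem stableMult_eq_zero {a : Expo 3 → ℝ} (ha : IsSmooth a) {q : Param} {p : ℝ × ℝ}
    (hp : p ∉ rootPts a q) : stableMult a (lineCoeff q) p = 0 := by
  have hv := vert_mem_rootPts a q
  rw [stableMult_eq_rootCount ha, if_neg (fun h => hp (by rw [h]; exact hv.1)),
    if_neg (fun h => hp (by rw [h]; exact hv.2))]
  have hl : ∀ L, legCount a q L p = 0 := by
    intro L
    rw [legCount, Finset.card_eq_zero, Finset.filter_eq_empty_iff]
    exact fun k hk h => hp (h ▸ legRootPt_mem_rootPts a q L hk)
  have he : edgeCount a q p = 0 := by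
    rw [edgeCount, Finset.card_eq_zero, Finset.filter_eq_empty_iff]
    exact fun k hk h => hp (h ▸ edgeRootPt_mem_rootPts a q hk)
  simp [rootCount, hl, he]

open Classical in
theorem totalMult_eq_sum {a : Expo 3 → ℝ} (ha : IsSmooth a) (q : Param) (C : Set (ℝ × ℝ)) :
    totalMult a q C =
      ∑ p ∈ rootPts a q, if p ∈ C then stableMult a (lineCoeff q) p else 0 := by
  rw [totalMult, finsum_mem_def, finsum_eq_sum_of_support_subset (s := rootPts a q)]
  · rfl
  · intro p hp
    by_contra hc
    exact hp (by simp only [indicator, stableMult_eq_zero ha hc, ite_self])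

open Classical in
theorem totalMult_eq {a : Expo 3 → ℝ} (ha : IsSmooth a) (q : Param) (C : Set (ℝ × ℝ)) :
    totalMult a q C = legIn a q .negHor C + legIn a q .negVert C + legIn a q .posHor C +
      legIn a q .posVert C + edgeIn a q C - (if vert0 q ∈ C then 6 else 0) -
      (if vert1 q ∈ C then 6 else 0) := by
  have hL : ∀ L, ∑ p ∈ rootPts a q, (if p ∈ C then (legCount a q L p : ℤ) else 0) =
      legIn a q L C := fun L => by
    convert sum_card_fiber _ _ _ (fun k hk => legRootPt_mem_rootPts a q L hk) C
    · rw [legCount]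
      congr!
    · rfl
  have hE : ∑ p ∈ rootPts a q, (if p ∈ C then (edgeCount a q p : ℤ) else 0) = edgeIn a q C := by
    convert sum_card_fiber _ _ _ (fun k hk => edgeRootPt_mem_rootPts a q hk) C
    · rw [edgeCount]
      congr!
    · rfl
  have hv : ∀ v ∈ rootPts a q, ∑ p ∈ rootPts a q, (if p = v then (if p ∈ C then (6 : ℤ) else 0)
      else 0) = if v ∈ C then 6 else 0 := by
    intro v hv
    rw [Finset.sum_ite_eq' (rootPts a q) v]
    simp [hv]
  rw [totalMult_eq_sum ha, ← hL, ← hL, ← hL, ← hL, ← hE, ← hv _ (vert_mem_rootPts a q).1,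
    ← hv _ (vert_mem_rootPts a q).2]
  simp only [← Finset.sum_add_distrib, ← Finset.sum_sub_distrib]
  refine Finset.sum_congr rfl fun p _ => ?_
  rw [stableMult_eq_rootCount ha, rootCount]
  split_ifs <;> push_cast <;> ring

/-- Four legs with three roots each, six roots on the edge, minus six for each of the two vertices.
-/
theorem totalMult_univ {a : Expo 3 → ℝ} (ha : IsSmooth a) (q : Param) :
    totalMult a q univ = 6 := by
  rw [totalMult_eq ha]
  simp [legIn, edgeIn]

/-! ### Positivity -/

theorem stableMult_eq_zero_of_notMem_curve {n k : ℕ} {a : Expo n → ℝ} {b : Expo k → ℝ} {p : ℝ × ℝ}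
    (hp : p ∉ curve a) : stableMult a b p = 0 := by
  obtain ⟨m, hm⟩ := notMem_curve_iff.1 hp
  have : orientedEdges (dualCell a p) = ∅ := by
    rw [hm, orientedEdges, Finset.filter_eq_empty_iff]
    rintro ⟨r, s⟩ hrs ⟨h1, -⟩
    simp only [Finset.mem_product, Finset.mem_singleton] at hrs
    exact h1 (by rw [hrs.1, hrs.2])
  rw [stableMult, this, Finset.sum_empty]

theorem stableMult_eq_zero_of_notMem_lam {a : Expo 3 → ℝ} (ha : IsSmooth a) {q : Param} {p : ℝ × ℝ}
    (hp : p ∉ lam q) : stableMult a (lineCoeff q) p = 0 := by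
  obtain ⟨m, hm⟩ := notMem_curve_iff.1 hp
  rw [stableMult_eq_mixed hm (Finset.singleton_nonempty m), mixed_singleton (ha.isSimplexCell p)]

theorem expo_ne_cases {m m' : Expo 3} (h : m ≠ m') :
    (m.1 : ℕ) < m'.1 ∨ (m'.1 : ℕ) < m.1 ∨ (m.2 : ℕ) < m'.2 ∨ (m'.2 : ℕ) < m.2 := by
  by_contra hc
  apply h
  ext <;> omega

/-- For a single exponent the outgoing slopes at a vertex add up to six. Two distinct active
exponents differ in one of the directions, so the sum of the maxima exceeds six. -/
theorem stableMult_vert_pos {a : Expo 3 → ℝ} (ha : IsSmooth a) {q : Param} {p : ℝ × ℝ}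
    (hv : p = vert0 q ∨ p = vert1 q) (hp : p ∈ curve a) : 0 < stableMult a (lineCoeff q) p := by
  have hA := ha.isSimplexCell p
  obtain ⟨m, hm, m', hm', hne⟩ := hp
  have hne := expo_ne_cases hne
  have f : ∀ σ : Expo 3 → ℕ, σ m ≤ (dualCell a p).sup σ ∧ σ m' ≤ (dualCell a p).sup σ :=
    fun σ => ⟨Finset.le_sup hm, Finset.le_sup hm'⟩
  have f1 := f (legSlope .negHor)
  have f2 := f (legSlope .negVert)
  have f3 := f (legSlope .posHor)
  have f4 := f (legSlope .posVert)
  by_cases hq : q.2 = 0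
  · have hpv : p = vert0 q := by
      rcases hv with h | h
      · exact h
      · rw [h, vert1_eq_vert0.2 hq]
    rw [stableMult_eq_mixed (hpv ▸ dualCell_lineCoeff_center q hq) Finset.univ_nonempty,
      mixed_square hA]
    simp only [legSlope] at *
    omega
  · have f5 := f (diagSlope (edgeSign q))
    have f6 := f (fun m => 6 - diagSlope (edgeSign q) m)
    rcases hv with h | h
    · rw [stableMult_eq_mixed (h ▸ dualCell_lineCoeff_vert0 q hq) (lowCell_nonempty _),
        mixed_low hA]
      generalize edgeSign q = b at f5 f6 ⊢
      cases b <;> simp only [legSlope, diagSlope, lowLeg] at * <;> omega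
    · rw [stableMult_eq_mixed (h ▸ dualCell_lineCoeff_vert1 q hq) (highCell_nonempty _),
        mixed_high hA]
      generalize edgeSign q = b at f5 f6 ⊢
      cases b <;> simp only [legSlope, diagSlope, highLeg] at * <;> omega

theorem stableMult_nonneg {a : Expo 3 → ℝ} (ha : IsSmooth a) (q : Param) (p : ℝ × ℝ) :
    0 ≤ stableMult a (lineCoeff q) p := by
  by_cases hp : p ∈ curve a
  · by_cases hv : p = vert0 q ∨ p = vert1 q
    · exact (stableMult_vert_pos ha hv hp).le
    · rw [stableMult_eq_rootCount ha, if_neg (fun h => hv (Or.inl h)),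
        if_neg (fun h => hv (Or.inr h))]
      omega
  · rw [stableMult_eq_zero_of_notMem_curve hp]

/-- While the active slope stays constant, exponents stay active. -/
theorem IsSlope.mem_dualCell_of_root_le {d : ℝ × ℝ} {σ : Expo 3 → ℕ} {N : ℕ} (h : IsSlope d σ N)
    {a : Expo 3 → ℝ} {v : ℝ × ℝ} {t s : ℝ} {m : Expo 3} (hm : m ∈ dualCell a (v + t • d))
    (hs : s ≤ t) (hr : 1 ≤ σ m → root a σ (σ m) v ≤ s) : m ∈ dualCell a (v + s • d) := by
  rcases hs.eq_or_lt with rfl | hs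
  · exact hm
  obtain ⟨r, hrs, hle⟩ : ∃ r ∈ dualCell a (v + s • d), σ m ≤ σ r := by
    rcases Nat.eq_zero_or_pos (σ m) with h0 | h0
    · obtain ⟨r, hr⟩ := dualCell_nonempty a (v + s • d)
      exact ⟨r, hr, by omega⟩
    · exact (h.root_le_iff a v h0 (h.le m) s).1 (hr h0)
  have he : σ m = σ r := le_antisymm hle (h.mono hs hrs hm)
  refine mem_dualCell_of_eq hrs (le_antisymm ?_ (mem_dualCell.1 hrs m))
  have h1 := h.value_sub a v s r m
  have h2 := h.value_sub a v t r m
  rw [he] at h1 h2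
  have := mem_dualCell.1 hm r
  linarith

/-- The intersection of the `(1,1)`-curve with the `(3,3)`-curve. -/
def inter (a : Expo 3 → ℝ) (q : Param) : Set (ℝ × ℝ) := lam q ∩ curve a

theorem joined_leg {a : Expo 3 → ℝ} {q : Param} {L : Leg} {s t : ℝ} (hs : 0 ≤ s) (hst : s ≤ t)
    (h : ∀ u, s ≤ u → u ≤ t → legPt q L u ∈ curve a) :
    ∃ S ⊆ inter a q, IsPreconnected S ∧ legPt q L s ∈ S ∧ legPt q L t ∈ S := by
  refine ⟨legPt q L '' Icc s t, ?_, ?_, ⟨s, ⟨le_rfl, hst⟩, rfl⟩, ⟨t, ⟨hst, le_rfl⟩, rfl⟩⟩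
  · rintro _ ⟨u, hu, rfl⟩
    exact ⟨legPt_mem_lam q L (hs.trans hu.1), h u hu.1 hu.2⟩
  · exact isPreconnected_Icc.image _ (continuous_line _ _).continuousOn

theorem joined_edge {a : Expo 3 → ℝ} {q : Param} {s t : ℝ} (hs : 0 ≤ s) (hst : s ≤ t)
    (ht : t ≤ |q.2|) (h : ∀ u, s ≤ u → u ≤ t → edgePt q u ∈ curve a) :
    ∃ S ⊆ inter a q, IsPreconnected S ∧ edgePt q s ∈ S ∧ edgePt q t ∈ S := by
  refine ⟨edgePt q '' Icc s t, ?_, ?_, ⟨s, ⟨le_rfl, hst⟩, rfl⟩, ⟨t, ⟨hst, le_rfl⟩, rfl⟩⟩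
  · rintro _ ⟨u, hu, rfl⟩
    exact ⟨edgePt_mem_lam q (hs.trans hu.1) (hu.2.trans ht), h u hu.1 hu.2⟩
  · exact isPreconnected_Icc.image _ (continuous_line _ _).continuousOn

/-- Every point of the intersection can be joined, inside of the intersection, with a point of
positive multiplicity. -/
theorem exists_stableMult_pos {a : Expo 3 → ℝ} (ha : IsSmooth a) {q : Param} {p : ℝ × ℝ}
    (hp : p ∈ inter a q) : ∃ p' ∈ inter a q, 0 < stableMult a (lineCoeff q) p' ∧
      ∃ S ⊆ inter a q, IsPreconnected S ∧ p ∈ S ∧ p' ∈ S := by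
  by_cases hmult : 0 < stableMult a (lineCoeff q) p
  · exact ⟨p, hp, hmult, {p}, by simpa using hp, isPreconnected_singleton, rfl, rfl⟩
  have hzero : stableMult a (lineCoeff q) p = 0 :=
    le_antisymm (not_lt.1 hmult) (stableMult_nonneg ha q p)
  have hpos : ∀ p' ∈ curve a, (p' = vert0 q ∨ p' = vert1 q) ∨ rootCount a q p' ≠ 0 →
      0 < stableMult a (lineCoeff q) p' := by
    rintro p' h1 h2
    by_cases hv : p' = vert0 q ∨ p' = vert1 q
    · exact stableMult_vert_pos ha hv h1
    · rw [stableMult_eq_rootCount ha, if_neg (fun h => hv (Or.inl h)),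
        if_neg (fun h => hv (Or.inr h))]
      have := h2.resolve_left hv
      omega
  obtain ⟨hpl, m, hm, m', hm', hne⟩ := hp
  rcases mem_lam_cases hpl with ⟨L, t, ht, rfl⟩ | ⟨t, ht, ht', rfl⟩ | h
  · have hs := isSlope_leg L
    rw [stableMult_eq_rootCount ha, if_neg (legPt_ne_vert ht).1, if_neg (legPt_ne_vert ht).2,
      rootCount_legPt a q L ht] at hzero
    have hcount := legCount_legPt a q L ht
    -- Multiplicity zero means that the slope does not jump, so all active exponents have the same
    -- slope.
    have hconst : ∀ r ∈ dualCell a (legPt q L t), legSlope L r = legSlope L m := by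
      intro r hr
      have f1 := Finset.le_sup (f := legSlope L) hr
      have f2 := Finset.le_sup (f := legSlope L) hm
      have f3 : 3 - _ ≤ _ := Finset.le_sup (f := fun m => 3 - legSlope L m) hr
      have f4 : 3 - _ ≤ _ := Finset.le_sup (f := fun m => 3 - legSlope L m) hm
      have := hs.le r
      have := hs.le m
      omega
    set k := legSlope L m with hk
    set κ := root a (legSlope L) k (legVertex q L)
    -- Walking back towards the vertex, both exponents stay active until the slope `k` sets in, or
    -- until the vertex if this happens behind it. Slope zero is the least possible, so for `k = 0`
    -- the walk always reaches the vertex.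
    set c := if 1 ≤ k then max κ 0 else 0 with hc
    have hc0 : 0 ≤ c := by
      rw [hc]; split_ifs
      · exact le_max_right _ _
      · exact le_rfl
    have hct : c ≤ t := by
      rw [hc]; split_ifs with h1
      · exact max_le ((hs.root_le_iff a _ h1 (hs.le m) t).2 ⟨m, hm, le_rfl⟩) ht.le
      · exact ht.le
    have hcurve : ∀ u, c ≤ u → u ≤ t → legPt q L u ∈ curve a := by
      intro u hu hut
      have hκ : 1 ≤ k → κ ≤ u := fun h1 => by
        rw [hc, if_pos h1] at hu
        exact (le_max_left _ _).trans hu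
      refine ⟨m, hs.mem_dualCell_of_root_le hm hut hκ, m', ?_, hne⟩
      refine hs.mem_dualCell_of_root_le hm' hut ?_
      rw [hconst m' hm']
      exact hκ
    obtain ⟨S, hS, h1, h2, h3⟩ := joined_leg hc0 hct hcurve
    refine ⟨_, hS h2, hpos _ (hS h2).2 ?_, S, hS, h1, h3, h2⟩
    rcases hc0.eq_or_lt with h0 | h0
    · rw [← h0, legPt_zero]
      exact Or.inl (legVertex_eq q L)
    · right
      rw [rootCount_legPt a q L h0, legCount, Finset.card_ne_zero]
      have h1 : 1 ≤ k := by
        by_contra hlt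
        rw [hc, if_neg hlt] at h0
        exact lt_irrefl _ h0
      exact ⟨k, Finset.mem_filter.2 ⟨Finset.mem_Icc.2 ⟨h1, hs.le m⟩, by
        rw [legRootPt, hc, if_pos h1]⟩⟩
  · have hs := isSlope_diag (edgeSign q)
    set σ := diagSlope (edgeSign q) with hσ
    rw [stableMult_eq_rootCount ha, if_neg (edgePt_ne_vert ht ht').1,
      if_neg (edgePt_ne_vert ht ht').2, rootCount_edgePt a q ht ht'] at hzero
    have hcount : edgeCount a q (edgePt q t) + 6 = (dualCell a (edgePt q t)).sup σ +
        (dualCell a (edgePt q t)).sup fun m => 6 - σ m := edgeCount_edgePt a q ht ht'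
    have hconst : ∀ r ∈ dualCell a (edgePt q t), σ r = σ m := by
      intro r hr
      have f1 := Finset.le_sup (f := σ) hr
      have f2 := Finset.le_sup (f := σ) hm
      have f3 : 6 - _ ≤ _ := Finset.le_sup (f := fun m => 6 - σ m) hr
      have f4 : 6 - _ ≤ _ := Finset.le_sup (f := fun m => 6 - σ m) hm
      have := hs.le r
      have := hs.le m
      omega
    set k := σ m with hk
    set κ := root a σ k (vert0 q)
    set c := if 1 ≤ k then max κ 0 else 0 with hc
    have hc0 : 0 ≤ c := by
      rw [hc]; split_ifs
      · exact le_max_right _ _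
      · exact le_rfl
    have hct : c ≤ t := by
      rw [hc]; split_ifs with h1
      · exact max_le ((hs.root_le_iff a _ h1 (hs.le m) t).2 ⟨m, hm, le_rfl⟩) ht.le
      · exact ht.le
    have hcurve : ∀ u, c ≤ u → u ≤ t → edgePt q u ∈ curve a := by
      intro u hu hut
      have hκ : 1 ≤ k → κ ≤ u := fun h1 => by
        rw [hc, if_pos h1] at hu
        exact (le_max_left _ _).trans hu
      refine ⟨m, hs.mem_dualCell_of_root_le hm hut hκ, m', ?_, hne⟩
      refine hs.mem_dualCell_of_root_le hm' hut ?_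
      rw [hconst m' hm']
      exact hκ
    obtain ⟨S, hS, h1, h2, h3⟩ := joined_edge hc0 hct ht'.le hcurve
    refine ⟨_, hS h2, hpos _ (hS h2).2 ?_, S, hS, h1, h3, h2⟩
    rcases hc0.eq_or_lt with h0 | h0
    · rw [← h0, edgePt_zero]
      exact Or.inl (Or.inl rfl)
    · right
      rw [rootCount_edgePt a q h0 (hct.trans_lt ht'), edgeCount, Finset.card_ne_zero]
      have h1 : 1 ≤ k := by
        by_contra hlt
        rw [hc, if_neg hlt] at h0
        exact lt_irrefl _ h0
      refine ⟨k, Finset.mem_filter.2 ⟨Finset.mem_Icc.2 ⟨h1, hs.le m⟩, ?_⟩⟩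
      have h2 : c = max κ 0 := by rw [hc, if_pos h1]
      have h3 : κ ≤ |q.2| := (le_max_left _ _).trans (h2 ▸ (hct.trans ht'.le))
      rw [edgeRootPt, min_eq_left h3, ← h2]
  · exact absurd (stableMult_vert_pos ha h ⟨m, hm, m', hm', hne⟩) hmult

/-! ### Components of the intersection -/

theorem mem_interComponents {a : Expo 3 → ℝ} {q : Param} {C : Set (ℝ × ℝ)} :
    C ∈ interComponents a q ↔ ∃ p ∈ inter a q, C = connectedComponentIn (inter a q) p := Iff.rfl

theorem mem_component_of_joined {X S : Set (ℝ × ℝ)} {p x y : ℝ × ℝ} (hS : S ⊆ X)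
    (hc : IsPreconnected S) (hx : x ∈ S) (hy : y ∈ S) (h : x ∈ connectedComponentIn X p) :
    y ∈ connectedComponentIn X p := by
  rw [connectedComponentIn_eq h]
  exact hc.subset_connectedComponentIn hx hS hy

theorem mem_component_iff_of_joined {X S : Set (ℝ × ℝ)} {p x y : ℝ × ℝ} (hS : S ⊆ X)
    (hc : IsPreconnected S) (hx : x ∈ S) (hy : y ∈ S) :
    x ∈ connectedComponentIn X p ↔ y ∈ connectedComponentIn X p :=
  ⟨mem_component_of_joined hS hc hx hy, mem_component_of_joined hS hc hy hx⟩

theorem mem_component_iff {X : Set (ℝ × ℝ)} {x p : ℝ × ℝ} (hx : x ∈ X) :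
    x ∈ connectedComponentIn X p ↔ connectedComponentIn X x = connectedComponentIn X p :=
  ⟨fun h => (connectedComponentIn_eq h).symm, fun h => h ▸ mem_connectedComponentIn hx⟩

open Classical in
/-- The points of the stable intersection. -/
def multPts (a : Expo 3 → ℝ) (q : Param) : Finset (ℝ × ℝ) :=
  (rootPts a q).filter fun p => 0 < stableMult a (lineCoeff q) p

theorem mem_multPts {a : Expo 3 → ℝ} (ha : IsSmooth a) {q : Param} {p : ℝ × ℝ} :
    p ∈ multPts a q ↔ 0 < stableMult a (lineCoeff q) p := by
  rw [multPts, Finset.mem_filter, and_iff_right_iff_imp]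
  intro h
  by_contra hc
  rw [stableMult_eq_zero ha hc] at h
  exact lt_irrefl _ h

theorem mem_inter_of_mem_multPts {a : Expo 3 → ℝ} (ha : IsSmooth a) {q : Param} {p : ℝ × ℝ}
    (hp : p ∈ multPts a q) : p ∈ inter a q := by
  rw [mem_multPts ha] at hp
  constructor
  · by_contra hc
    rw [stableMult_eq_zero_of_notMem_lam ha hc] at hp
    exact lt_irrefl _ hp
  · by_contra hc
    rw [stableMult_eq_zero_of_notMem_curve hc] at hp
    exact lt_irrefl _ hp

open Classical in
theorem totalMult_eq_sum_multPts {a : Expo 3 → ℝ} (ha : IsSmooth a) (q : Param)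
    (C : Set (ℝ × ℝ)) :
    totalMult a q C = ∑ p ∈ (multPts a q).filter (· ∈ C), stableMult a (lineCoeff q) p := by
  rw [totalMult_eq_sum ha, ← Finset.sum_filter, multPts, Finset.filter_filter]
  symm
  apply Finset.sum_subset
  · intro p hp
    simp only [Finset.mem_filter] at hp ⊢
    exact ⟨hp.1, hp.2.2⟩
  · intro p hp hnp
    simp only [Finset.mem_filter] at hp hnp
    have h0 := stableMult_nonneg ha q p
    by_contra hne
    exact hnp ⟨hp.1, lt_of_le_of_ne h0 (Ne.symm hne), hp.2⟩

open Classical in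
/-- The total multiplicity on a union of components is the sum over these components. -/
theorem totalMult_eq_sum_components {a : Expo 3 → ℝ} (ha : IsSmooth a) (q : Param)
    (U : Set (ℝ × ℝ)) (hU : ∀ p ∈ inter a q, p ∈ U → connectedComponentIn (inter a q) p ⊆ U) :
    totalMult a q U =
      ∑ C ∈ ((multPts a q).filter (· ∈ U)).image (connectedComponentIn (inter a q)),
        totalMult a q C := by
  rw [totalMult_eq_sum_multPts ha, ← Finset.sum_fiberwise_of_maps_to
    (fun p hp => Finset.mem_image_of_mem (connectedComponentIn (inter a q)) hp)]
  refine Finset.sum_congr rfl fun C hC => ?_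
  obtain ⟨p, hp, rfl⟩ := Finset.mem_image.1 hC
  rw [Finset.mem_filter] at hp
  rw [totalMult_eq_sum_multPts ha]
  congr 1
  ext x
  simp only [Finset.mem_filter]
  constructor
  · rintro ⟨⟨h1, h2⟩, h3⟩
    exact ⟨h1, h3 ▸ mem_connectedComponentIn (mem_inter_of_mem_multPts ha h1)⟩
  · rintro ⟨h1, h2⟩
    refine ⟨⟨h1, hU p (mem_inter_of_mem_multPts ha hp.1) hp.2 h2⟩, ?_⟩
    exact (mem_component_iff (mem_inter_of_mem_multPts ha h1)).1 h2

theorem totalMult_pos {a : Expo 3 → ℝ} (ha : IsSmooth a) {q : Param} {C : Set (ℝ × ℝ)}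
    {p : ℝ × ℝ} (hp : p ∈ multPts a q) (hC : p ∈ C) : 0 < totalMult a q C := by
  classical
  rw [totalMult_eq_sum_multPts ha]
  refine Finset.sum_pos (fun x hx => ?_) ⟨p, Finset.mem_filter.2 ⟨hp, hC⟩⟩
  exact (mem_multPts ha).1 (Finset.mem_filter.1 hx).1

open Classical in
-- Each component contains a point of positive multiplicity; hence there are finitely many, and all
-- have positive total multiplicity.
theorem interComponents_eq {a : Expo 3 → ℝ} (ha : IsSmooth a) (q : Param) :
    interComponents a q = ((multPts a q).image (connectedComponentIn (inter a q)) : Finset _) := by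
  ext C
  rw [mem_interComponents, Finset.mem_coe, Finset.mem_image]
  constructor
  · rintro ⟨p, hp, rfl⟩
    obtain ⟨p', hp', hpos, S, hS, h1, h2, h3⟩ := exists_stableMult_pos ha hp
    refine ⟨p', (mem_multPts ha).2 hpos, ?_⟩
    rw [← mem_component_iff hp']
    exact h1.subset_connectedComponentIn h2 hS h3
  · rintro ⟨p, hp, rfl⟩
    exact ⟨p, mem_inter_of_mem_multPts ha hp, rfl⟩

/-- A curve is tritangent if and only if all components have even multiplicity. -/
theorem isTritangent_iff_even {a : Expo 3 → ℝ} (ha : IsSmooth a) (q : Param) :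
    IsTritangent a q ↔ ∀ C ∈ interComponents a q, Even (totalMult a q C) := by
  classical
  constructor
  · rintro (⟨C₁, C₂, C₃, -, -, -, h, h1, h2, h3⟩ | ⟨C₁, C₂, -, h, h1, h2⟩ | ⟨C, h, h1⟩) D hD <;>
      rw [h] at hD
    · rcases hD with rfl | rfl | rfl
      · rw [h1]; decide
      · rw [h2]; decide
      · rw [h3]; decide
    · rcases hD with rfl | rfl
      · rw [h1]; decide
      · rw [h2]; decide
    · rw [mem_singleton_iff.1 hD, h1]; decide
  · intro heven
    set 𝒞 := (multPts a q).image (connectedComponentIn (inter a q)) with h𝒞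
    have hset := interComponents_eq ha q
    rw [← h𝒞] at hset
    have hsum : ∑ C ∈ 𝒞, totalMult a q C = 6 := by
      have := totalMult_eq_sum_components ha q univ (fun _ _ _ => subset_univ _)
      rw [totalMult_univ ha] at this
      simpa [h𝒞] using this.symm
    have hge : ∀ C ∈ 𝒞, 2 ≤ totalMult a q C ∧ Even (totalMult a q C) := by
      intro C hC
      have he := heven C (by rw [hset]; exact hC)
      obtain ⟨p, hp, rfl⟩ := Finset.mem_image.1 hC
      have := totalMult_pos ha hp
        (mem_connectedComponentIn (mem_inter_of_mem_multPts ha hp))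
      obtain ⟨k, hk⟩ := he
      exact ⟨by omega, k, hk⟩
    -- Positive even numbers with sum six: only `6`, `2 + 4` and `2 + 2 + 2` are possible.
    have hcard : 2 * (𝒞.card : ℤ) ≤ 6 := by
      rw [← hsum, mul_comm, ← nsmul_eq_mul]
      exact Finset.card_nsmul_le_sum _ _ _ fun C hC => (hge C hC).1
    have hcases : 𝒞.card = 0 ∨ 𝒞.card = 1 ∨ 𝒞.card = 2 ∨ 𝒞.card = 3 := by omega
    rcases hcases with h | h | h | h
    · rw [Finset.card_eq_zero] at h
      rw [h] at hsum
      simp at hsum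
    · obtain ⟨C, hC⟩ := Finset.card_eq_one.1 h
      rw [hC] at hset hsum
      exact Or.inr (Or.inr ⟨C, by simpa using hset, by simpa using hsum⟩)
    · obtain ⟨C, D, hne, hC⟩ := Finset.card_eq_two.1 h
      rw [hC] at hset hsum hge
      rw [Finset.sum_pair hne] at hsum
      obtain ⟨h1, k1, e1⟩ := hge C (by simp)
      obtain ⟨h2, k2, e2⟩ := hge D (by simp)
      rcases (show totalMult a q C = 2 ∨ totalMult a q C = 4 by omega) with h | h
      · exact Or.inr (Or.inl ⟨C, D, hne, by simpa using hset, h, by omega⟩)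
      · exact Or.inr (Or.inl ⟨D, C, hne.symm, by simpa [Set.pair_comm] using hset, by omega, h⟩)
    · obtain ⟨C, D, E, h12, h13, h23, hC⟩ := Finset.card_eq_three.1 h
      rw [hC] at hset hsum hge
      rw [Finset.sum_insert (by simp [h12, h13]), Finset.sum_pair h23] at hsum
      obtain ⟨h1, -⟩ := hge C (by simp)
      obtain ⟨h2, -⟩ := hge D (by simp)
      obtain ⟨h3, -⟩ := hge E (by simp)
      exact Or.inl ⟨C, D, E, h12, h13, h23, by simpa using hset, by omega, by omega, by omega⟩

/-! ### Parity implies tritangency -/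

/-- Between two consecutive roots the slope is the index of the first. The guards on `k` allow for
the absence of a root of index `0` or `N + 1`. -/
theorem IsSlope.eq_of_singleton {d : ℝ × ℝ} {σ : Expo 3 → ℕ} {N : ℕ} (h : IsSlope d σ N)
    {a : Expo 3 → ℝ} {v : ℝ × ℝ} {k : ℕ} (hkN : k ≤ N) {t : ℝ}
    (h1 : 1 ≤ k → root a σ k v ≤ t) (h2 : k + 1 ≤ N → t ≤ root a σ (k + 1) v) {m : Expo 3}
    (hm : dualCell a (v + t • d) = {m}) : σ m = k := by
  apply le_antisymm
  · by_contra hc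
    push Not at hc
    have hN := h.le m
    have := (h.root_lt_iff a v (by omega) (by omega : k + 1 ≤ N) t).2 fun r hr => by
      rw [hm, Finset.mem_singleton] at hr
      rw [hr]; exact hc
    exact absurd (h2 (by omega)) (not_le.2 this)
  · rcases Nat.eq_zero_or_pos k with h0 | h0
    · omega
    · obtain ⟨r, hr, hle⟩ := (h.root_le_iff a v h0 hkN t).1 (h1 h0)
      rw [hm, Finset.mem_singleton] at hr
      rwa [hr] at hle

/-- A chamber met between the roots `k` and `k + 1` would have slope `k`, against parity. Thus the
leg runs inside `Γ` there. -/
theorem Par.leg_mem_curve {a : Expo 3 → ℝ} {q : Param} (h : Par a q) {L : Leg} {k : ℕ}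
    (hk : Even k) (hk3 : k ≤ 3) {t : ℝ} (ht : 0 ≤ t)
    (h1 : 1 ≤ k → root a (legSlope L) k (legVertex q L) ≤ t)
    (h2 : t ≤ root a (legSlope L) (k + 1) (legVertex q L)) : legPt q L t ∈ curve a := by
  by_contra hc
  obtain ⟨m, hm⟩ := notMem_curve_iff.1 hc
  have h3 := h.1 L t ht m hm
  rw [(isSlope_leg L).eq_of_singleton hk3 h1 (fun _ => h2) hm] at h3
  exact (Nat.not_odd_iff_even.2 hk) h3

theorem Par.edge_mem_curve {a : Expo 3 → ℝ} {q : Param} (h : Par a q) (hq : q.2 ≠ 0) {k : ℕ}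
    (hk : Odd k) (hk3 : k ≤ 6) {t : ℝ} (ht : 0 ≤ t) (ht' : t ≤ |q.2|)
    (h1 : root a (diagSlope (edgeSign q)) k (vert0 q) ≤ t)
    (h2 : t ≤ root a (diagSlope (edgeSign q)) (k + 1) (vert0 q)) : edgePt q t ∈ curve a := by
  by_contra hc
  obtain ⟨m, hm⟩ := notMem_curve_iff.1 hc
  have h3 := h.2 hq t ht ht' m hm
  rw [(isSlope_diag (edgeSign q)).eq_of_singleton hk3 (fun _ => h1) (fun _ => h2) hm] at h3
  exact (Nat.not_even_iff_odd.2 hk) h3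

/-- Slope zero is even, so a leg follows `Γ` from its vertex to the first root. The next lemma uses
slope two in the same way, between the second and the third root. -/
theorem Par.legRootPt_one {a : Expo 3 → ℝ} {q : Param} (h : Par a q) (L : Leg) (p : ℝ × ℝ) :
    legVertex q L ∈ connectedComponentIn (inter a q) p ↔
      legRootPt a q L 1 ∈ connectedComponentIn (inter a q) p := by
  rw [← legPt_zero, legRootPt]
  rcases le_or_gt (root a (legSlope L) 1 (legVertex q L)) 0 with h0 | h0
  · rw [max_eq_right h0]
  · rw [max_eq_left h0.le]
    obtain ⟨S, hS, h1, h2, h3⟩ := joined_leg (a := a) (q := q) (L := L) le_rfl h0.le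
      fun u hu hu' => h.leg_mem_curve (k := 0) (by decide) (by norm_num) hu (by simp) hu'
    exact mem_component_iff_of_joined hS h1 h2 h3

theorem Par.legRootPt_two {a : Expo 3 → ℝ} {q : Param} (h : Par a q) (L : Leg) (p : ℝ × ℝ) :
    legRootPt a q L 2 ∈ connectedComponentIn (inter a q) p ↔
      legRootPt a q L 3 ∈ connectedComponentIn (inter a q) p := by
  rw [legRootPt, legRootPt]
  have hmono := (isSlope_leg L).root_mono a (legVertex q L) (k := 2) (l := 3) (by norm_num)
    (by norm_num) le_rfl
  set r := root a (legSlope L) 2 (legVertex q L) with hr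
  set s := root a (legSlope L) 3 (legVertex q L) with hs
  rcases le_or_gt s 0 with h0 | h0
  · rw [max_eq_right h0, max_eq_right (hmono.trans h0)]
  · obtain ⟨S, hS, h1, h2, h3⟩ := joined_leg (a := a) (q := q) (L := L) (s := max r 0)
      (t := max s 0) (le_max_right _ _) (max_le_max_right _ hmono)
      fun u hu hu' => h.leg_mem_curve (k := 2) (by decide) (by norm_num)
        ((le_max_right _ _).trans hu) (fun _ => (le_max_left _ _).trans hu)
        (hu'.trans_eq (max_eq_left h0.le))
    exact mem_component_iff_of_joined hS h1 h2 h3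

/-- Odd slopes are forbidden on the edge, which joins the roots `1` and `2`, `3` and `4`, `5` and
`6`. -/
theorem Par.edgeRootPt_pair {a : Expo 3 → ℝ} {q : Param} (h : Par a q) {k : ℕ} (hk : Odd k)
    (hk6 : k + 1 ≤ 6) (p : ℝ × ℝ) :
    edgeRootPt a q k ∈ connectedComponentIn (inter a q) p ↔
      edgeRootPt a q (k + 1) ∈ connectedComponentIn (inter a q) p := by
  rw [edgeRootPt, edgeRootPt]
  have hmono := (isSlope_diag (edgeSign q)).root_mono a (vert0 q) (k := k) (l := k + 1) hk.pos
    (by omega) hk6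
  set r := root a (diagSlope (edgeSign q)) k (vert0 q) with hr
  set s := root a (diagSlope (edgeSign q)) (k + 1) (vert0 q) with hs
  have hle : max (min r |q.2|) 0 ≤ max (min s |q.2|) 0 :=
    max_le_max_right _ (min_le_min_right _ hmono)
  rcases hle.eq_or_lt with he | hlt
  · rw [he]
  have hT : max (min s |q.2|) 0 ≤ |q.2| := max_le (min_le_right _ _) (abs_nonneg _)
  -- The two placed roots differ, so the edge is nondegenerate and its parity condition is
  -- available.
  have hq : q.2 ≠ 0 := by
    intro h0
    rw [h0, abs_zero] at hT hlt
    exact absurd (hlt.trans_le hT) (not_lt.2 (le_max_right _ _))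
  have hr1 : r ≤ max (min r |q.2|) 0 := by
    rcases le_or_gt r |q.2| with h1 | h1
    · rw [min_eq_left h1]; exact le_max_left _ _
    · rw [min_eq_right h1.le] at hlt
      exact absurd (hlt.trans_le hT) (not_lt.2 (le_max_left _ _))
  have hs1 : max (min s |q.2|) 0 ≤ s := by
    rcases max_choice (min s |q.2|) 0 with h1 | h1
    · rw [h1]; exact min_le_left _ _
    · rw [h1] at hlt
      exact absurd hlt (not_lt.2 (le_max_right _ _))
  obtain ⟨S, hS, h1, h2, h3⟩ := joined_edge (a := a) (q := q) (le_max_right _ _) hle hT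
    fun u hu hu' => h.edge_mem_curve hq hk (by omega) ((le_max_right _ _).trans hu)
      (hu'.trans hT) (hr1.trans hu) (hu'.trans hs1)
  exact mem_component_iff_of_joined hS h1 h2 h3

theorem card_filter_Icc_three (P : ℕ → Prop) [DecidablePred P] :
    ((Finset.Icc 1 3).filter P).card =
      (if P 1 then 1 else 0) + (if P 2 then 1 else 0) + (if P 3 then 1 else 0) := by
  rw [Finset.card_filter, show Finset.Icc 1 3 = ({1, 2, 3} : Finset ℕ) from rfl,
    Finset.sum_insert (by decide), Finset.sum_insert (by decide), Finset.sum_singleton, add_assoc]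

theorem card_filter_Icc_six (P : ℕ → Prop) [DecidablePred P] :
    ((Finset.Icc 1 6).filter P).card =
      (if P 1 then 1 else 0) + (if P 2 then 1 else 0) + (if P 3 then 1 else 0) +
      (if P 4 then 1 else 0) + (if P 5 then 1 else 0) + (if P 6 then 1 else 0) := by
  rw [Finset.card_filter, show Finset.Icc 1 6 = ({1, 2, 3, 4, 5, 6} : Finset ℕ) from rfl,
    Finset.sum_insert (by decide), Finset.sum_insert (by decide), Finset.sum_insert (by decide),
    Finset.sum_insert (by decide), Finset.sum_insert (by decide), Finset.sum_singleton]
  simp only [add_assoc]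

/-- Modulo two, a component counts one for each leg whose vertex it contains: the first root goes
with the vertex, and all other roots come in pairs. Two legs are attached to `vert0` and two to
`vert1`, and the subtracted sixes are even. -/
theorem Par.isTritangent {a : Expo 3 → ℝ} (ha : IsSmooth a) {q : Param} (h : Par a q) :
    IsTritangent a q := by
  classical
  rw [isTritangent_iff_even ha]
  intro C hC
  obtain ⟨p, -, rfl⟩ := mem_interComponents.1 hC
  set C := connectedComponentIn (inter a q) p
  have hL : ∀ L, ∃ k, legIn a q L C = (if legVertex q L ∈ C then 1 else 0) + 2 * k := by
    intro L
    refine ⟨if legRootPt a q L 2 ∈ C then 1 else 0, ?_⟩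
    rw [legIn, card_filter_Icc_three]
    simp only [← h.legRootPt_one L p, ← h.legRootPt_two L p, C]
    ring
  have hE : ∃ k, edgeIn a q C = 2 * k := by
    refine ⟨(if edgeRootPt a q 1 ∈ C then 1 else 0) + (if edgeRootPt a q 3 ∈ C then 1 else 0) +
      (if edgeRootPt a q 5 ∈ C then 1 else 0), ?_⟩
    rw [edgeIn, card_filter_Icc_six]
    have e1 := h.edgeRootPt_pair (k := 1) (by decide) (by norm_num) p
    have e3 := h.edgeRootPt_pair (k := 3) (by decide) (by norm_num) p
    have e5 := h.edgeRootPt_pair (k := 5) (by decide) (by norm_num) p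
    norm_num only at e1 e3 e5
    simp only [← e1, ← e3, ← e5, C]
    ring
  obtain ⟨k1, e1⟩ := hL (lowLeg (edgeSign q))
  obtain ⟨k2, e2⟩ := hL .negVert
  obtain ⟨k3, e3⟩ := hL (highLeg (edgeSign q))
  obtain ⟨k4, e4⟩ := hL .posVert
  obtain ⟨k5, e5⟩ := hE
  rw [legVertex_lowLeg] at e1
  rw [legVertex_highLeg] at e3
  change _ = (if vert0 q ∈ C then 1 else 0) + 2 * k2 at e2
  change _ = (if vert1 q ∈ C then 1 else 0) + 2 * k4 at e4
  have htot : totalMult a q C = legIn a q (lowLeg (edgeSign q)) C + legIn a q .negVert C +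
      legIn a q (highLeg (edgeSign q)) C + legIn a q .posVert C + edgeIn a q C -
      (if vert0 q ∈ C then 6 else 0) - (if vert1 q ∈ C then 6 else 0) := by
    rw [totalMult_eq ha]
    generalize edgeSign q = b
    cases b <;> simp only [lowLeg, highLeg]
    ring
  rw [htot, e1, e2, e3, e4, e5, Int.even_iff]
  split_ifs <;> push_cast <;> omega

/-! ### Tritangency implies parity -/

/-- Cutting along a line which misses the intersection, both sides have even multiplicity. -/
theorem IsTritangent.even_of_cut {a : Expo 3 → ℝ} (ha : IsSmooth a) {q : Param}
    (h : IsTritangent a q) (f : ℝ × ℝ → ℝ) (hf : Continuous f) (c : ℝ)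
    (hc : ∀ p ∈ inter a q, f p ≠ c) : Even (totalMult a q {p | c < f p}) := by
  classical
  rw [totalMult_eq_sum_components ha]
  · refine even_iff_two_dvd.2 (Finset.dvd_sum fun C hC => even_iff_two_dvd.1 ?_)
    obtain ⟨p, hp, rfl⟩ := Finset.mem_image.1 hC
    exact (isTritangent_iff_even ha q).1 h _
      ⟨p, mem_inter_of_mem_multPts ha (Finset.mem_filter.1 hp).1, rfl⟩
  · intro p hp hpc
    refine isPreconnected_connectedComponentIn.subset_left_of_subset_union
      (u := {p | c < f p}) (v := {p | f p < c}) (isOpen_lt continuous_const hf)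
      (isOpen_lt hf continuous_const) ?_ ?_ ⟨p, mem_connectedComponentIn hp, hpc⟩
    · rw [Set.disjoint_left]
      intro x hx hx'
      have h1 : c < f x := hx
      have h2 : f x < c := hx'
      exact lt_asymm h1 h2
    · intro x hx
      rcases lt_or_gt_of_ne (hc x (connectedComponentIn_subset _ _ hx)) with h | h
      · exact Or.inr h
      · exact Or.inl h

/-- The linear form measuring the direction `d`. -/
def form (d p : ℝ × ℝ) : ℝ := d.1 * p.1 + d.2 * p.2

theorem continuous_form (d : ℝ × ℝ) : Continuous (form d) := by unfold form; fun_prop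

theorem form_add_smul (d p u : ℝ × ℝ) (t : ℝ) : form d (p + t • u) = form d p + t * form d u := by
  simp only [form, Prod.fst_add, Prod.snd_add, Prod.smul_fst, Prod.smul_snd, smul_eq_mul]; ring

theorem form_legDir_self (L : Leg) : form (legDir L) (legDir L) = 1 := by
  cases L <;> simp [form, legDir]

theorem form_legDir_ne {L L' : Leg} (h : L' ≠ L) : form (legDir L) (legDir L') ≤ 0 := by
  cases L <;> cases L' <;> first | exact absurd rfl h | simp [form, legDir]

/-- Each leg sticks out of `Λ`: off the leg, the linear form in its direction never exceeds the
value at its vertex. Hence a perpendicular line through an interior point of the leg meets `Λ`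
nowhere else. -/
theorem form_vert_le (q : Param) (L : Leg) :
    form (legDir L) (vert0 q) ≤ form (legDir L) (legVertex q L) ∧
    form (legDir L) (vert1 q) ≤ form (legDir L) (legVertex q L) := by
  rcases le_or_gt 0 q.2 with h | h
  · have := abs_of_nonneg h
    cases L <;> simp [form, legDir, legVertex, h, vert0, vert1]
  · have := abs_of_neg h
    cases L <;> simp [form, legDir, legVertex, not_le.2 h, vert0, vert1, h.le]

theorem form_legVertex_le (q : Param) (L L' : Leg) :
    form (legDir L) (legVertex q L') ≤ form (legDir L) (legVertex q L) := by
  rcases legVertex_eq q L' with h | h <;> rw [h]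
  · exact (form_vert_le q L).1
  · exact (form_vert_le q L).2

theorem form_legPt_le {q : Param} {L L' : Leg} (h : L' ≠ L) {t : ℝ} (ht : 0 ≤ t) :
    form (legDir L) (legPt q L' t) ≤ form (legDir L) (legVertex q L) := by
  rw [legPt, form_add_smul]
  have := form_legVertex_le q L L'
  have := mul_nonpos_of_nonneg_of_nonpos ht (form_legDir_ne h)
  linarith

theorem form_edgePt_le {q : Param} {L : Leg} {t : ℝ} (ht : 0 ≤ t) (ht' : t ≤ |q.2|) :
    form (legDir L) (edgePt q t) ≤ form (legDir L) (legVertex q L) := by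
  obtain ⟨h0, h1⟩ := form_vert_le q L
  rw [← edgePt_abs, edgePt, form_add_smul] at h1
  rw [edgePt, form_add_smul]
  rcases le_or_gt (form (legDir L) (edgeDir (edgeSign q))) 0 with h | h
  · have := mul_nonpos_of_nonneg_of_nonpos ht h
    linarith
  · have := mul_le_mul_of_nonneg_right ht' h.le
    linarith

theorem form_legPt_self (q : Param) (L : Leg) (t : ℝ) :
    form (legDir L) (legPt q L t) = form (legDir L) (legVertex q L) + t := by
  rw [legPt, form_add_smul, form_legDir_self, mul_one]

theorem eventually_line_mem {a : Expo 3 → ℝ} {v d : ℝ × ℝ} {m : Expo 3} {t : ℝ}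
    (hm : dualCell a (v + t • d) = {m}) : ∀ᶠ s in 𝓝 t, dualCell a (v + s • d) = {m} := by
  filter_upwards [(continuous_line v d).continuousAt.eventually
    (eventually_dualCell_subset a (v + t • d))] with s hs
  rw [hm] at hs
  exact (Finset.Nonempty.subset_singleton_iff (dualCell_nonempty a _)).1 hs

theorem IsSlope.card_root_gt {d : ℝ × ℝ} {σ : Expo 3 → ℕ} {N : ℕ} (h : IsSlope d σ N)
    {a : Expo 3 → ℝ} {v : ℝ × ℝ} {t : ℝ} {m : Expo 3} (hm : dualCell a (v + t • d) = {m}) :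
    ((Finset.Icc 1 N).filter fun k => t < root a σ k v).card = N - σ m := by
  have h1 := h.card_root_le' a v t
  rw [hm, Finset.sup_singleton] at h1
  have h2 := Finset.card_filter_add_card_filter_not (s := Finset.Icc 1 N)
    (fun k => root a σ k v ≤ t)
  simp only [not_le, Nat.card_Icc] at h2
  omega

open Classical in
-- A perpendicular cut at a point off `Γ` isolates the outer part of the leg. It contains `3 -
-- legSlope L m` roots and no vertex, and this number must be even.
theorem IsTritangent.odd_legSlope {a : Expo 3 → ℝ} (ha : IsSmooth a) {q : Param}
    (h : IsTritangent a q) {L : Leg} {t : ℝ} (ht : 0 < t) {m : Expo 3}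
    (hm : dualCell a (legPt q L t) = {m}) : Odd (legSlope L m) := by
  set c := form (legDir L) (legPt q L t) with hc
  have hcv : form (legDir L) (legVertex q L) < c := by rw [hc, form_legPt_self]; linarith
  have hcut : ∀ p ∈ inter a q, form (legDir L) p ≠ c := by
    rintro p ⟨hpl, hpc⟩ he
    rcases mem_lam_cases hpl with ⟨L', s, hs, rfl⟩ | ⟨s, hs, hs', rfl⟩ | rfl | rfl
    · by_cases hL : L' = L
      · subst hL
        rw [hc, form_legPt_self, form_legPt_self, add_right_inj] at he
        subst he
        exact notMem_curve_iff.2 ⟨m, hm⟩ hpc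
      · have := form_legPt_le (q := q) hL hs.le
        linarith
    · have := form_edgePt_le (L := L) hs.le hs'.le
      linarith
    · have := (form_vert_le q L).1
      linarith
    · have := (form_vert_le q L).2
      linarith
  have heven := h.even_of_cut ha _ (continuous_form (legDir L)) c hcut
  set U := {p | c < form (legDir L) p} with hU
  have hL : ∀ L', L' ≠ L → legIn a q L' U = 0 := by
    intro L' hL
    rw [legIn, Finset.card_eq_zero, Finset.filter_eq_empty_iff]
    intro k _ hk
    have := form_legPt_le (q := q) hL (le_max_right (root a (legSlope L') k (legVertex q L')) 0)
    have : c < form _ (legRootPt a q L' k) := hk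
    rw [legRootPt] at this
    linarith
  have hE : edgeIn a q U = 0 := by
    rw [edgeIn, Finset.card_eq_zero, Finset.filter_eq_empty_iff]
    intro k _ hk
    have h1 : c < form (legDir L) (edgeRootPt a q k) := hk
    rw [edgeRootPt] at h1
    have := form_edgePt_le (q := q) (L := L) (le_max_right (min (root a (diagSlope (edgeSign q)) k
      (vert0 q)) |q.2|) 0) (max_le (min_le_right _ _) (abs_nonneg _))
    linarith
  have h0 : vert0 q ∉ U := fun hv => by
    have := (form_vert_le q L).1
    have : c < _ := hv
    linarith
  have h1 : vert1 q ∉ U := fun hv => by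
    have := (form_vert_le q L).2
    have : c < _ := hv
    linarith
  have hown : legIn a q L U = 3 - legSlope L m := by
    rw [← (isSlope_leg L).card_root_gt hm, legIn]
    congr 1
    ext k
    simp only [Finset.mem_filter, hU, mem_ofPred_eq, legRootPt, hc, form_legPt_self,
      add_lt_add_iff_left, lt_max_iff, not_lt.2 ht.le, or_false]
  rw [totalMult_eq ha, if_neg h0, if_neg h1, hE] at heven
  have hle := (isSlope_leg L).le m
  have : totalMult a q U = ((3 - legSlope L m : ℕ) : ℤ) := by
    rw [totalMult_eq ha, if_neg h0, if_neg h1, hE, ← hown]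
    cases L <;> simp [hL]
  have heven := h.even_of_cut ha _ (continuous_form (legDir L)) c hcut
  rw [← hU, this] at heven
  have : Even (3 - legSlope L m) := by exact_mod_cast heven
  rw [Nat.even_iff] at this
  rw [Nat.odd_iff]
  omega

theorem form_edgeDir_self (b : Bool) : form (edgeDir b) (edgeDir b) = 2 := by
  cases b <;> norm_num [form, edgeDir]

theorem form_edgeDir_low (b : Bool) : form (edgeDir b) (legDir (lowLeg b)) ≤ 0 ∧
    form (edgeDir b) (legDir .negVert) ≤ 0 := by
  cases b <;> simp [form, edgeDir, legDir, lowLeg]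

theorem form_edgeDir_high (b : Bool) : 0 ≤ form (edgeDir b) (legDir (highLeg b)) ∧
    0 ≤ form (edgeDir b) (legDir .posVert) := by
  cases b <;> simp [form, edgeDir, legDir, highLeg]

open Classical in
-- Above a perpendicular cut of the edge lie two complete legs with three roots each, one vertex
-- counted with `-6`, and `6 - diagSlope` roots of the edge. The total must be even.
theorem IsTritangent.even_diagSlope {a : Expo 3 → ℝ} (ha : IsSmooth a) {q : Param}
    (h : IsTritangent a q) {t : ℝ} (ht : 0 < t) (ht' : t < |q.2|) {m : Expo 3}
    (hm : dualCell a (edgePt q t) = {m}) : Even (diagSlope (edgeSign q) m) := by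
  set b := edgeSign q with hb
  set φ := form (edgeDir b) with hφ
  set c := φ (edgePt q t) with hc
  have hedge : ∀ s, φ (edgePt q s) = φ (vert0 q) + s * 2 := fun s => by
    rw [edgePt, hφ, form_add_smul, form_edgeDir_self]
  have hv1 : φ (vert1 q) = φ (vert0 q) + |q.2| * 2 := by rw [← edgePt_abs, hedge]
  have hcv : c = φ (vert0 q) + t * 2 := by rw [hc, hedge]
  have hlow : ∀ L, L = lowLeg b ∨ L = .negVert → ∀ s, 0 ≤ s → φ (legPt q L s) < c := by
    intro L hL s hs
    have hv : legVertex q L = vert0 q := by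
      rcases hL with rfl | rfl
      · exact legVertex_lowLeg q
      · rfl
    have hd : form (edgeDir b) (legDir L) ≤ 0 := by
      rcases hL with rfl | rfl
      · exact (form_edgeDir_low b).1
      · exact (form_edgeDir_low b).2
    rw [legPt, hv, hφ, form_add_smul, ← hφ]
    have := mul_nonpos_of_nonneg_of_nonpos hs hd
    linarith
  have hhigh : ∀ L, L = highLeg b ∨ L = .posVert → ∀ s, 0 ≤ s → c < φ (legPt q L s) := by
    intro L hL s hs
    have hv : legVertex q L = vert1 q := by
      rcases hL with rfl | rfl
      · exact legVertex_highLeg q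
      · rfl
    have hd : 0 ≤ form (edgeDir b) (legDir L) := by
      rcases hL with rfl | rfl
      · exact (form_edgeDir_high b).1
      · exact (form_edgeDir_high b).2
    rw [legPt, hv, hφ, form_add_smul, ← hφ]
    have := mul_nonneg hs hd
    linarith
  have hcut : ∀ p ∈ inter a q, φ p ≠ c := by
    rintro p ⟨hpl, hpc⟩ he
    rcases mem_lam_cases hpl with ⟨L', s, hs, rfl⟩ | ⟨s, hs, hs', rfl⟩ | rfl | rfl
    · rcases leg_cases b L' with hL | hL | hL | hL
      · exact (hlow L' (Or.inl hL) s hs.le).ne he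
      · exact (hlow L' (Or.inr hL) s hs.le).ne he
      · exact (hhigh L' (Or.inl hL) s hs.le).ne' he
      · exact (hhigh L' (Or.inr hL) s hs.le).ne' he
    · rw [hedge, hcv] at he
      have : s = t := by linarith
      subst this
      exact notMem_curve_iff.2 ⟨m, hm⟩ hpc
    · linarith
    · linarith
  have heven := h.even_of_cut ha φ (continuous_form (edgeDir b)) c hcut
  set U := {p | c < φ p} with hU
  have hlow0 : ∀ L, L = lowLeg b ∨ L = .negVert → legIn a q L U = 0 := by
    intro L hL
    rw [legIn, Finset.card_eq_zero, Finset.filter_eq_empty_iff]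
    exact fun k _ hk => lt_asymm (hlow L hL _ (le_max_right _ _)) hk
  have hhigh3 : ∀ L, L = highLeg b ∨ L = .posVert → legIn a q L U = 3 := by
    intro L hL
    rw [legIn, Finset.filter_true_of_mem]
    · rfl
    · exact fun k _ => hhigh L hL _ (le_max_right _ _)
  have h0 : vert0 q ∉ U := fun hv => by
    have : c < _ := hv
    linarith
  have h1 : vert1 q ∈ U := by
    change c < _
    linarith
  have hE : edgeIn a q U = 6 - diagSlope b m := by
    rw [← (isSlope_diag b).card_root_gt hm, edgeIn]
    congr 1
    ext k
    simp only [Finset.mem_filter, hU, mem_ofPred_eq, edgeRootPt, hedge, hcv,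
      add_lt_add_iff_left, ← hb]
    rw [mul_lt_mul_iff_left₀ (by norm_num)]
    simp only [lt_max_iff, lt_min_iff, ht', not_lt.2 ht.le, or_false, and_true]
  have htot : totalMult a q U = legIn a q (lowLeg b) U + legIn a q .negVert U +
      legIn a q (highLeg b) U + legIn a q .posVert U + edgeIn a q U -
      (if vert0 q ∈ U then 6 else 0) - (if vert1 q ∈ U then 6 else 0) := by
    rw [totalMult_eq ha]
    clear_value b
    cases b <;> simp only [lowLeg, highLeg]
    ring
  rw [htot, hlow0 _ (Or.inl rfl), hlow0 _ (Or.inr rfl), hhigh3 _ (Or.inl rfl),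
    hhigh3 _ (Or.inr rfl), hE, if_neg h0, if_pos h1] at heven
  have hle := (isSlope_diag b).le m
  rw [Int.even_iff] at heven
  rw [Nat.even_iff]
  omega

/-- Cuts are made at interior points of the pieces only. Lying in a given chamber is an open
condition, so the slope at a vertex off `Γ` is seen at nearby interior points. -/
theorem IsTritangent.par {a : Expo 3 → ℝ} (ha : IsSmooth a) {q : Param}
    (h : IsTritangent a q) : Par a q := by
  constructor
  · intro L t ht m hm
    rcases ht.eq_or_lt with rfl | ht
    · obtain ⟨s, hs, hs'⟩ := ((eventually_line_mem hm).filter_mono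
        (nhdsWithin_le_nhds (s := Ioi 0)) |>.and self_mem_nhdsWithin).exists
      exact h.odd_legSlope ha hs' hs
    · exact h.odd_legSlope ha ht hm
  · intro hq t ht ht' m hm
    have h0 := abs_pos.2 hq
    have hmem : t ∈ closure (Ioo 0 |q.2|) := by
      rw [closure_Ioo h0.ne]; exact ⟨ht, ht'⟩
    obtain ⟨s, hs, hs'⟩ := mem_closure_iff_nhds.1 hmem _ (eventually_line_mem hm)
    exact h.even_diagSlope ha hs'.1 hs'.2 hs

/-! ### Local structure along a line -/

theorem IsSlope.eventually_top {d : ℝ × ℝ} {σ : Expo 3 → ℕ} {N : ℕ} (h : IsSlope d σ N)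
    (a : Expo 3 → ℝ) (v : ℝ × ℝ) (t : ℝ) :
    ∀ᶠ s in 𝓝[>] t, ∀ m ∈ dualCell a (v + s • d), m ∈ dualCell a (v + t • d) ∧
      ∀ m' ∈ dualCell a (v + t • d), σ m' ≤ σ m := by
  filter_upwards [((continuous_line v d).continuousAt.eventually
    (eventually_dualCell_subset a (v + t • d))).filter_mono nhdsWithin_le_nhds,
    self_mem_nhdsWithin] with s hs hts m hm
  exact ⟨hs hm, fun m' hm' => h.mono hts hm' hm⟩

/-- Just after `t` only exponents of top slope remain active. If `m` were the only one, it would be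
alone there and its slope would satisfy `P`. -/
theorem IsSlope.exists_ne {d : ℝ × ℝ} {σ : Expo 3 → ℕ} {N : ℕ} (h : IsSlope d σ N)
    {a : Expo 3 → ℝ} {v : ℝ × ℝ} {t T : ℝ} (hT : t < T) {P : ℕ → Prop}
    (hP : ∀ s, t < s → s < T → ∀ m, dualCell a (v + s • d) = {m} → P (σ m)) {m : Expo 3}
    (hm : m ∈ dualCell a (v + t • d)) (htop : ∀ m' ∈ dualCell a (v + t • d), σ m' ≤ σ m)
    (hσ : ¬ P (σ m)) : ∃ m' ∈ dualCell a (v + t • d), m' ≠ m ∧ σ m' = σ m := by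
  by_contra! hcon
  obtain ⟨s, ⟨hs, hsT⟩, hts⟩ := (((h.eventually_top a v t).and
    ((eventually_lt_nhds hT).filter_mono nhdsWithin_le_nhds)).and self_mem_nhdsWithin).exists
  refine hσ (hP s hts hsT m ((Finset.Nonempty.subset_singleton_iff (dualCell_nonempty a _)).1
    fun m' hm' => ?_))
  obtain ⟨h1, h2⟩ := hs m' hm'
  rw [Finset.mem_singleton]
  by_contra hne
  exact hcon m' h1 hne (le_antisymm (htop m' h1) (h2 m hm))

/-- If a leg leaves `p` with an even slope, it leaves along an edge of `Γ`. -/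
theorem Par.exists_ne_of_even {a : Expo 3 → ℝ} {q : Param} (h : Par a q) {L : Leg} {t : ℝ}
    (ht : 0 ≤ t) {m : Expo 3} (hm : m ∈ dualCell a (legPt q L t))
    (htop : ∀ m' ∈ dualCell a (legPt q L t), legSlope L m' ≤ legSlope L m)
    (heven : Even (legSlope L m)) :
    ∃ m' ∈ dualCell a (legPt q L t), m' ≠ m ∧ legSlope L m' = legSlope L m :=
  (isSlope_leg L).exists_ne (lt_add_one t) (P := Odd)
    (fun s hs _ n hn => h.1 L s (ht.trans hs.le) n hn) hm htop (Nat.not_odd_iff_even.2 heven)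

/-- The coordinate transverse to the direction `d`. -/
def cross (d p : ℝ × ℝ) : ℝ := d.1 * p.2 - d.2 * p.1

theorem continuous_cross (d : ℝ × ℝ) : Continuous (cross d) := by unfold cross; fun_prop

theorem eq_add_smul_legDir (L : Leg) {p v : ℝ × ℝ} (h : cross (legDir L) p = cross (legDir L) v) :
    p = v + (form (legDir L) p - form (legDir L) v) • legDir L := by
  cases L <;> simp [cross, form, legDir] at h ⊢ <;> ext <;> simp [h]

theorem cross_legPt (q : Param) (L : Leg) (t : ℝ) :
    cross (legDir L) (legPt q L t) = cross (legDir L) (legVertex q L) := by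
  cases L <;> simp [cross, legDir, legPt]

/-- An edge of `Γ` dual to a segment orthogonal to `d` lies on a line of direction `d`. -/
theorem cross_eq_of_mem {n : ℕ} {a : Expo n → ℝ} {p p' : ℝ × ℝ} {m m' : Expo n} {L : Leg}
    (hne : m ≠ m') (hd : form (legDir L) ((m.1 : ℕ), (m.2 : ℕ)) =
      form (legDir L) ((m'.1 : ℕ), (m'.2 : ℕ)))
    (hm : m ∈ dualCell a p) (hm' : m' ∈ dualCell a p) (h : m ∈ dualCell a p')
    (h' : m' ∈ dualCell a p') : cross (legDir L) p' = cross (legDir L) p := by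
  have e1 := monomialValue_eq_of_mem hm hm'
  have e2 := monomialValue_eq_of_mem h h'
  have hne' : ((m.1 : ℕ) : ℝ) ≠ (m'.1 : ℕ) ∨ ((m.2 : ℕ) : ℝ) ≠ (m'.2 : ℕ) := by
    by_contra! hcon
    exact hne (Prod.ext (Fin.ext (Nat.cast_injective hcon.1)) (Fin.ext (Nat.cast_injective hcon.2)))
  simp only [monomialValue] at e1 e2
  have key : ((m.1 : ℕ) - (m'.1 : ℕ) : ℝ) * (p'.1 - p.1) +
      ((m.2 : ℕ) - (m'.2 : ℕ) : ℝ) * (p'.2 - p.2) = 0 := by linear_combination e2 - e1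
  cases L
  all_goals
    simp [cross, form, legDir] at hd ⊢
    rw [hd] at key hne'
    simp only [sub_self, zero_mul, zero_add, add_zero, mul_eq_zero, sub_eq_zero, ne_eq,
      not_true_eq_false, or_false, false_or] at key hne'
    exact key.resolve_left hne'

theorem form_eq_of_legSlope_eq {L : Leg} {m m' : Expo 3} (h : legSlope L m = legSlope L m') :
    form (legDir L) ((m.1 : ℕ), (m.2 : ℕ)) = form (legDir L) ((m'.1 : ℕ), (m'.2 : ℕ)) := by
  obtain ⟨c, hc⟩ := (isSlope_leg L).slope
  have h1 := hc m
  have h2 := hc m'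
  simp only [form]
  rw [h] at h1
  linarith

/-! ### Edges of `Γ` with the slope of a leg -/

theorem det3_eq_zero_of_legSlope_eq {L : Leg} {m m' s : Expo 3} (h : legSlope L m' = legSlope L m)
    (hs : legSlope L s = legSlope L m) : det3 m m' s = 0 := by
  have h1 := m.1.is_le
  have h2 := m'.1.is_le
  have h3 := s.1.is_le
  have h4 := m.2.is_le
  have h5 := m'.2.is_le
  have h6 := s.2.is_le
  cases L <;> simp only [legSlope] at h hs <;> simp only [det3]
  · rw [show (m'.1 : ℕ) = m.1 by omega, show (s.1 : ℕ) = m.1 by omega]; ring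
  · rw [show (m'.2 : ℕ) = m.2 by omega, show (s.2 : ℕ) = m.2 by omega]; ring
  · rw [h, hs]; ring
  · rw [h, hs]; ring

/-- The position of an exponent along the side of slope `0` of the square. -/
def sidePos : Leg → Expo 3 → ℕ
  | .negHor, m => m.2
  | .posHor, m => m.2
  | .negVert, m => m.1
  | .posVert, m => m.1

/-- Two active exponents with the same slope along a leg are adjacent. -/
theorem IsSmooth.adjacent {a : Expo 3 → ℝ} (ha : IsSmooth a) {p : ℝ × ℝ} {L : Leg} {m m' : Expo 3}
    (hm : m ∈ dualCell a p) (hm' : m' ∈ dualCell a p) (hne : m ≠ m')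
    (h : legSlope L m' = legSlope L m) :
    (sidePos L m = sidePos L m' + 1 ∨ sidePos L m' = sidePos L m + 1) ∧
      ∀ s ∈ dualCell a p, legSlope L s = legSlope L m → s = m ∨ s = m' := by
  obtain ⟨r, hr, hs⟩ := ha.exists_triangle hne hm hm'
  refine ⟨?_, fun s h1 h2 => hs s h1 (det3_eq_zero_of_legSlope_eq h h2)⟩
  have hdvd : ((sidePos L m' : ℤ) - sidePos L m) ∣ 1 := by
    rw [← Int.isUnit_iff_abs_eq] at hr
    have : ((sidePos L m' : ℤ) - sidePos L m) ∣ det3 m m' r := by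
      have h1 := m.1.is_le
      have h2 := m'.1.is_le
      have h4 := m.2.is_le
      have h5 := m'.2.is_le
      cases L <;> simp only [legSlope] at h <;> simp only [det3, sidePos]
      · rw [show (m'.1 : ℕ) = m.1 by omega]
        exact ⟨-((r.1 : ℕ) - (m.1 : ℕ) : ℤ), by ring⟩
      · rw [show (m'.2 : ℕ) = m.2 by omega]
        exact ⟨((r.2 : ℕ) - (m.2 : ℕ) : ℤ), by ring⟩
      · rw [h]
        exact ⟨-((r.1 : ℕ) - (m.1 : ℕ) : ℤ), by ring⟩
      · rw [h]
        exact ⟨((r.2 : ℕ) - (m.2 : ℕ) : ℤ), by ring⟩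
    exact isUnit_iff_dvd_one.1 (isUnit_of_dvd_unit this hr)
  have := Int.isUnit_iff.1 (isUnit_iff_dvd_one.2 hdvd)
  omega

/-! ### Special tritangents -/

/-- The vertex of the leg `L` lies in the interior of a ray of `Γ` opposite to `L`. -/
def OnOppositeRay (a : Expo 3 → ℝ) (q : Param) (L : Leg) : Prop :=
  ∀ m ∈ dualCell a (legVertex q L), legSlope L m = 0

/-- The first root is then the distance from the vertex of the leg to the end of the ray. -/
theorem onOppositeRay_iff {a : Expo 3 → ℝ} {q : Param} {L : Leg} :
    OnOppositeRay a q L ↔ 0 < root a (legSlope L) 1 (legVertex q L) := by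
  rw [← not_le, (isSlope_leg L).root_le_iff a _ le_rfl (by norm_num), zero_smul, add_zero]
  push Not
  exact forall₂_congr fun m _ => by omega

theorem exists_legRootPt {a : Expo 3 → ℝ} (ha : IsSmooth a) {q : Param} {L : Leg} {t : ℝ}
    (ht : 0 < t) (h : 0 < stableMult a (lineCoeff q) (legPt q L t)) :
    ∃ k ∈ Finset.Icc 1 3, legRootPt a q L k = legPt q L t := by
  classical
  rw [stableMult_eq_rootCount ha, rootCount_legPt a q L ht, if_neg (legPt_ne_vert ht).1,
    if_neg (legPt_ne_vert ht).2, sub_zero, sub_zero, Nat.cast_pos, legCount, Finset.card_pos] at h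
  obtain ⟨k, hk⟩ := h
  exact ⟨k, (Finset.mem_filter.1 hk).1, (Finset.mem_filter.1 hk).2⟩

theorem midpoint_legPt (q : Param) (L : Leg) (s t : ℝ) :
    midpoint ℝ (legPt q L s) (legPt q L t) = legPt q L ((s + t) / 2) := by
  rw [midpoint_eq_smul_add, invOf_eq_inv, legPt, legPt, legPt]
  module

/-- Off an opposite ray the first root is placed at the vertex, so only the second and third roots
can lie inside the leg, and these share a component. Every tangency inside the leg then belongs to
the component of the second root, and there cannot be two. -/
theorem IsLegTangency.legRootPt_two_mem {a : Expo 3 → ℝ} (ha : IsSmooth a) {q : Param}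
    (h : Par a q) {L : Leg} {C : Set (ℝ × ℝ)} {P : ℝ × ℝ} (hT : IsLegTangency a q L C P)
    (hL : ¬ OnOppositeRay a q L) : legRootPt a q L 2 ∈ C := by
  classical
  obtain ⟨hC, ⟨t, ht, rfl⟩, p₁, ⟨hp₁, t₁, ht₁, rfl⟩, p₂, ⟨hp₂, t₂, ht₂, rfl⟩, hdiv, hmid⟩ := hT
  obtain ⟨p, -, rfl⟩ := mem_interComponents.1 hC
  rw [onOppositeRay_iff, not_lt] at hL
  have key : ∀ s, 0 < s → legPt q L s ∈ connectedComponentIn (inter a q) p →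
      0 < stableMult a (lineCoeff q) (legPt q L s) →
      legRootPt a q L 2 ∈ connectedComponentIn (inter a q) p := by
    intro s hs hmem hpos
    obtain ⟨k, hk, hks⟩ := exists_legRootPt ha hs hpos
    rw [← hks] at hmem
    rw [Finset.mem_Icc] at hk
    obtain rfl | rfl | rfl : k = 1 ∨ k = 2 ∨ k = 3 := by omega
    · rw [legRootPt, max_eq_right hL, legPt_inj] at hks
      exact absurd hks hs.ne
    · exact hmem
    · exact (h.legRootPt_two L p).2 hmem
  -- The midpoint is in the open leg, so at least one of `p₁`, `p₂` is away from the vertex.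
  have hsum : t₁ + t₂ = 2 * t := by
    have : legPt q L t = legPt q L ((t₁ + t₂) / 2) := by
      rw [← midpoint_legPt]; exact hmid
    rw [legPt_inj] at this
    linarith
  rcases ht₁.eq_or_lt with h0 | h1
  · refine key t₂ (by linarith) hp₂ ?_
    rw [legPt, hdiv _ hp₂, if_pos (rfl : legVertex q L + t₂ • legDir L = _)]
    split_ifs <;> norm_num
  · refine key t₁ h1 hp₁ ?_
    rw [legPt, hdiv _ hp₁, if_pos (rfl : legVertex q L + t₁ • legDir L = _)]
    split_ifs <;> norm_num

theorem IsSpecial.exists_onOppositeRay {a : Expo 3 → ℝ} (ha : IsSmooth a) {q : Param}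
    (h : IsSpecial a q) : ∃ L, OnOppositeRay a q L := by
  obtain ⟨hq, L, C₁, C₂, P₁, P₂, hne, h1, h2⟩ := h
  refine ⟨L, by_contra fun hL => hne ?_⟩
  have m1 := h1.legRootPt_two_mem ha (hq.par ha) hL
  have m2 := h2.legRootPt_two_mem ha (hq.par ha) hL
  obtain ⟨p₁, -, rfl⟩ := mem_interComponents.1 h1.1
  obtain ⟨p₂, -, rfl⟩ := mem_interComponents.1 h2.1
  rw [connectedComponentIn_eq m1, connectedComponentIn_eq m2]

/-- The hypothesis makes the trace of `Z` on `X` relatively open; it is closed already, so it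
contains every component that it meets. -/
theorem component_subset_of_locally {X Z : Set (ℝ × ℝ)} {x : ℝ × ℝ} (hZ : IsClosed Z)
    (hx : x ∈ Z) (h : ∀ p ∈ Z, ∀ᶠ p' in 𝓝 p, p' ∈ X → p' ∈ Z) :
    connectedComponentIn X x ⊆ Z := by
  by_cases hX : x ∈ X
  swap
  · rw [connectedComponentIn_eq_empty hX]; exact empty_subset _
  have hsub := connectedComponentIn_subset X x
  have hin : ∀ p ∈ connectedComponentIn X x, p ∈ interior (Xᶜ ∪ Z) → p ∈ Z := fun p hp hp' =>
    (interior_subset hp').resolve_left fun hn => hn (hsub hp)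
  have key := isPreconnected_iff_subset_of_disjoint.1 (isPreconnected_connectedComponentIn
    (x := x) (F := X)) (interior (Xᶜ ∪ Z)) Zᶜ isOpen_interior hZ.isOpen_compl ?_ ?_
  · rcases key with h1 | h1
    · exact fun p hp => hin p hp (h1 hp)
    · exact absurd hx (h1 (mem_connectedComponentIn hX))
  · intro p _
    by_cases hpZ : p ∈ Z
    · left
      rw [mem_interior_iff_mem_nhds]
      filter_upwards [h p hpZ] with p' hp'
      by_cases hpX : p' ∈ X
      · exact Or.inr (hp' hpX)
      · exact Or.inl hpX
    · exact Or.inr hpZ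
  · rw [eq_empty_iff_forall_notMem]
    rintro p ⟨hp, hp1, hp2⟩
    exact hp2 (hin p hp hp1)

/-- The leg opposite to `L`. -/
def oppLeg : Leg → Leg
  | .negHor => .posHor
  | .posHor => .negHor
  | .negVert => .posVert
  | .posVert => .negVert

theorem legSlope_oppLeg (L : Leg) (m : Expo 3) : legSlope (oppLeg L) m = 3 - legSlope L m := by
  have h1 := m.1.is_le
  have h2 := m.2.is_le
  cases L <;> simp only [legSlope, oppLeg] <;> omega

/-- The line of a leg meets `Λ` elsewhere only if `Λ` is `4`-valent, and then in the opposite leg.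
This exception has to be carried through the analysis of opposite rays. -/
theorem mem_lam_line {q : Param} {L : Leg} {p : ℝ × ℝ} (hp : p ∈ lam q)
    (h : cross (legDir L) p = cross (legDir L) (legVertex q L)) :
    (∃ t, 0 ≤ t ∧ p = legPt q L t) ∨ (q.2 = 0 ∧ ∃ t, 0 < t ∧ p = legPt q (oppLeg L) t) := by
  by_cases hq : q.2 = 0
  · have hv : vert1 q = vert0 q := vert1_eq_vert0.2 hq
    have hvL : ∀ L, legVertex q L = vert0 q := fun L => by
      rcases legVertex_eq q L with h | h <;> rw [h]
      exact hv
    rcases mem_lam_cases hp with ⟨L', s, hs, rfl⟩ | ⟨s, hs, hs', rfl⟩ | rfl | rfl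
    · have h' : cross (legDir L) (vert0 q + s • legDir L') = cross (legDir L) (vert0 q) := by
        rw [← hvL L', ← legPt, h, hvL, hvL]
      cases L <;> cases L' <;>
        first
        | exact Or.inl ⟨s, hs.le, rfl⟩
        | exact Or.inr ⟨hq, s, hs, rfl⟩
        | exact absurd h' (by simp [cross, legDir, hs.ne'])
    · rw [hq, abs_zero] at hs'
      exact absurd hs (not_lt.2 hs'.le)
    · exact Or.inl ⟨0, le_rfl, by rw [legPt_zero, hvL]⟩
    · exact Or.inl ⟨0, le_rfl, by rw [legPt_zero, hvL, hv]⟩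
  · left
    have hpos := abs_pos.2 hq
    rcases lt_or_gt_of_ne hq with hneg | hpos'
    · have hab := abs_of_neg hneg
      have hes : edgeSign q = false := by simp [edgeSign, hneg]
      rcases mem_lam_cases hp with ⟨L', s, hs, rfl⟩ | ⟨s, hs, hs', rfl⟩ | rfl | rfl
      · cases L <;> cases L' <;>
          first
          | exact ⟨s, hs.le, rfl⟩
          | exact absurd h (by
              simp [cross, legDir, legPt, legVertex, vert0, vert1, not_le.2 hneg, hab]
              first | done | (intro hh; linarith) | (apply ne_of_lt; linarith) | (apply ne_of_gt; linarith))
      · exact absurd h (by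
          cases L <;> simp [cross, legDir, edgePt, edgeDir, hes, legVertex, vert0, vert1, not_le.2 hneg, hab] <;>
          first | done | (intro hh; linarith) | (apply ne_of_lt; linarith) | (apply ne_of_gt; linarith))
      · cases L <;> first
          | (refine ⟨0, le_rfl, ?_⟩; simp [legPt, legVertex, not_le.2 hneg]; done)
          | exact absurd h (by simp [cross, legDir, legVertex, vert0, vert1, not_le.2 hneg, hq])
      · cases L <;> first
          | (refine ⟨0, le_rfl, ?_⟩; simp [legPt, legVertex, not_le.2 hneg]; done)
          | exact absurd h (by simp [cross, legDir, legVertex, vert0, vert1, not_le.2 hneg, hq])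
    · have hab := abs_of_pos hpos'
      have hes : edgeSign q = true := by simp [edgeSign, hpos'.le]
      rcases mem_lam_cases hp with ⟨L', s, hs, rfl⟩ | ⟨s, hs, hs', rfl⟩ | rfl | rfl
      · cases L <;> cases L' <;>
          first
          | exact ⟨s, hs.le, rfl⟩
          | exact absurd h (by
              simp [cross, legDir, legPt, legVertex, vert0, vert1, hpos'.le, hab]
              first | done | (intro hh; linarith) | (apply ne_of_lt; linarith) | (apply ne_of_gt; linarith))
      · exact absurd h (by
          cases L <;> simp [cross, legDir, edgePt, edgeDir, hes, legVertex, vert0, vert1, hpos'.le, hab] <;>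
          first | done | (intro hh; linarith) | (apply ne_of_lt; linarith) | (apply ne_of_gt; linarith))
      · cases L <;> first
          | (refine ⟨0, le_rfl, ?_⟩; simp [legPt, legVertex, hpos'.le]; done)
          | exact absurd h (by simp [cross, legDir, legVertex, vert0, vert1, hpos'.le, hq])
      · cases L <;> first
          | (refine ⟨0, le_rfl, ?_⟩; simp [legPt, legVertex, hpos'.le]; done)
          | exact absurd h (by simp [cross, legDir, legVertex, vert0, vert1, hpos'.le, hq])

/-- The outgoing slopes of each exponent add up to six. Neighbours on a side agree in the direction
`L` and differ by one, with opposite signs, in two of the other directions, so the maxima add up to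
seven. -/
theorem card_sup_vertex (L : Leg) (m m' : Expo 3) (h : legSlope L m = 0) (h' : legSlope L m' = 0)
    (hadj : sidePos L m = sidePos L m' + 1 ∨ sidePos L m' = sidePos L m + 1) :
    (∀ b, L = lowLeg b ∨ L = .negVert →
      ({m, m'} : Finset (Expo 3)).sup (legSlope (lowLeg b)) +
        ({m, m'} : Finset (Expo 3)).sup (legSlope .negVert) +
        ({m, m'} : Finset (Expo 3)).sup (diagSlope b) = 7) ∧
    (∀ b, L = highLeg b ∨ L = .posVert →
      ({m, m'} : Finset (Expo 3)).sup (legSlope (highLeg b)) +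
        ({m, m'} : Finset (Expo 3)).sup (legSlope .posVert) +
        ({m, m'} : Finset (Expo 3)).sup (fun m => 6 - diagSlope b m) = 7) ∧
    ({m, m'} : Finset (Expo 3)).sup (legSlope .negHor) +
      ({m, m'} : Finset (Expo 3)).sup (legSlope .negVert) +
      ({m, m'} : Finset (Expo 3)).sup (legSlope .posHor) +
      ({m, m'} : Finset (Expo 3)).sup (legSlope .posVert) = 7 := by
  have h1 := m.1.is_le
  have h2 := m.2.is_le
  have h1' := m'.1.is_le
  have h2' := m'.2.is_le
  refine ⟨fun b hb => ?_, fun b hb => ?_, ?_⟩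
  all_goals
    simp only [Finset.sup_insert, Finset.sup_singleton]
    cases L <;> try cases b
  all_goals
    simp only [legSlope, diagSlope, lowLeg, highLeg, sidePos, reduceCtorEq, or_self, or_false,
      false_or] at *
  all_goals omega

/-- At the vertex of a leg which lies on an opposite ray, the multiplicity is one. -/
theorem stableMult_legVertex_eq_one {a : Expo 3 → ℝ} (ha : IsSmooth a) {q : Param} {L : Leg}
    {m m' : Expo 3} (hA : dualCell a (legVertex q L) = {m, m'}) (h : legSlope L m = 0)
    (h' : legSlope L m' = 0)
    (hadj : sidePos L m = sidePos L m' + 1 ∨ sidePos L m' = sidePos L m + 1) :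
    stableMult a (lineCoeff q) (legVertex q L) = 1 := by
  have hs := ha.isSimplexCell (legVertex q L)
  obtain ⟨c1, c2, c3⟩ := card_sup_vertex L m m' h h' hadj
  by_cases hq : q.2 = 0
  · have hv : legVertex q L = vert0 q := by
      rcases legVertex_eq q L with h | h <;> rw [h]
      exact vert1_eq_vert0.2 hq
    rw [hv] at hA hs ⊢
    rw [stableMult_eq_mixed (dualCell_lineCoeff_center q hq) Finset.univ_nonempty,
      mixed_square hs, hA, c3]
    norm_num
  · rcases leg_cases (edgeSign q) L with hL | hL | hL | hL
    · have hv : legVertex q L = vert0 q := by rw [hL, legVertex_lowLeg]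
      rw [hv] at hA hs ⊢
      rw [stableMult_eq_mixed (dualCell_lineCoeff_vert0 q hq) (lowCell_nonempty _),
        mixed_low hs, hA, c1 _ (Or.inl hL)]
      norm_num
    · have hv : legVertex q L = vert0 q := by rw [hL]; rfl
      rw [hv] at hA hs ⊢
      rw [stableMult_eq_mixed (dualCell_lineCoeff_vert0 q hq) (lowCell_nonempty _),
        mixed_low hs, hA, c1 _ (Or.inr hL)]
      norm_num
    · have hv : legVertex q L = vert1 q := by rw [hL, legVertex_highLeg]
      rw [hv] at hA hs ⊢
      rw [stableMult_eq_mixed (dualCell_lineCoeff_vert1 q hq) (highCell_nonempty _),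
        mixed_high hs, hA, c2 _ (Or.inl hL)]
      norm_num
    · have hv : legVertex q L = vert1 q := by rw [hL]; rfl
      rw [hv] at hA hs ⊢
      rw [stableMult_eq_mixed (dualCell_lineCoeff_vert1 q hq) (highCell_nonempty _),
        mixed_high hs, hA, c2 _ (Or.inr hL)]
      norm_num

theorem stableMult_legPt {a : Expo 3 → ℝ} (ha : IsSmooth a) {q : Param} {L : Leg} {t : ℝ}
    (ht : 0 < t) : stableMult a (lineCoeff q) (legPt q L t) = legCount a q L (legPt q L t) := by
  rw [stableMult_eq_rootCount ha, rootCount_legPt a q L ht, if_neg (legPt_ne_vert ht).1,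
    if_neg (legPt_ne_vert ht).2, sub_zero, sub_zero]

/-- Away from the vertices, multiplicities vanish where `Γ` runs along the leg. -/
theorem stableMult_legPt_eq_zero {a : Expo 3 → ℝ} (ha : IsSmooth a) {q : Param} {L : Leg} {t : ℝ}
    (ht : 0 < t) {k : ℕ} (h : ∀ m ∈ dualCell a (legPt q L t), legSlope L m = k) :
    stableMult a (lineCoeff q) (legPt q L t) = 0 := by
  have hc := legCount_legPt a q L ht
  have h1 : (dualCell a (legPt q L t)).sup (legSlope L) = k := by
    rw [Finset.sup_congr rfl h]
    exact Finset.sup_const (dualCell_nonempty _ _) _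
  have h2 : ((dualCell a (legPt q L t)).sup fun m => 3 - legSlope L m) = 3 - k := by
    rw [Finset.sup_congr rfl fun m hm => by rw [h m hm]]
    exact Finset.sup_const (dualCell_nonempty _ _) _
  obtain ⟨m, hm⟩ := dualCell_nonempty a (legPt q L t)
  have := (isSlope_leg L).le m
  rw [h m hm] at this
  rw [stableMult_legPt ha ht]
  have : legCount a q L (legPt q L t) = 0 := by omega
  rw [this, Nat.cast_zero]

/-- The base of the triangle has length one, so twice its area is its height over the side.
Unimodularity will force the third vertex to have slope one. -/
theorem abs_det3_of_adjacent {L : Leg} {m m' r : Expo 3} (h : legSlope L m = 0)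
    (h' : legSlope L m' = 0)
    (hadj : sidePos L m = sidePos L m' + 1 ∨ sidePos L m' = sidePos L m + 1) :
    |det3 m m' r| = legSlope L r := by
  have h1 := m.1.is_le
  have h2 := m.2.is_le
  have h1' := m'.1.is_le
  have h2' := m'.2.is_le
  have h3 := r.1.is_le
  have h3' := r.2.is_le
  have e : (sidePos L m : ℤ) - sidePos L m' = 1 ∨ (sidePos L m : ℤ) - sidePos L m' = -1 := by omega
  have key : det3 m m' r = ((sidePos L m : ℤ) - sidePos L m') * legSlope L r ∨
      det3 m m' r = -(((sidePos L m : ℤ) - sidePos L m') * legSlope L r) := by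
    cases L <;> simp only [legSlope] at h h' <;> simp only [det3, sidePos, legSlope]
    · rw [show (m'.1 : ℕ) = 3 by omega, show (m.1 : ℕ) = 3 by omega, Nat.cast_sub h3]
      right; push_cast; ring
    · rw [show (m'.2 : ℕ) = 3 by omega, show (m.2 : ℕ) = 3 by omega, Nat.cast_sub h3']
      left; push_cast; ring
    · rw [h, h']; left; push_cast; ring
    · rw [h, h']; right; push_cast; ring
  rcases e with e | e <;> rcases key with k | k <;> rw [k, e] <;> simp

/-- Slope zero is even, so by parity the vertex is not in a chamber: two neighbouring exponents of a
side are active. They stay active up to the first root, where a third exponent completes a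
unimodular triangle. -/
theorem OnOppositeRay.structure {a : Expo 3 → ℝ} (ha : IsSmooth a) {q : Param} (h : Par a q)
    {L : Leg} (hL : OnOppositeRay a q L) : ∃ m m' r : Expo 3, m ≠ m' ∧ legSlope L m = 0 ∧
      legSlope L m' = 0 ∧ legSlope L r = 1 ∧
      (sidePos L m = sidePos L m' + 1 ∨ sidePos L m' = sidePos L m + 1) ∧
      (∀ t < root a (legSlope L) 1 (legVertex q L), dualCell a (legPt q L t) = {m, m'}) ∧
      dualCell a (legPt q L (root a (legSlope L) 1 (legVertex q L))) = {m, m', r} := by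
  obtain ⟨m, hm⟩ := dualCell_nonempty a (legVertex q L)
  have hκ := onOppositeRay_iff.1 hL
  obtain ⟨m', hm', hne⟩ : ∃ m' ∈ dualCell a (legVertex q L), m' ≠ m := by
    by_contra! hcon
    have hs : dualCell a (legPt q L 0) = {m} := by
      rw [legPt_zero]
      exact (Finset.Nonempty.subset_singleton_iff (dualCell_nonempty a _)).1 fun x hx =>
        Finset.mem_singleton.2 (hcon x hx)
    have := h.1 L 0 le_rfl m hs
    rw [hL m hm] at this
    exact absurd this (by decide)
  have e := hL m hm
  have e' := hL m' hm'
  obtain ⟨hadj, huniq⟩ := ha.adjacent hm hm' hne.symm (e'.trans e.symm)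
  set κ := root a (legSlope L) 1 (legVertex q L)
  have hsl := isSlope_leg L
  -- Negative `t` are included: before the first root only slope zero is active, so the same pair
  -- remains active on a whole half-line.
  have hmem : ∀ t < κ, dualCell a (legPt q L t) = {m, m'} := by
    intro t ht
    have hzero : ∀ s ∈ dualCell a (legPt q L t), legSlope L s = 0 := by
      intro s hs
      by_contra hs0
      exact not_le.2 ht ((hsl.root_le_iff a _ le_rfl (by norm_num) t).2 ⟨s, hs, by omega⟩)
    have hact : ∀ n ∈ dualCell a (legVertex q L), n ∈ dualCell a (legPt q L t) := by
      intro n hn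
      obtain ⟨s, hs⟩ := dualCell_nonempty a (legPt q L t)
      have h1 := hsl.value_sub a (legVertex q L) t s n
      rw [hzero s hs, hL n hn, sub_self, mul_zero, add_zero] at h1
      have h2 := mem_dualCell.1 hn s
      have h3 := mem_dualCell.1 hs n
      rw [legPt] at h3
      refine mem_dualCell_of_eq hs ?_
      rw [legPt]
      linarith
    ext s
    rw [Finset.mem_insert, Finset.mem_singleton]
    refine ⟨fun hs => ?_, ?_⟩
    · refine huniq s ?_ ((hzero s hs).trans e.symm)
      have h1 := hsl.value_sub a (legVertex q L) t s m
      rw [hzero s hs, e, sub_self, mul_zero, add_zero] at h1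
      have h2 := monomialValue_eq_of_mem hs (hact m hm)
      rw [legPt] at h2
      refine mem_dualCell_of_eq hm ?_
      linarith
    · rintro (rfl | rfl)
      · exact hact _ hm
      · exact hact _ hm'
  have hclosed : ∀ n, n = m ∨ n = m' → n ∈ dualCell a (legPt q L κ) := by
    intro n hn
    have hc : IsClosed {t | n ∈ dualCell a (legPt q L t)} :=
      (isClosed_mem_dualCell a n).preimage (continuous_line _ _)
    have hsub : Iio κ ⊆ {t | n ∈ dualCell a (legPt q L t)} := fun t ht => by
      change n ∈ dualCell a (legPt q L t)
      rw [hmem t ht]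
      rcases hn with rfl | rfl <;> simp
    have := closure_minimal hsub hc
    rw [closure_Iio] at this
    exact this self_mem_Iic
  obtain ⟨r, hr, hr1⟩ := (hsl.root_le_iff a (legVertex q L) le_rfl (by norm_num) κ).1 le_rfl
  have hdet := abs_det3_of_adjacent (r := r) e e' hadj
  obtain ⟨habs, hcell⟩ := ha _ m (hclosed m (Or.inl rfl)) m' (hclosed m' (Or.inr rfl)) r hr
    (fun h0 => by rw [h0] at hdet; simp at hdet; omega)
  refine ⟨m, m', r, hne.symm, e, e', ?_, hadj, hmem, hcell⟩
  rw [hdet] at habs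
  exact_mod_cast habs

theorem legCell_form (L : Leg) {m m' : Expo 1} (hm : m ∈ legCell L) (hm' : m' ∈ legCell L) :
    form (legDir L) ((m.1 : ℕ), (m.2 : ℕ)) = form (legDir L) ((m'.1 : ℕ), (m'.2 : ℕ)) := by
  cases L <;> simp only [legCell, Finset.mem_insert, Finset.mem_singleton] at hm hm' <;>
    rcases hm with rfl | rfl <;> rcases hm' with rfl | rfl <;> simp [form, legDir]

/-- Before the end of the ray, `Γ` stays locally on the line of the leg. Near the end `Λ` stays on
this line, and just past it only `r` is active, which is a chamber. Negative parameters are allowed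
because a `4`-valent curve continues along the opposite leg. -/
theorem OnOppositeRay.component_subset {a : Expo 3 → ℝ} (ha : IsSmooth a) {q : Param}
    (h : Par a q) {L : Leg} (hL : OnOppositeRay a q L) :
    connectedComponentIn (inter a q) (legVertex q L) ⊆
      {p | p ∈ inter a q ∧ ∃ t ≤ root a (legSlope L) 1 (legVertex q L), p = legPt q L t} := by
  obtain ⟨m, m', r, hne, e, e', er, hadj, hmem, hcell⟩ := hL.structure ha h
  have hκ := onOppositeRay_iff.1 hL
  set κ := root a (legSlope L) 1 (legVertex q L)
  have hZeq : {p | p ∈ inter a q ∧ ∃ t ≤ κ, p = legPt q L t} =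
      inter a q ∩ {p | cross (legDir L) p = cross (legDir L) (legVertex q L)} ∩
        {p | form (legDir L) p ≤ form (legDir L) (legVertex q L) + κ} := by
    ext p
    constructor
    · rintro ⟨hp, t, ht, rfl⟩
      refine ⟨⟨hp, cross_legPt q L t⟩, ?_⟩
      change form _ _ ≤ _
      rw [form_legPt_self]
      linarith
    · rintro ⟨⟨hp, h1⟩, h2⟩
      have h2' : form (legDir L) p ≤ form (legDir L) (legVertex q L) + κ := h2
      exact ⟨hp, _, by linarith, eq_add_smul_legDir L h1⟩
  have hv : legVertex q L ∈ curve a := by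
    have := hmem 0 hκ
    rw [legPt_zero] at this
    change (dualCell a _).Nontrivial
    rw [this]
    exact ⟨m, by simp, m', by simp, hne⟩
  refine component_subset_of_locally ?_ ?_ ?_
  · rw [hZeq]
    exact (((isClosed_curve _).inter (isClosed_curve _)).inter (isClosed_eq (continuous_cross _)
      continuous_const)).inter (isClosed_le (continuous_form _) continuous_const)
  · refine ⟨⟨?_, hv⟩, 0, hκ.le, (legPt_zero q L).symm⟩
    rw [← legPt_zero]
    exact legPt_mem_lam q L le_rfl
  · rintro p ⟨hp, t, ht, rfl⟩
    rw [hZeq]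
    rcases ht.lt_or_eq with ht | rfl
    · have hlt : ∀ᶠ p' in 𝓝 (legPt q L t), form (legDir L) p' <
          form (legDir L) (legVertex q L) + κ := by
        refine (isOpen_lt (continuous_form _) continuous_const).mem_nhds ?_
        change form _ _ < _
        rw [form_legPt_self]
        linarith
      filter_upwards [eventually_dualCell_subset a (legPt q L t), hlt] with p' hsub hlt hp'
      refine ⟨⟨hp', ?_⟩, hlt.le⟩
      obtain ⟨x, hx, y, hy, hxy⟩ := hp'.2
      have hx0 : legSlope L x = 0 := by
        have := hsub hx
        rw [hmem t ht, Finset.mem_insert, Finset.mem_singleton] at this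
        rcases this with rfl | rfl <;> assumption
      have hy0 : legSlope L y = 0 := by
        have := hsub hy
        rw [hmem t ht, Finset.mem_insert, Finset.mem_singleton] at this
        rcases this with rfl | rfl <;> assumption
      change cross _ _ = _
      rw [cross_eq_of_mem hxy (form_eq_of_legSlope_eq (hx0.trans hy0.symm)) (hsub hx) (hsub hy)
        hx hy, cross_legPt]
    · have htop := eventually_nhdsWithin_iff.1 ((isSlope_leg L).eventually_top a (legVertex q L) κ)
      have htop' : ∀ᶠ p' in 𝓝 (legPt q L κ), form (legDir L) p' - form (legDir L) (legVertex q L)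
          ∈ {s | s ∈ Ioi κ → ∀ m ∈ dualCell a (legVertex q L + s • legDir L),
            m ∈ dualCell a (legVertex q L + κ • legDir L) ∧
            ∀ m' ∈ dualCell a (legVertex q L + κ • legDir L), legSlope L m' ≤ legSlope L m} := by
        refine ((continuous_form _).sub continuous_const).continuousAt.eventually_mem ?_
        change _ ∈ 𝓝 (form (legDir L) (legPt q L κ) - form (legDir L) (legVertex q L))
        rw [form_legPt_self, add_sub_cancel_left]
        exact htop
      filter_upwards [eventually_dualCell_subset (lineCoeff q) (legPt q L κ), htop'] with p' hsub
        htop hp'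
      rw [dualCell_lineCoeff_legPt q L hκ] at hsub
      have hc : cross (legDir L) p' = cross (legDir L) (legVertex q L) := by
        obtain ⟨x, hx, y, hy, hxy⟩ := hp'.1
        have hx' := hsub hx
        have hy' := hsub hy
        rw [← cross_legPt q L κ]
        refine cross_eq_of_mem hxy (legCell_form L hx' hy') ?_ ?_ hx hy <;>
        rwa [dualCell_lineCoeff_legPt q L hκ]
      refine ⟨⟨hp', hc⟩, ?_⟩
      change form (legDir L) p' ≤ _
      by_contra! hlt
      have hlt' : κ < form (legDir L) p' - form (legDir L) (legVertex q L) := by linarith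
      have hp2 := hp'.2
      rw [eq_add_smul_legDir L hc] at hp2
      have hall : ∀ x ∈ dualCell a (legVertex q L + (form (legDir L) p' -
          form (legDir L) (legVertex q L)) • legDir L), x = r := by
        intro x hx
        obtain ⟨h1, h2⟩ := htop hlt' x hx
        rw [← legPt, hcell] at h1 h2
        have := h2 r (by simp)
        simp only [Finset.mem_insert, Finset.mem_singleton] at h1
        rcases h1 with rfl | rfl | rfl
        · omega
        · omega
        · rfl
      obtain ⟨x, hx, y, hy, hxy⟩ := hp2
      exact hxy ((hall x hx).trans (hall y hy).symm)

/-- The component of the vertex of the leg carries a tangency. -/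
theorem OnOppositeRay.isLegTangency {a : Expo 3 → ℝ} (ha : IsSmooth a) {q : Param} (h : Par a q)
    {L : Leg} (hL : OnOppositeRay a q L) : ∃ P, IsLegTangency a q L
      (connectedComponentIn (inter a q) (legVertex q L)) P := by
  have hC := hL.component_subset ha h
  obtain ⟨m, m', r, hne, e, e', er, hadj, hmem, hcell⟩ := hL.structure ha h
  have hκ := onOppositeRay_iff.1 hL
  have hW := h.legRootPt_one L (legVertex q L)
  rw [legRootPt, max_eq_left hκ.le] at hW
  set κ := root a (legSlope L) 1 (legVertex q L)
  have hv := hmem 0 hκ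
  rw [legPt_zero] at hv
  have hslope : ∀ t < κ, ∀ n ∈ dualCell a (legPt q L t), legSlope L n = 0 := by
    intro t ht n hn
    rw [hmem t ht, Finset.mem_insert, Finset.mem_singleton] at hn
    rcases hn with rfl | rfl <;> assumption
  have hvX : legVertex q L ∈ inter a q := by
    refine ⟨?_, m, ?_, m', ?_, hne⟩
    · rw [← legPt_zero]
      exact legPt_mem_lam q L le_rfl
    · rw [hv]; simp
    · rw [hv]; simp
  have hvC := mem_connectedComponentIn hvX
  have hmult1 : stableMult a (lineCoeff q) (legPt q L κ) = 1 := by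
    have := legCount_legPt a q L hκ
    rw [hcell] at this
    simp only [Finset.sup_insert, Finset.sup_singleton, e, e', er] at this
    rw [stableMult_legPt ha hκ]
    have h1 : legCount a q L (legPt q L κ) = 1 := by
      norm_num at this
      omega
    rw [h1, Nat.cast_one]
  refine ⟨legPt q L (κ / 2), mem_interComponents.2 ⟨_, hvX, rfl⟩, ⟨κ / 2, by positivity, rfl⟩,
    legVertex q L, ⟨hvC, 0, le_rfl, (legPt_zero q L).symm⟩, legPt q L κ, ⟨hW.1 hvC, κ, hκ.le, rfl⟩,
    ?_, ?_⟩
  · intro p hp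
    obtain ⟨hpX, t, ht, rfl⟩ := hC hp
    have hiff : (legPt q L t = legVertex q L ↔ t = 0) ∧ (legPt q L t = legPt q L κ ↔ t = κ) := by
      rw [← legPt_zero q L, legPt_inj, legPt_inj]
      exact ⟨Iff.rfl, Iff.rfl⟩
    rcases ht.lt_or_eq with ht | rfl
    · rw [if_neg (hiff.2.not.2 ht.ne), add_zero]
      rcases lt_trichotomy t 0 with h0 | rfl | h0
      · rw [if_neg (hiff.1.not.2 h0.ne)]
        -- Points behind the vertex lie on the opposite leg of a `4`-valent curve. All active
        -- exponents there have outward slope three, so the multiplicity vanishes.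
        rcases mem_lam_line hpX.1 (cross_legPt q L t) with ⟨s, hs, he⟩ | ⟨-, s, hs, he⟩
        · rw [legPt_inj] at he
          exact absurd he (h0.trans_le hs).ne
        · rw [he]
          refine stableMult_legPt_eq_zero ha hs (k := 3) fun n hn => ?_
          rw [← he] at hn
          rw [legSlope_oppLeg, hslope t ht n hn]
      · rw [if_pos (legPt_zero q L), legPt_zero]
        exact stableMult_legVertex_eq_one ha hv e e' hadj
      · rw [if_neg (hiff.1.not.2 h0.ne')]
        exact stableMult_legPt_eq_zero ha h0 (hslope t ht)
    · rw [if_neg (hiff.1.not.2 hκ.ne'), if_pos rfl, hmult1, zero_add]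
  · rw [← legPt_zero q L, midpoint_legPt, zero_add]

/-- The vertex and the first root form one tangency. Roots two and three form another; the chamber
of `r`, crossed between the first and the second root, separates them. -/
theorem OnOppositeRay.isSpecial {a : Expo 3 → ℝ} (ha : IsSmooth a) {q : Param} (h : Par a q)
    {L : Leg} (hL : OnOppositeRay a q L) : IsSpecial a q := by
  classical
  obtain ⟨P₁, hP₁⟩ := hL.isLegTangency ha h
  obtain ⟨m, m', r, hne, e, e', er, hadj, hmem, hcell⟩ := hL.structure ha h
  have hsl := isSlope_leg L
  have hκ := onOppositeRay_iff.1 hL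
  have htop := hsl.eventually_top a (legVertex q L) (root a (legSlope L) 1 (legVertex q L))
  have hκ₂ : root a (legSlope L) 1 (legVertex q L) < root a (legSlope L) 2 (legVertex q L) := by
    rw [← not_le, hsl.root_le_iff a _ (by norm_num) (by norm_num), ← legPt, hcell]
    rintro ⟨n, hn, hn2⟩
    simp only [Finset.mem_insert, Finset.mem_singleton] at hn
    rcases hn with rfl | rfl | rfl <;> omega
  have hκ₃ := hsl.root_mono a (legVertex q L) (k := 2) (l := 3) (by norm_num) (by norm_num) le_rfl
  set κ₁ := root a (legSlope L) 1 (legVertex q L) with hκ₁def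
  set κ₂ := root a (legSlope L) 2 (legVertex q L) with hκ₂def
  set κ₃ := root a (legSlope L) 3 (legVertex q L) with hκ₃def
  -- A point between the first two roots at which `r` alone is active; the perpendicular cut there
  -- separates the two components.
  obtain ⟨c, ⟨hc, hcκ⟩, hκc⟩ := ((htop.and ((eventually_lt_nhds hκ₂).filter_mono
    nhdsWithin_le_nhds)).and self_mem_nhdsWithin).exists
  have hκc : κ₁ < c := hκc
  have hcX : legPt q L c ∉ curve a := by
    rw [notMem_curve_iff]
    refine ⟨r, (Finset.Nonempty.subset_singleton_iff (dualCell_nonempty a _)).1 fun n hn => ?_⟩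
    obtain ⟨h1, h2⟩ := hc n hn
    rw [← legPt, hcell] at h1 h2
    have := h2 r (by simp)
    simp only [Finset.mem_insert, Finset.mem_singleton] at h1 ⊢
    rcases h1 with rfl | rfl | rfl
    · omega
    · omega
    · rfl
  have hright : ∀ p ∈ inter a q, form (legDir L) (legVertex q L) + c ≤ form (legDir L) p →
      ∃ t, c < t ∧ p = legPt q L t := by
    rintro p ⟨hpl, hpc⟩ hle
    rcases mem_lam_cases hpl with ⟨L', s, hs, rfl⟩ | ⟨s, hs, hs', rfl⟩ | rfl | rfl
    · by_cases hLL : L' = L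
      · subst hLL
        rw [form_legPt_self] at hle
        refine ⟨s, lt_of_le_of_ne (by linarith) ?_, rfl⟩
        rintro rfl
        exact hcX hpc
      · have := form_legPt_le (q := q) hLL hs.le
        linarith
    · have := form_edgePt_le (L := L) hs.le hs'.le
      linarith
    · have := (form_vert_le q L).1
      linarith
    · have := (form_vert_le q L).2
      linarith
  have h2curve : legPt q L κ₂ ∈ curve a := h.leg_mem_curve (k := 2) (by decide) (by norm_num)
    (by linarith) (fun _ => le_rfl) hκ₃
  have h2X : legPt q L κ₂ ∈ inter a q := ⟨legPt_mem_lam q L (by linarith), h2curve⟩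
  set C := connectedComponentIn (inter a q) (legPt q L κ₂) with hCdef
  have hCX : C ⊆ inter a q := connectedComponentIn_subset _ _
  have h2C : legPt q L κ₂ ∈ C := mem_connectedComponentIn h2X
  have h3C : legPt q L κ₃ ∈ C := by
    have := h.legRootPt_two L (legPt q L κ₂)
    rw [legRootPt, legRootPt, ← hκ₂def, ← hκ₃def, max_eq_left (by linarith),
      max_eq_left (by linarith)] at this
    exact this.1 h2C
  have hCsub : C ⊆ {p | form (legDir L) (legVertex q L) + c < form (legDir L) p} := by
    refine isPreconnected_connectedComponentIn.subset_left_of_subset_union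
      (v := {p | form (legDir L) p < form (legDir L) (legVertex q L) + c})
      (isOpen_lt continuous_const (continuous_form _))
      (isOpen_lt (continuous_form _) continuous_const) ?_ ?_ ⟨_, h2C, ?_⟩
    · rw [Set.disjoint_left]
      intro x hx hx'
      have h1 : _ < form (legDir L) x := hx
      have h2 : form (legDir L) x < _ := hx'
      exact lt_asymm h1 h2
    · intro x hx
      rcases lt_or_ge (form (legDir L) x) (form (legDir L) (legVertex q L) + c) with h1 | h1
      · exact Or.inr h1
      · obtain ⟨t, ht, rfl⟩ := hright x (hCX hx) h1
        left
        change _ < form _ _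
        rw [form_legPt_self]
        linarith
    · change _ < form _ _
      rw [form_legPt_self]
      linarith
  refine ⟨h.isTritangent ha, L, _, C, P₁, legPt q L ((κ₂ + κ₃) / 2), ?_, hP₁,
    mem_interComponents.2 ⟨_, h2X, rfl⟩, ⟨(κ₂ + κ₃) / 2, by linarith, rfl⟩, legPt q L κ₂,
    ⟨h2C, κ₂, by linarith, rfl⟩, legPt q L κ₃, ⟨h3C, κ₃, by linarith, rfl⟩, ?_,
    (midpoint_legPt q L κ₂ κ₃).symm⟩
  · intro hCC
    rw [← hCC] at h2C
    obtain ⟨-, t, ht, he⟩ := hL.component_subset ha h h2C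
    rw [legPt_inj] at he
    linarith
  · intro p hp
    have h1 : _ < form (legDir L) p := hCsub hp
    obtain ⟨t, ht, rfl⟩ := hright p (hCX hp) h1.le
    have ht0 : 0 < t := by linarith
    rw [stableMult_legPt ha ht0, legCount, card_filter_Icc_three]
    simp only [legRootPt, ← hκ₁def, ← hκ₂def, ← hκ₃def, legPt_inj]
    rw [max_eq_left (by linarith), max_eq_left (by linarith), max_eq_left (by linarith),
      if_neg (by linarith : κ₁ ≠ t)]
    push_cast
    rw [zero_add]
    simp only [eq_comm]

theorem isSpecial_iff {a : Expo 3 → ℝ} (ha : IsSmooth a) {q : Param} (h : Par a q) :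
    IsSpecial a q ↔ ∃ L, OnOppositeRay a q L :=
  ⟨fun hs => hs.exists_onOppositeRay ha, fun ⟨_, hL⟩ => hL.isSpecial ha h⟩

/-! ### Corner chambers -/

/-- The lowest vertex, or the other one if `top`. -/
def cornerVertex (q : Param) (top : Bool) : ℝ × ℝ := if top then vert1 q else vert0 q

/-- The slope of an exponent along the edge, starting at a vertex. -/
def cornerSlope (b top : Bool) (m : Expo 3) : ℕ := if top then 6 - diagSlope b m else diagSlope b m

/-- The direction of the edge, starting at a vertex. -/
def cornerDir (b top : Bool) : ℝ × ℝ := if top then -edgeDir b else edgeDir b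

/-- The member has an edge of slope `±1`, a vertex of which lies in the corner chamber behind it or
in the interior of the edge of `Γ` cutting it off. -/
def InCorner (a : Expo 3 → ℝ) (q : Param) (b top : Bool) : Prop :=
  (if b then 0 < q.2 else q.2 < 0) ∧
    ∀ m ∈ dualCell a (cornerVertex q top), cornerSlope b top m ≤ 1

theorem isSlope_corner (b top : Bool) : IsSlope (cornerDir b top) (cornerSlope b top) 6 := by
  cases top
  · exact isSlope_diag b
  · obtain ⟨⟨c, hc⟩, h2, ⟨m0, h3⟩, ⟨m6, h4⟩⟩ := isSlope_diag b
    refine ⟨⟨-6 - c, fun m => ?_⟩, fun m => ?_, ⟨m6, ?_⟩, ⟨m0, ?_⟩⟩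
    · have := hc m
      simp only [cornerDir, cornerSlope, if_true, Nat.cast_sub (h2 m), Prod.fst_neg, Prod.snd_neg]
      push_cast
      linarith
    · simp only [cornerSlope, if_true]; omega
    · simp only [cornerSlope, if_true, h4]
    · simp only [cornerSlope, if_true, h3]

theorem corner_line (q : Param) (top : Bool) (t : ℝ) :
    cornerVertex q top + t • cornerDir (edgeSign q) top =
      edgePt q (if top then |q.2| - t else t) := by
  cases top
  · rfl
  · simp only [cornerVertex, cornerDir, if_true, ← edgePt_abs, edgePt]
    module

theorem edgeSign_of_sign {q : Param} {b : Bool} (h : if b then 0 < q.2 else q.2 < 0) :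
    edgeSign q = b ∧ q.2 ≠ 0 := by
  cases b
  · have h : q.2 < 0 := by simpa using h
    exact ⟨by simp [edgeSign, h], h.ne⟩
  · have h : 0 < q.2 := by simpa using h
    exact ⟨by simp [edgeSign, h.le], h.ne'⟩

theorem Par.even_cornerSlope {a : Expo 3 → ℝ} {q : Param} (h : Par a q) (hq : q.2 ≠ 0)
    {top : Bool} {t : ℝ} (ht : 0 ≤ t) (ht' : t ≤ |q.2|) {m : Expo 3}
    (hm : dualCell a (cornerVertex q top + t • cornerDir (edgeSign q) top) = {m}) :
    Even (cornerSlope (edgeSign q) top m) := by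
  rw [corner_line] at hm
  have hle := (isSlope_diag (edgeSign q)).le m
  cases top
  · exact h.2 hq t ht ht' m hm
  · have := h.2 hq (|q.2| - t) (by linarith) (by linarith) m hm
    simp only [cornerSlope, if_true]
    rw [Nat.even_iff] at this ⊢
    omega

/-- Slope one is odd along the edge. If it is the largest slope at the vertex, parity requires a
second active exponent with slope one. Otherwise only slope zero is active, and a single exponent
has it. -/
theorem InCorner.cases {a : Expo 3 → ℝ} {q : Param} (h : Par a q) {b top : Bool}
    (hc : InCorner a q b top) :
    (∃ m, dualCell a (cornerVertex q top) = {m} ∧ cornerSlope b top m = 0) ∨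
    ∃ m ∈ dualCell a (cornerVertex q top), ∃ m' ∈ dualCell a (cornerVertex q top), m ≠ m' ∧
      cornerSlope b top m = 1 ∧ cornerSlope b top m' = 1 := by
  obtain ⟨rfl, hq⟩ := edgeSign_of_sign hc.1
  have hle := hc.2
  by_cases h1 : ∃ m ∈ dualCell a (cornerVertex q top), cornerSlope (edgeSign q) top m = 1
  · obtain ⟨m, hm, hm1⟩ := h1
    right
    have hz : cornerVertex q top + (0 : ℝ) • cornerDir (edgeSign q) top = cornerVertex q top := by
      rw [zero_smul, add_zero]
    obtain ⟨m', hm', hne, he⟩ := (isSlope_corner (edgeSign q) top).exists_ne (a := a)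
      (v := cornerVertex q top) (t := 0) (abs_pos.2 hq) (P := Even)
      (fun s hs hs' n hn => h.even_cornerSlope hq hs.le hs'.le hn) (by rwa [hz])
      (fun n hn => by rw [hm1]; rw [hz] at hn; exact hle n hn) (by rw [hm1]; decide)
    rw [hz] at hm'
    exact ⟨m, hm, m', hm', hne.symm, hm1, he.trans hm1⟩
  · left
    push Not at h1
    obtain ⟨m, hm⟩ := dualCell_nonempty a (cornerVertex q top)
    have hz : ∀ n ∈ dualCell a (cornerVertex q top), cornerSlope (edgeSign q) top n = 0 :=
      fun n hn => by have := hle n hn; have := h1 n hn; omega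
    have huniq : ∀ b top, ∀ m n : Expo 3, cornerSlope b top m = 0 → cornerSlope b top n = 0 →
        n = m := by
      intro b top m n hm hn
      have h1 := m.1.is_le
      have h2 := m.2.is_le
      have h3 := n.1.is_le
      have h4 := n.2.is_le
      cases b <;> cases top <;> simp [cornerSlope, diagSlope] at hm hn <;> ext <;> omega
    exact ⟨m, (Finset.Nonempty.subset_singleton_iff ⟨m, hm⟩).1 fun n hn =>
      Finset.mem_singleton.2 (huniq _ _ m n (hz m hm) (hz n hn)), hz m hm⟩

/-- The conditions on dual cells become one bound on slopes, an open condition that is easy to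
deform. Parity is needed to recover both exponents of the corner edge from this bound. -/
theorem corner_iff {a : Expo 3 → ℝ} (ha : IsSmooth a) {q : Param} (h : Par a q) :
    (InCornerChamber a q ∨ OnCornerEdge a q) ↔ ∃ b top, InCorner a q b top := by
  constructor
  -- By unimodularity an exponent active together with the two ends of the corner edge has
  -- determinant `0` or `±1` with them. Among those of slope at least two this leaves precisely the
  -- three exponents excluded in `OnCornerEdge`.
  · have edge : ∀ (p : ℝ × ℝ) (b top : Bool) (m m' : Expo 3), m ∈ dualCell a p →
        m' ∈ dualCell a p → (∀ r, |det3 m m' r| = 1 ∨ det3 m m' r = 0 →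
          2 ≤ cornerSlope b top r → r ∉ dualCell a p) →
        ∀ r ∈ dualCell a p, cornerSlope b top r ≤ 1 := by
      intro p b top m m' hm hm' hr r hrp
      by_contra! hlt
      refine hr r ?_ hlt hrp
      by_cases h0 : det3 m m' r = 0
      · exact Or.inr h0
      · exact Or.inl (ha p m hm m' hm' r hrp h0).1
    rintro ((⟨hl, hc⟩ | ⟨hl, hc⟩ | ⟨hl, hc⟩ | ⟨hl, hc⟩) |
      (⟨hl, h1, h2, h3, h4, h5⟩ | ⟨hl, h1, h2, h3, h4, h5⟩ | ⟨hl, h1, h2, h3, h4, h5⟩ |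
        ⟨hl, h1, h2, h3, h4, h5⟩))
    · refine ⟨true, false, by simpa using hl, fun m hm => ?_⟩
      rw [show cornerVertex q false = vert0 q from rfl, hc, Finset.mem_singleton] at hm
      rw [hm]; decide
    · refine ⟨true, true, by simpa using hl, fun m hm => ?_⟩
      rw [show cornerVertex q true = vert1 q from rfl, hc, Finset.mem_singleton] at hm
      rw [hm]; decide
    · refine ⟨false, false, by simpa using hl, fun m hm => ?_⟩
      rw [show cornerVertex q false = vert0 q from rfl, hc, Finset.mem_singleton] at hm
      rw [hm]; decide
    · refine ⟨false, true, by simpa using hl, fun m hm => ?_⟩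
      rw [show cornerVertex q true = vert1 q from rfl, hc, Finset.mem_singleton] at hm
      rw [hm]; decide
    · refine ⟨true, false, by simpa using hl, edge _ _ _ _ _ h1 h2 fun r hr hs hrp => ?_⟩
      have : r = (0, 2) ∨ r = (1, 1) ∨ r = (2, 0) := by clear hrp; revert r; decide
      rcases this with rfl | rfl | rfl
      exacts [h3 hrp, h4 hrp, h5 hrp]
    · refine ⟨true, true, by simpa using hl, edge _ _ _ _ _ h1 h2 fun r hr hs hrp => ?_⟩
      have : r = (1, 3) ∨ r = (2, 2) ∨ r = (3, 1) := by clear hrp; revert r; decide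
      rcases this with rfl | rfl | rfl
      exacts [h3 hrp, h4 hrp, h5 hrp]
    · refine ⟨false, false, by simpa using hl, edge _ _ _ _ _ h1 h2 fun r hr hs hrp => ?_⟩
      have : r = (1, 0) ∨ r = (2, 1) ∨ r = (3, 2) := by clear hrp; revert r; decide
      rcases this with rfl | rfl | rfl
      exacts [h3 hrp, h4 hrp, h5 hrp]
    · refine ⟨false, true, by simpa using hl, edge _ _ _ _ _ h1 h2 fun r hr hs hrp => ?_⟩
      have : r = (0, 1) ∨ r = (1, 2) ∨ r = (2, 3) := by clear hrp; revert r; decide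
      rcases this with rfl | rfl | rfl
      exacts [h3 hrp, h4 hrp, h5 hrp]
  · rintro ⟨b, top, hc⟩
    have hle := hc.2
    have hnot : ∀ r, 2 ≤ cornerSlope b top r → r ∉ dualCell a (cornerVertex q top) :=
      fun r hr hr' => absurd (hle r hr') (by omega)
    rcases hc.cases h with ⟨m, hm, hm0⟩ | ⟨m, hm, m', hm', hne, e, e'⟩
    · left
      cases b <;> cases top
      · exact Or.inr (Or.inr (Or.inl ⟨by simpa using hc.1, by
          rw [← show m = (3, 0) by clear hm; revert m; decide]; exact hm⟩))
      · exact Or.inr (Or.inr (Or.inr ⟨by simpa using hc.1, by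
          rw [← show m = (0, 3) by clear hm; revert m; decide]; exact hm⟩))
      · exact Or.inl ⟨by simpa using hc.1, by
          rw [← show m = (0, 0) by clear hm; revert m; decide]; exact hm⟩
      · exact Or.inr (Or.inl ⟨by simpa using hc.1, by
          rw [← show m = (3, 3) by clear hm; revert m; decide]; exact hm⟩)
    · right
      cases b <;> cases top
      · have : (m = (2, 0) ∧ m' = (3, 1)) ∨ (m = (3, 1) ∧ m' = (2, 0)) := by
          clear hm hm'; revert m m'; decide
        refine Or.inr (Or.inr (Or.inl ⟨by simpa using hc.1, ?_, ?_, hnot _ (by decide),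
          hnot _ (by decide), hnot _ (by decide)⟩)) <;>
        rcases this with ⟨rfl, rfl⟩ | ⟨rfl, rfl⟩ <;> assumption
      · have : (m = (0, 2) ∧ m' = (1, 3)) ∨ (m = (1, 3) ∧ m' = (0, 2)) := by
          clear hm hm'; revert m m'; decide
        refine Or.inr (Or.inr (Or.inr ⟨by simpa using hc.1, ?_, ?_, hnot _ (by decide),
          hnot _ (by decide), hnot _ (by decide)⟩)) <;>
        rcases this with ⟨rfl, rfl⟩ | ⟨rfl, rfl⟩ <;> assumption
      · have : (m = (1, 0) ∧ m' = (0, 1)) ∨ (m = (0, 1) ∧ m' = (1, 0)) := by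
          clear hm hm'; revert m m'; decide
        refine Or.inl ⟨by simpa using hc.1, ?_, ?_, hnot _ (by decide),
          hnot _ (by decide), hnot _ (by decide)⟩ <;>
        rcases this with ⟨rfl, rfl⟩ | ⟨rfl, rfl⟩ <;> assumption
      · have : (m = (2, 3) ∧ m' = (3, 2)) ∨ (m = (3, 2) ∧ m' = (2, 3)) := by
          clear hm hm'; revert m m'; decide
        refine Or.inr (Or.inl ⟨by simpa using hc.1, ?_, ?_, hnot _ (by decide),
          hnot _ (by decide), hnot _ (by decide)⟩) <;>
        rcases this with ⟨rfl, rfl⟩ | ⟨rfl, rfl⟩ <;> assumption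

/-! ### Symmetries of the square -/

/-- A symmetry of order two of the square of exponents, with its actions on the plane and on
`(1,1)`-curves. -/
structure Symmetry where
  /-- the action on exponents -/
  expo : Expo 3 → Expo 3
  /-- the action on the plane -/
  pt : ℝ × ℝ → ℝ × ℝ
  /-- the action on `(1,1)`-curves -/
  act : Param → Param
  /-- the action on legs -/
  leg : Leg → Leg
  /-- the action on corners -/
  corner : Bool × Bool → Bool × Bool
  expo_expo : ∀ m, expo (expo m) = m
  act_act : ∀ q, act (act q) = q
  leg_leg : ∀ L, leg (leg L) = L
  corner_corner : ∀ c, corner (corner c) = c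
  continuous_act : Continuous act
  exists_pt : ∀ p, ∃ p', pt p' = p
  abs_det3 : ∀ m m' r, |det3 (expo m) (expo m') (expo r)| = |det3 m m' r|
  value : ∀ (a : Expo 3 → ℝ) (m m' : Expo 3) (p : ℝ × ℝ),
    monomialValue (a ∘ expo) m (pt p) - monomialValue (a ∘ expo) m' (pt p) =
      monomialValue a (expo m) p - monomialValue a (expo m') p
  legVertex_act : ∀ q L, legVertex (act q) (leg L) = pt (legVertex q L)
  pt_add : ∀ (p : ℝ × ℝ) (L : Leg) (t : ℝ), pt (p + t • legDir L) = pt p + t • legDir (leg L)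
  legSlope_leg : ∀ L m, legSlope (leg L) m = legSlope L (expo m)
  abs_act : ∀ q, |(act q).2| = |q.2|
  edge_act : ∀ q, q.2 ≠ 0 → ∀ t, 0 ≤ t → t ≤ |q.2| → ∃ t', 0 ≤ t' ∧ t' ≤ |q.2| ∧
    edgePt (act q) t = pt (edgePt q t')
  even_act : ∀ q : Param, q.2 ≠ 0 → ∀ m, Even (diagSlope (edgeSign q) (expo m)) →
    Even (diagSlope (edgeSign (act q)) m)
  sign_act : ∀ (q : Param) c, (if (corner c).1 then 0 < (act q).2 else (act q).2 < 0) ↔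
    (if c.1 then 0 < q.2 else q.2 < 0)
  cornerVertex_act : ∀ (q : Param) (c : Bool × Bool), (if c.1 then 0 < q.2 else q.2 < 0) →
    cornerVertex (act q) (corner c).2 = pt (cornerVertex q c.2)
  cornerSlope_corner : ∀ c m, cornerSlope (corner c).1 (corner c).2 m =
    cornerSlope c.1 c.2 (expo m)

namespace Symmetry

variable (s : Symmetry)

theorem mem_dualCell_pt {a : Expo 3 → ℝ} {p : ℝ × ℝ} {m : Expo 3} :
    m ∈ dualCell (a ∘ s.expo) (s.pt p) ↔ s.expo m ∈ dualCell a p := by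
  rw [mem_dualCell, mem_dualCell]
  constructor
  · intro h m'
    have h1 := h (s.expo m')
    have h2 := s.value a m (s.expo m') p
    rw [s.expo_expo] at h2
    linarith
  · intro h m'
    have h1 := h (s.expo m')
    have h2 := s.value a m m' p
    linarith

theorem dualCell_pt_eq_singleton {a : Expo 3 → ℝ} {p : ℝ × ℝ} {m : Expo 3}
    (h : dualCell (a ∘ s.expo) (s.pt p) = {m}) : dualCell a p = {s.expo m} := by
  ext x
  have := s.mem_dualCell_pt (a := a) (p := p) (m := s.expo x)
  rw [s.expo_expo, h, Finset.mem_singleton] at this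
  rw [← this, Finset.mem_singleton]
  constructor
  · intro h; rw [← h, s.expo_expo]
  · intro h; rw [h, s.expo_expo]

theorem isSmooth {a : Expo 3 → ℝ} (ha : IsSmooth a) : IsSmooth (a ∘ s.expo) := by
  intro p q hq r hr t ht hdet
  obtain ⟨p, rfl⟩ := s.exists_pt p
  rw [mem_dualCell_pt] at hq hr ht
  obtain ⟨h1, h2⟩ := ha p _ hq _ hr _ ht (by
    rwa [ne_eq, ← abs_eq_zero, s.abs_det3, abs_eq_zero])
  refine ⟨by rwa [s.abs_det3] at h1, ?_⟩
  ext x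
  have hinj : ∀ x y, s.expo x = s.expo y ↔ x = y := fun x y =>
    ⟨fun h => by rw [← s.expo_expo x, h, s.expo_expo], fun h => by rw [h]⟩
  rw [mem_dualCell_pt, h2]
  simp only [Finset.mem_insert, Finset.mem_singleton, hinj]

theorem comp_comp (a : Expo 3 → ℝ) : (a ∘ s.expo) ∘ s.expo = a := by
  funext m
  simp only [Function.comp_apply, s.expo_expo]

theorem par_act {a : Expo 3 → ℝ} {q : Param} (h : Par a q) : Par (a ∘ s.expo) (s.act q) := by
  constructor
  · intro L t ht m hm
    rw [← s.leg_leg L] at hm ⊢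
    rw [legPt, s.legVertex_act, ← s.pt_add] at hm
    rw [s.legSlope_leg]
    exact h.1 (s.leg L) t ht _ (s.dualCell_pt_eq_singleton hm)
  · intro hq t ht ht' m hm
    have hq' : q.2 ≠ 0 := by
      rw [ne_eq, ← abs_eq_zero, s.abs_act, abs_eq_zero] at hq
      exact hq
    rw [s.abs_act] at ht'
    obtain ⟨t', h0, h1, he⟩ := s.edge_act q hq' t ht ht'
    rw [he] at hm
    exact s.even_act q hq' m (h.2 hq' t' h0 h1 _ (s.dualCell_pt_eq_singleton hm))

theorem dualCell_forall {a : Expo 3 → ℝ} {p : ℝ × ℝ} {P : Expo 3 → Prop} :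
    (∀ m ∈ dualCell (a ∘ s.expo) (s.pt p), P (s.expo m)) ↔ ∀ m ∈ dualCell a p, P m := by
  constructor
  · intro h m hm
    have := h (s.expo m)
    rw [s.mem_dualCell_pt, s.expo_expo] at this
    exact this hm
  · intro h m hm
    exact h _ (s.mem_dualCell_pt.1 hm)

theorem onOppositeRay_act {a : Expo 3 → ℝ} {q : Param} {L : Leg} :
    OnOppositeRay (a ∘ s.expo) (s.act q) (s.leg L) ↔ OnOppositeRay a q L := by
  unfold OnOppositeRay
  simp only [s.legVertex_act, s.legSlope_leg]
  exact s.dualCell_forall (P := fun m => legSlope L m = 0)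

theorem inCorner_act {a : Expo 3 → ℝ} {q : Param} {c : Bool × Bool} :
    InCorner (a ∘ s.expo) (s.act q) (s.corner c).1 (s.corner c).2 ↔ InCorner a q c.1 c.2 := by
  unfold InCorner
  rw [s.sign_act]
  refine and_congr_right fun h => ?_
  rw [s.cornerVertex_act q c h]
  simp only [s.cornerSlope_corner]
  exact s.dualCell_forall (P := fun m => cornerSlope c.1 c.2 m ≤ 1)

end Symmetry

/-- The reflection `(x, y) ↦ (-x, y)`. -/
def reflection : Symmetry where
  expo m := (m.1.rev, m.2)
  pt p := (-p.1, p.2)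
  act q := ((-q.1.1, q.1.2), -q.2)
  leg
    | .negHor => .posHor
    | .posHor => .negHor
    | .negVert => .negVert
    | .posVert => .posVert
  corner c := (!c.1, c.2)
  expo_expo m := by simp
  act_act q := by simp
  leg_leg L := by cases L <;> rfl
  corner_corner c := by simp
  continuous_act := by fun_prop
  exists_pt p := ⟨(-p.1, p.2), by simp⟩
  abs_det3 m m' r := by
    rw [← abs_neg]
    congr 1
    have h1 := m.1.is_le
    have h2 := m'.1.is_le
    have h3 := r.1.is_le
    simp only [det3, Fin.val_rev]
    zify [h1, h2, h3, show (m.1 : ℕ) + 1 ≤ 3 + 1 by omega, show (m'.1 : ℕ) + 1 ≤ 3 + 1 by omega,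
      show (r.1 : ℕ) + 1 ≤ 3 + 1 by omega]
    ring
  value a m m' p := by
    simp only [monomialValue, Fin.val_rev, Function.comp_apply]
    rw [Nat.cast_sub (by omega), Nat.cast_sub (by omega)]
    push_cast
    ring
  legVertex_act q L := by
    rcases lt_trichotomy q.2 0 with h | h | h
    · cases L <;> simp [legVertex, vert0, vert1, h.not_ge, h.le] <;> ring
    · cases L <;> simp [legVertex, vert0, vert1, h]
    · cases L <;> simp [legVertex, vert0, vert1, h.not_ge, h.le] <;> ring
  pt_add p L t := by cases L <;> ext <;> simp [legDir] <;> ring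
  legSlope_leg L m := by
    have := m.1.is_le
    cases L <;> simp only [legSlope, Fin.val_rev] <;> omega
  abs_act q := by simp
  edge_act q hq t h0 h1 := by
    refine ⟨t, h0, h1, ?_⟩
    rcases lt_or_gt_of_ne hq with h | h
    · simp [edgePt, edgeDir, edgeSign, vert0, h.not_ge, h.le, add_comm]
    · simp [edgePt, edgeDir, edgeSign, vert0, h.not_ge, h.le, add_comm]
  even_act q hq m h := by
    have h1 := m.1.is_le
    have h2 := m.2.is_le
    rw [Nat.even_iff] at h ⊢
    rcases lt_or_gt_of_ne hq with hl | hl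
    · simp [edgeSign, hl.not_ge, hl.le, diagSlope, Fin.val_rev] at h ⊢
      omega
    · simp [edgeSign, hl.not_ge, hl.le, diagSlope, Fin.val_rev] at h ⊢
      omega
  sign_act q c := by rcases c with ⟨b, t⟩; cases b <;> simp
  cornerVertex_act q c _ := by
    rcases c with ⟨b, t⟩
    cases t <;> simp [cornerVertex, vert0, vert1]; ring
  cornerSlope_corner c m := by
    have h1 := m.1.is_le
    have h2 := m.2.is_le
    rcases c with ⟨b, t⟩
    cases b <;> cases t <;> simp [cornerSlope, diagSlope, Fin.val_rev] <;> omega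

/-- The reflection `(x, y) ↦ (y, x)`. -/
def swap : Symmetry where
  expo m := (m.2, m.1)
  pt p := (p.2, p.1)
  -- For `q.2 < 0` the lowest vertex of the image is the mirror image of the upper vertex; `min`
  -- covers both signs. For the same reason `corner` exchanges the two ends of an edge of slope
  -- `-1`.
  act q := ((q.1.2 - min q.2 0, q.1.1 + min q.2 0), q.2)
  leg
    | .negHor => .negVert
    | .negVert => .negHor
    | .posHor => .posVert
    | .posVert => .posHor
  corner c := (c.1, if c.1 then c.2 else !c.2)
  expo_expo m := rfl
  act_act q := by simp
  leg_leg L := by cases L <;> rfl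
  corner_corner c := by rcases c with ⟨b, t⟩; cases b <;> simp
  continuous_act := by fun_prop
  exists_pt p := ⟨(p.2, p.1), rfl⟩
  abs_det3 m m' r := by
    rw [← abs_neg]
    congr 1
    simp only [det3]
    ring
  value a m m' p := by
    simp only [monomialValue, Function.comp_apply]
    ring
  legVertex_act q L := by
    rcases le_or_gt 0 q.2 with h | h
    · cases L <;> simp [legVertex, vert0, vert1, h, abs_of_nonneg h]
    · cases L <;> simp [legVertex, vert0, vert1, h.not_ge, h.le, abs_of_neg h, sub_eq_add_neg]
  pt_add p L t := by cases L <;> ext <;> simp [legDir]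
  legSlope_leg L m := by cases L <;> rfl
  abs_act q := rfl
  edge_act q hq t h0 h1 := by
    rcases lt_or_gt_of_ne hq with h | h
    · refine ⟨|q.2| - t, by linarith, by linarith, ?_⟩
      simp [edgePt, edgeDir, edgeSign, vert0, h.not_ge, h.le, abs_of_neg h]
      constructor <;> ring
    · refine ⟨t, h0, h1, ?_⟩
      simp [edgePt, edgeDir, edgeSign, vert0, h.le]
  even_act q hq m h := by
    have h1 := m.1.is_le
    have h2 := m.2.is_le
    rw [Nat.even_iff] at h ⊢
    rcases lt_or_gt_of_ne hq with hl | hl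
    · simp [edgeSign, hl.not_ge, hl.le, diagSlope] at h ⊢
      omega
    · simp [edgeSign, hl.not_ge, hl.le, diagSlope] at h ⊢
      omega
  sign_act q c := Iff.rfl
  cornerVertex_act q c h := by
    rcases c with ⟨b, t⟩
    cases b
    · have h : q.2 < 0 := by simpa using h
      cases t <;> simp [cornerVertex, vert0, vert1, h.le, abs_of_neg h, sub_eq_add_neg]
    · have h : 0 < q.2 := by simpa using h
      cases t <;> simp [cornerVertex, vert0, vert1, h.le, abs_of_pos h]
  cornerSlope_corner c m := by
    have h1 := m.1.is_le
    have h2 := m.2.is_le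
    rcases c with ⟨b, t⟩
    cases b <;> cases t <;> simp [cornerSlope, diagSlope] <;> omega

/-! ### Sliding a vertex out of a corner chamber -/

/-- The properties of tritangent classes which are used to deform their members. -/
structure Admissible (a : Expo 3 → ℝ) (Ω : Set Param) : Prop where
  par : ∀ q ∈ Ω, Par a q
  conn : IsPathConnected Ω
  extend : ∀ γ : ℝ → Param, Continuous γ → γ 0 ∈ Ω → (∀ t, 0 ≤ t → t < 1 → Par a (γ t)) → γ 1 ∈ Ω

theorem Admissible.act {a : Expo 3 → ℝ} {Ω : Set Param} (h : Admissible a Ω) (s : Symmetry) :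
    Admissible (a ∘ s.expo) (s.act ⁻¹' Ω) where
  par q hq := by
    have := s.par_act (h.par _ hq)
    rwa [s.act_act] at this
  conn := by
    have : s.act ⁻¹' Ω = s.act '' Ω := by
      ext q
      exact ⟨fun hq => ⟨_, hq, s.act_act q⟩, by rintro ⟨q, hq, rfl⟩; rwa [mem_preimage, s.act_act]⟩
    rw [this]
    exact h.conn.image s.continuous_act
  extend γ hγ h0 hp := h.extend (s.act ∘ γ) (s.continuous_act.comp hγ) h0 fun t ht ht' => by
    have := s.par_act (hp t ht ht')
    rwa [s.comp_comp] at this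

/-- Moving the lowest vertex by `δ` along the edge of slope `1`, keeping the other vertex. -/
def slide (q : Param) (δ : ℝ) : Param := ((q.1.1 + δ, q.1.2 + δ), q.2 - δ)

theorem slide_zero (q : Param) : slide q 0 = q := by simp [slide]

theorem edgeSign_of_pos {q : Param} (h : 0 < q.2) : edgeSign q = true := by simp [edgeSign, h.le]

theorem vert0_slide {q : Param} (h : 0 < q.2) (δ : ℝ) : vert0 (slide q δ) = edgePt q δ := by
  ext <;> simp [slide, vert0, edgePt, edgeSign_of_pos h, edgeDir]

theorem vert1_slide {q : Param} {δ : ℝ} (h : 0 < q.2) (hδ : δ ≤ q.2) :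
    vert1 (slide q δ) = vert1 q := by
  simp only [slide, vert1, abs_of_pos h, abs_of_nonneg (sub_nonneg.2 hδ)]
  ext <;> simp

theorem edgePt_slide {q : Param} (h : 0 < q.2) {δ : ℝ} (hδ : δ < q.2) (t : ℝ) :
    edgePt (slide q δ) t = edgePt q (δ + t) := by
  rw [edgePt, vert0_slide h, edgeSign_of_pos (show 0 < (slide q δ).2 from sub_pos.2 hδ),
    edgePt, edgePt, edgeSign_of_pos h]
  module

/-- The edge and the two upper legs of the new curve are contained in those of the old one. Up to
the second root only `(0,0)`, `(1,0)`, `(0,1)` can be active at the moving vertex. Both lower legs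
start with an active exponent of slope three, so each chamber they meet has odd slope. -/
theorem par_slide {a : Expo 3 → ℝ} {q : Param} (h : Par a q) {t : ℝ} (ht : 0 ≤ t)
    (htl : t < q.2) (hτ : t < root a (diagSlope true) 2 (vert0 q)) : Par a (slide q t) := by
  have hl : 0 < q.2 := ht.trans_lt htl
  have hl' : 0 < (slide q t).2 := sub_pos.2 htl
  have hes := edgeSign_of_pos hl
  have hle : ∀ m ∈ dualCell a (edgePt q t), (m.1 : ℕ) + (m.2 : ℕ) ≤ 1 := by
    intro m hm
    by_contra! hcon
    refine not_le.2 hτ (((isSlope_diag true).root_le_iff a _ (by norm_num) (by norm_num) t).2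
      ⟨m, ?_, hcon⟩)
    rwa [edgePt, hes] at hm
  have hsing : ∀ m, dualCell a (edgePt q t) = {m} → (m.1 : ℕ) + m.2 ≠ 1 := by
    intro m hm hm1
    have := h.2 hl.ne' t ht (by rw [abs_of_pos hl]; exact htl.le) m hm
    rw [hes] at this
    simp only [diagSlope, hm1] at this
    exact absurd this (by decide)
  -- The assumption on `σ` says that near the corner only one exponent, of degree one, can fail to
  -- have slope three. It cannot be the only active exponent, because degree one is odd along the
  -- old edge.
  have hlow : ∀ σ : Expo 3 → ℕ, (∀ m m', σ m ≠ 3 → σ m' ≠ 3 → (m.1 : ℕ) + m.2 ≤ 1 →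
      (m'.1 : ℕ) + m'.2 ≤ 1 → (m.1 : ℕ) + m.2 = 1 ∧ m' = m) →
      ∃ m ∈ dualCell a (edgePt q t), σ m = 3 := by
    intro σ hσ
    by_contra! hcon
    obtain ⟨m, hm⟩ := dualCell_nonempty a (edgePt q t)
    refine hsing m ?_ (hσ m m (hcon m hm) (hcon m hm) (hle m hm) (hle m hm)).1
    exact (Finset.Nonempty.subset_singleton_iff ⟨m, hm⟩).1 fun n hn =>
      Finset.mem_singleton.2 (hσ m n (hcon m hm) (hcon n hn) (hle m hm) (hle n hn)).2
  have hleg : ∀ L, legVertex (slide q t) L = edgePt q t →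
      (∃ m ∈ dualCell a (edgePt q t), legSlope L m = 3) → ∀ s, 0 ≤ s → ∀ m,
      dualCell a (legPt (slide q t) L s) = {m} → Odd (legSlope L m) := by
    rintro L hv ⟨m₀, hm₀, h3⟩ s hs m hm
    have : legSlope L m = 3 := by
      rcases hs.eq_or_lt with rfl | hs
      · rw [legPt_zero, hv] at hm
        rw [hm, Finset.mem_singleton] at hm₀
        rw [← hm₀, h3]
      · rw [legPt, hv] at hm
        have h1 := (isSlope_leg L).mono (a := a) (v := edgePt q t) hs (m := m₀) (m' := m)
          (by rwa [zero_smul, add_zero]) (by rw [hm]; exact Finset.mem_singleton_self m)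
        have := (isSlope_leg L).le m
        omega
    rw [this]; decide
  constructor
  · intro L
    cases L
    · refine hleg .negHor ?_ (hlow _ ?_)
      · simp only [legVertex, if_pos hl'.le, vert0_slide hl]
      · intro m m' h1 h2 h3 h4
        simp only [legSlope] at h1 h2
        refine ⟨by omega, ?_⟩
        ext <;> omega
    · refine hleg .negVert ?_ (hlow _ ?_)
      · exact vert0_slide hl t
      · intro m m' h1 h2 h3 h4
        simp only [legSlope] at h1 h2
        refine ⟨by omega, ?_⟩
        ext <;> omega
    all_goals
      intro s hs m hm
      refine h.1 _ s hs m ?_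
      rw [← hm, legPt, legPt]
      simp only [legVertex, if_pos hl'.le, if_pos hl.le, vert1_slide hl htl.le]
  · intro _ s hs hs' m hm
    rw [edgePt_slide hl htl] at hm
    rw [edgeSign_of_pos hl', ← hes]
    rw [abs_of_pos hl'] at hs'
    refine h.2 hl.ne' (t + s) (by linarith) ?_ m hm
    rw [abs_of_pos hl]
    have : s ≤ q.2 - t := hs'
    linarith

/-- A deformation of `Ω` which moves all members out of one corner. -/
def CornerStep (a : Expo 3 → ℝ) (Ω : Set Param) (c : Bool × Bool) : Prop :=
  ∃ f : Param → Param, ContinuousOn f Ω ∧ ∀ q ∈ Ω, f q ∈ Ω ∧ ¬ InCorner a (f q) c.1 c.2 ∧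
    (¬ InCorner a q c.1 c.2 → f q = q) ∧
    ∀ c' : Bool × Bool, ¬ InCorner a q c'.1 c'.2 → ¬ InCorner a (f q) c'.1 c'.2

/-- The vertex moves up the edge until an exponent of degree two becomes active or the edge has
length zero. Either way it leaves the corner, while the other vertex stays fixed and `q.2` does not
become negative, so no other corner is entered. -/
theorem Admissible.cornerStep {a : Expo 3 → ℝ} {Ω : Set Param} (h : Admissible a Ω) :
    CornerStep a Ω (true, false) := by
  -- Truncating both terms at zero gives a continuous function on all parameters, vanishing exactly
  -- outside this corner; members outside are not moved.
  let δ : Param → ℝ := fun q => min (max q.2 0) (max (root a (diagSlope true) 2 (vert0 q)) 0)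
  have hδ : Continuous δ := (continuous_snd.max continuous_const).min
    (((continuous_root _ _ _).comp continuous_fst).max continuous_const)
  have hcorner : ∀ q : Param, InCorner a q true false ↔
      0 < q.2 ∧ 0 < root a (diagSlope true) 2 (vert0 q) := by
    intro q
    rw [← not_le (a := root _ _ _ _), (isSlope_diag true).root_le_iff a _ (by norm_num)
      (by norm_num), zero_smul, add_zero]
    push Not
    simp only [InCorner, if_true, cornerVertex, cornerSlope, Bool.false_eq_true, if_false]
    exact and_congr_right fun _ => forall₂_congr fun m _ => by omega
  have hδ0 : ∀ q, ¬ InCorner a q true false → δ q = 0 := by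
    intro q hq
    rw [hcorner, not_and_or, not_lt, not_lt] at hq
    rcases hq with h | h
    · exact (congrArg₂ min (max_eq_right h) rfl).trans (min_eq_left (le_max_right _ _))
    · exact (congrArg₂ min rfl (max_eq_right h)).trans (min_eq_right (le_max_right _ _))
  have hid : ∀ q, ¬ InCorner a q true false → slide q (δ q) = q := fun q hq => by
    rw [hδ0 q hq, slide_zero]
  refine ⟨fun q => slide q (δ q), Continuous.continuousOn (by unfold slide; fun_prop), ?_⟩
  intro q hq
  dsimp only
  by_cases hc : InCorner a q true false
  swap
  · refine ⟨by rwa [hid q hc], by rwa [hid q hc], fun _ => hid q hc, fun c' h' => by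
      rwa [hid q hc]⟩
  obtain ⟨hl, hτ⟩ := (hcorner q).1 hc
  have hδeq : δ q = min q.2 (root a (diagSlope true) 2 (vert0 q)) :=
    congrArg₂ min (max_eq_left hl.le) (max_eq_left hτ.le)
  have hpos : 0 < δ q := by rw [hδeq]; exact lt_min hl hτ
  have hle : δ q ≤ q.2 := by rw [hδeq]; exact min_le_left _ _
  have hout : ¬ InCorner a (slide q (δ q)) true false := by
    rintro ⟨h1, h2⟩
    have h1 : 0 < (slide q (δ q)).2 := by simpa using h1
    change 0 < q.2 - δ q at h1
    have h3 : δ q = root a (diagSlope true) 2 (vert0 q) := by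
      rw [hδeq]
      refine min_eq_right (le_of_lt ?_)
      by_contra! hcon
      rw [hδeq, min_eq_left hcon, sub_self] at h1
      exact lt_irrefl _ h1
    obtain ⟨m, hm, hm2⟩ := ((isSlope_diag true).root_le_iff a (vert0 q) (by norm_num)
      (by norm_num) (δ q)).1 h3.ge
    have := h2 m (by
      change m ∈ dualCell a (vert0 _)
      rw [vert0_slide hl, edgePt, edgeSign_of_pos hl]; exact hm)
    simp only [cornerSlope, Bool.false_eq_true, if_false] at this
    omega
  refine ⟨?_, hout, fun h => absurd hc h, ?_⟩
  -- Parity is verified before the endpoint only, since the edge may contract there; closedness of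
  -- the class, through `extend`, supplies the endpoint.
  · have := h.extend (fun u => slide q (u * δ q)) (by unfold slide; fun_prop)
      (by rwa [zero_mul, slide_zero]) fun t ht ht' => ?_
    · rwa [one_mul] at this
    · have h1 : t * δ q < δ q := by nlinarith
      refine par_slide (h.par q hq) (mul_nonneg ht hpos.le) (h1.trans_le hle) (h1.trans_le ?_)
      rw [hδeq]; exact min_le_right _ _
  · rintro ⟨b, top⟩ h' hb
    cases b
    · have h1 : (slide q (δ q)).2 < 0 := by simpa using hb.1
      have h2 : (slide q (δ q)).2 = q.2 - δ q := rfl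
      linarith
    · cases top
      · exact hout hb
      · refine h' ⟨by simpa using hl, fun m hm => hb.2 m ?_⟩
        change m ∈ dualCell a (vert1 _)
        rw [vert1_slide hl hle]
        exact hm

theorem CornerStep.act {a : Expo 3 → ℝ} {Ω : Set Param} (s : Symmetry) {c : Bool × Bool}
    (h : CornerStep (a ∘ s.expo) (s.act ⁻¹' Ω) (s.corner c)) : CornerStep a Ω c := by
  obtain ⟨f, hf, hstep⟩ := h
  have hmaps : MapsTo s.act Ω (s.act ⁻¹' Ω) := fun q hq => by rwa [mem_preimage, s.act_act]
  have key : ∀ q c, InCorner a (s.act q) (c : Bool × Bool).1 c.2 ↔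
      InCorner (a ∘ s.expo) q (s.corner c).1 (s.corner c).2 := fun q c => by
    rw [← s.inCorner_act, s.act_act]
  have key' : ∀ q c, InCorner (a ∘ s.expo) (s.act q) (s.corner c).1 (s.corner c).2 ↔
    InCorner a q (c : Bool × Bool).1 c.2 := fun q c => s.inCorner_act
  refine ⟨s.act ∘ f ∘ s.act, s.continuous_act.comp_continuousOn
    (hf.comp s.continuous_act.continuousOn hmaps), fun q hq => ?_⟩
  obtain ⟨h1, h2, h3, h4⟩ := hstep _ (hmaps hq)
  refine ⟨h1, ?_, fun h => ?_, fun c' h => ?_⟩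
  · rwa [Function.comp_apply, key]
  · rw [Function.comp_apply, Function.comp_apply, h3 (by rwa [key']), s.act_act]
  · rw [Function.comp_apply, key]
    exact h4 _ (by rwa [key'])

/-- The two reflections act transitively on the four corners. -/
theorem cornerStep {a : Expo 3 → ℝ} {Ω : Set Param} (h : Admissible a Ω) (c : Bool × Bool) :
    CornerStep a Ω c := by
  have h00 : ∀ (a : Expo 3 → ℝ) (Ω : Set Param), Admissible a Ω → CornerStep a Ω (true, false) :=
    fun _ _ h => h.cornerStep
  have h30 : ∀ (a : Expo 3 → ℝ) (Ω : Set Param), Admissible a Ω → CornerStep a Ω (false, false) :=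
    fun _ _ h => CornerStep.act reflection (h00 _ _ (h.act _))
  have h03 : ∀ (a : Expo 3 → ℝ) (Ω : Set Param), Admissible a Ω → CornerStep a Ω (false, true) :=
    fun _ _ h => CornerStep.act swap (h30 _ _ (h.act _))
  rcases c with ⟨b, top⟩
  cases b <;> cases top
  · exact h30 a Ω h
  · exact h03 a Ω h
  · exact h00 a Ω h
  · exact CornerStep.act reflection (h03 _ _ (h.act _))

/-- The members without a vertex in a corner. -/
def bounded (a : Expo 3 → ℝ) (Ω : Set Param) : Set Param :=
  {q ∈ Ω | ∀ c : Bool × Bool, ¬ InCorner a q c.1 c.2}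

/-- No step enters a corner already left, so the composition of all four retracts `Ω` onto `bounded
a Ω`. -/
theorem isPathConnected_bounded {a : Expo 3 → ℝ} {Ω : Set Param} (h : Admissible a Ω) :
    IsPathConnected (bounded a Ω) := by
  choose f hf hstep using cornerStep h
  let F : List (Bool × Bool) → Param → Param := fun l q => l.foldr (fun c q => f c q) q
  have hF : ∀ l : List (Bool × Bool), ContinuousOn (F l) Ω ∧ ∀ q ∈ Ω, F l q ∈ Ω ∧
      (∀ c ∈ l, ¬ InCorner a (F l q) c.1 c.2) ∧ (q ∈ bounded a Ω → F l q = q) := by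
    intro l
    induction l with
    | nil => exact ⟨continuousOn_id, fun q hq => ⟨hq, by simp, fun _ => rfl⟩⟩
    | cons c l ih =>
      refine ⟨(hf c).comp ih.1 fun q hq => (ih.2 q hq).1, fun q hq => ?_⟩
      obtain ⟨h1, h2, h3⟩ := ih.2 q hq
      obtain ⟨g1, g2, g3, g4⟩ := hstep c (F l q) h1
      refine ⟨g1, ?_, fun hq' => ?_⟩
      · intro c' hc'
        rcases List.mem_cons.1 hc' with rfl | hc'
        · exact g2
        · exact g4 c' (h2 c' hc')
      · change f c (F l q) = q
        rw [h3 hq'] at g3 ⊢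
        exact g3 (hq'.2 c)
  obtain ⟨hc, hall⟩ := hF [(true, false), (true, true), (false, false), (false, true)]
  convert h.conn.image' hc using 1
  ext q
  constructor
  · exact fun hq => ⟨q, hq.1, (hall q hq.1).2.2 hq⟩
  · rintro ⟨p, hp, rfl⟩
    obtain ⟨h1, h2, -⟩ := hall p hp
    exact ⟨h1, fun c => h2 c (by rcases c with ⟨b, t⟩; cases b <;> cases t <;> simp)⟩

/-! ### Pushing a special tritangent to the end of a ray -/

/-- How far the exponent `(3, 1)` stays active from `p` in the direction `(1, 1)`. -/
def exitLength (a : Expo 3 → ℝ) (p : ℝ × ℝ) : ℝ :=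
  min (min (monomialValue a (3, 1) p - monomialValue a (3, 2) p)
    (monomialValue a (3, 1) p - monomialValue a (2, 3) p))
    ((monomialValue a (3, 1) p - monomialValue a (3, 3) p) / 2)

theorem continuous_exitLength (a : Expo 3 → ℝ) : Continuous (exitLength a) := by
  have := continuous_monomialValue a
  unfold exitLength
  fun_prop

theorem diag_sub (a : Expo 3 → ℝ) (p : ℝ × ℝ) (t : ℝ) (m : Expo 3) :
    monomialValue a (3, 1) (p + t • edgeDir true) - monomialValue a m (p + t • edgeDir true) =
      monomialValue a (3, 1) p - monomialValue a m p + t * (4 - ((m.1 : ℕ) + (m.2 : ℕ) : ℝ)) := by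
  have := (isSlope_diag true).value_sub a p t (3, 1) m
  rw [this]
  simp only [diagSlope]
  push_cast
  norm_num

/-- Along `(1,1)` the exponent `(3,1)` has slope four. Only `(3,2)` and `(2,3)`, faster by one, and
`(3,3)`, faster by two, can overtake it; hence the division by two in `exitLength`. -/
theorem le_exitLength_iff {a : Expo 3 → ℝ} {p : ℝ × ℝ} (hp : (3, 1) ∈ dualCell a p) {t : ℝ}
    (ht : 0 ≤ t) : t ≤ exitLength a p ↔ (3, 1) ∈ dualCell a (p + t • edgeDir true) := by
  have key : ∀ m, monomialValue a m (p + t • edgeDir true) ≤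
      monomialValue a (3, 1) (p + t • edgeDir true) ↔
      0 ≤ monomialValue a (3, 1) p - monomialValue a m p +
        t * (4 - ((m.1 : ℕ) + (m.2 : ℕ) : ℝ)) := fun m => by
    rw [← diag_sub, sub_nonneg]
  rw [mem_dualCell, exitLength, le_min_iff, le_min_iff]
  simp only [key]
  constructor
  · rintro ⟨⟨h1, h2⟩, h3⟩ m
    have hm := mem_dualCell.1 hp m
    by_cases hle : (m.1 : ℕ) + (m.2 : ℕ) ≤ 4
    · have : ((m.1 : ℕ) + (m.2 : ℕ) : ℝ) ≤ 4 := by exact_mod_cast hle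
      have := mul_nonneg ht (sub_nonneg.2 this)
      linarith
    · have : m = (3, 2) ∨ m = (2, 3) ∨ m = (3, 3) := by
        clear hm; revert m; decide
      rcases this with rfl | rfl | rfl <;> norm_num <;> linarith
  · intro h
    have h1 := h (3, 2)
    have h2 := h (2, 3)
    have h3 := h (3, 3)
    norm_num at h1 h2 h3
    exact ⟨⟨by linarith, by linarith⟩, by linarith⟩

theorem exists_mem_exit {a : Expo 3 → ℝ} {p : ℝ × ℝ} (hp : (3, 1) ∈ dualCell a p)
    (ht : 0 ≤ exitLength a p) : ∃ m ∈ dualCell a (p + exitLength a p • edgeDir true),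
      m = (3, 2) ∨ m = (2, 3) ∨ m = (3, 3) := by
  have h31 := (le_exitLength_iff hp ht).1 le_rfl
  have key := diag_sub a p (exitLength a p)
  have hmem : ∀ m : Expo 3, monomialValue a (3, 1) p - monomialValue a m p +
      exitLength a p * (4 - ((m.1 : ℕ) + (m.2 : ℕ) : ℝ)) = 0 →
      m ∈ dualCell a (p + exitLength a p • edgeDir true) := fun m hm =>
    mem_dualCell_of_eq h31 (by have := key m; linarith)
  rcases min_choice (min (monomialValue a (3, 1) p - monomialValue a (3, 2) p)
    (monomialValue a (3, 1) p - monomialValue a (2, 3) p))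
    ((monomialValue a (3, 1) p - monomialValue a (3, 3) p) / 2) with h | h
  · rcases min_choice (monomialValue a (3, 1) p - monomialValue a (3, 2) p)
      (monomialValue a (3, 1) p - monomialValue a (2, 3) p) with h' | h'
    · have e : exitLength a p = _ := h.trans h'
      exact ⟨(3, 2), hmem _ (by rw [e]; norm_num), Or.inl rfl⟩
    · have e : exitLength a p = _ := h.trans h'
      exact ⟨(2, 3), hmem _ (by rw [e]; norm_num), Or.inr (Or.inl rfl)⟩
  · have e : exitLength a p = _ := h
    exact ⟨(3, 3), hmem _ (by rw [e]; norm_num), Or.inr (Or.inr rfl)⟩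

/-- Moving to the left changes only the comparison with `(2,3)`, by `s`. This keeps the lower clamp
in `push` inactive on the ray. -/
theorem exitLength_sub_le (a : Expo 3 → ℝ) (x y : ℝ) {s : ℝ} (hs : 0 ≤ s) :
    exitLength a (x, y) - s ≤ exitLength a (x - s, y) := by
  have h1 : exitLength a (x, y) ≤ _ := min_le_left _ _
  have h2 := h1.trans (min_le_left _ _)
  have h3 := h1.trans (min_le_right _ _)
  have h4 : exitLength a (x, y) ≤ _ := min_le_right _ _
  have e32 : monomialValue a (3, 1) (x - s, y) - monomialValue a (3, 2) (x - s, y) =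
    monomialValue a (3, 1) (x, y) - monomialValue a (3, 2) (x, y) := by
      norm_num [monomialValue]; ring
  have e23 : monomialValue a (3, 1) (x - s, y) - monomialValue a (2, 3) (x - s, y) =
    monomialValue a (3, 1) (x, y) - monomialValue a (2, 3) (x, y) - s := by
      norm_num [monomialValue]; ring
  have e33 : monomialValue a (3, 1) (x - s, y) - monomialValue a (3, 3) (x - s, y) =
    monomialValue a (3, 1) (x, y) - monomialValue a (3, 3) (x, y) := by
      norm_num [monomialValue]; ring
  unfold exitLength at h1 h2 h3 h4 ⊢
  rw [e32, e23, e33]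
  exact le_min (le_min (by linarith) (by linarith)) (by linarith)

theorem IsSlope.mem_dualCell_of_top {d : ℝ × ℝ} {σ : Expo 3 → ℕ} {N : ℕ} (h : IsSlope d σ N)
    {a : Expo 3 → ℝ} {v : ℝ × ℝ} {t : ℝ} {m : Expo 3} (hm : m ∈ dualCell a v) (hN : σ m = N)
    (ht : 0 ≤ t) : m ∈ dualCell a (v + t • d) := by
  rw [mem_dualCell] at hm ⊢
  intro m'
  have h1 := h.value_sub a v t m m'
  have h2 := hm m'
  have h3 : (σ m' : ℝ) ≤ σ m := by rw [hN]; exact_mod_cast h.le m'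
  have := mul_nonneg ht (sub_nonneg.2 h3)
  linarith

theorem IsSmooth.notMem_of_mem {a : Expo 3 → ℝ} (ha : IsSmooth a) {p : ℝ × ℝ}
    (h : (3, 1) ∈ dualCell a p) : (3, 3) ∉ dualCell a p := fun h' => by
  have := (ha.adjacent (L := .negHor) h h' (by decide) rfl).1
  revert this
  decide

/-- The negative horizontal leg is part of the old one. The edge stays where `(3,1)` is active, with
even slope four. The negative vertical and positive horizontal legs start with an active exponent of
slope three and hence meet only odd chambers. The positive vertical leg is the delicate one. -/
theorem par_of_ray {a : Expo 3 → ℝ} (ha : IsSmooth a) {q : Param} (h : Par a q) (hl : 0 ≤ q.2)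
    (hv1 : (3, 1) ∈ dualCell a (vert1 q)) {s : ℝ} (hs : 0 ≤ s) {p : ℝ × ℝ}
    (hp : p = (q.1.1 - s, q.1.2)) (h30 : (3, 0) ∈ dualCell a p) (h31 : (3, 1) ∈ dualCell a p)
    {l : ℝ} (hl0 : 0 ≤ l) (hl1 : l = min (q.2 + s) (exitLength a p)) : Par a (p, l) := by
  have hle : l ≤ exitLength a p := hl1.trans_le (min_le_right _ _)
  have hle' : l ≤ q.2 + s := hl1.trans_le (min_le_left _ _)
  have hdiag : ∀ t, 0 ≤ t → t ≤ l → (3, 1) ∈ dualCell a (p + t • edgeDir true) :=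
    fun t h0 h1 => (le_exitLength_iff h31 h0).1 (h1.trans hle)
  have hz : vert1 (p, l) = p + l • edgeDir true := by
    ext <;> simp [vert1, edgeDir, abs_of_nonneg hl0]
  have hz31 : (3, 1) ∈ dualCell a (vert1 (p, l)) := by rw [hz]; exact hdiag l hl0 le_rfl
  have hne : ∀ {A : Finset (Expo 3)} {m n n' : Expo 3}, n ∈ A → n' ∈ A → n ≠ n' → A ≠ {m} := by
    rintro A m n n' hn hn' hne rfl
    rw [Finset.mem_singleton] at hn hn'
    exact hne (hn.trans hn'.symm)
  have hstart : ∀ (L : Leg) (t : ℝ) (m n : Expo 3), 0 < t → n ∈ dualCell a (legVertex (p, l) L) →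
      legSlope L n = 3 → dualCell a (legPt (p, l) L t) = {m} → Odd (legSlope L m) := by
    intro L t m n ht hn hn3 hm
    have h1 := (isSlope_leg L).mono (a := a) (v := legVertex (p, l) L) ht (m := n) (m' := m)
      (by rwa [zero_smul, add_zero]) (by rw [← legPt, hm]; exact Finset.mem_singleton_self m)
    have h2 := (isSlope_leg L).le m
    rw [show legSlope L m = 3 by omega]
    decide
  constructor
  · intro L t ht m hm
    cases L
    · refine h.1 .negHor (s + t) (by linarith) m ?_
      rw [← hm]
      congr 1
      rw [legPt, legPt, legVertex, legVertex, if_pos hl, if_pos (show 0 ≤ (p, l).2 from hl0), vert0,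
        vert0, hp]
      ext <;> simp [legDir] <;> ring
    · rcases ht.eq_or_lt with rfl | ht
      · rw [legPt_zero] at hm
        exact absurd hm (hne (n := (3, 0)) (n' := (3, 1)) h30 h31 (by decide))
      · exact hstart .negVert t m _ ht h30 rfl hm
    · have hv : legVertex (p, l) .posHor = vert1 (p, l) := if_pos hl0
      rcases ht.eq_or_lt with rfl | ht
      · rw [legPt_zero, hv] at hm
        rw [hm, Finset.mem_singleton] at hz31
        rw [← hz31]; decide
      · exact hstart .posHor t m (3, 1) ht (by rwa [hv]) rfl hm
    -- With edge length `q.2 + s` the upper vertex stays on the line of the old vertical leg, whose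
    -- parity applies. Otherwise the edge stops where `(3,1)` ties with `(3,2)`, `(2,3)` or `(3,3)`;
    -- the last is excluded by smoothness, and `(2,3)` starts the new leg with slope three.
    · rcases le_total (q.2 + s) (exitLength a p) with hcase | hcase
      · rw [min_eq_left hcase] at hl1
        refine h.1 .posVert (s + t) (by linarith) m ?_
        rw [← hm]
        congr 1
        rw [legPt, legPt, legVertex, legVertex, vert1, vert1, hp, abs_of_nonneg hl,
          abs_of_nonneg (show 0 ≤ (((q.1.1 - s, q.1.2), l) : Param).2 from hl0), hl1]
        ext <;> simp [legDir]; ring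
      · rcases hcase.eq_or_lt with hcase | hcase
        · rw [hcase, min_self] at hl1
          refine h.1 .posVert (s + t) (by linarith) m ?_
          rw [← hm]
          congr 1
          rw [legPt, legPt, legVertex, legVertex, vert1, vert1, hp, abs_of_nonneg hl,
            abs_of_nonneg (show 0 ≤ (((q.1.1 - s, q.1.2), l) : Param).2 from hl0), hl1]
          ext <;> simp [legDir]; ring
        rw [min_eq_right hcase.le] at hl1
        obtain ⟨n, hn, hn'⟩ := exists_mem_exit h31 (hl1 ▸ hl0)
        rw [← hl1, ← hz] at hn
        rcases hn' with rfl | rfl | rfl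
        -- A tie with `(3,2)` means that the vertex is on a horizontal ray of `Γ`. To the right this
        -- ray crosses the old vertical leg, where the top slope would be two, attained by `(3,2)`
        -- alone: this contradicts parity.
        · exfalso
          set z := vert1 (p, l) with hzdef
          have hzx : z.1 = q.1.1 - s + l := by rw [hzdef, vert1, hp]
          have heq := monomialValue_eq_of_mem hz31 hn
          have hge := mem_dualCell.1 hv1 (3, 2)
          have hdiff : ∀ p : ℝ × ℝ, monomialValue a (3, 1) p - monomialValue a (3, 2) p =
              a (3, 1) - a (3, 2) - p.2 := fun p => by norm_num [monomialValue]; ring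
          have e1 := hdiff z
          have e2 := hdiff (vert1 q)
          have ht0 : 0 ≤ z.2 - (vert1 q).2 := by linarith
          have hu : 0 < q.2 + s - l := by rw [hl1]; linarith
          have hz' : legPt q .posVert (z.2 - (vert1 q).2) = z + (q.2 + s - l) • legDir .posHor := by
            ext
            · simp [legPt, legVertex, legDir, hzx, vert1]
            · simp [legPt, legVertex, legDir]
          have hmem : ∀ n ∈ dualCell a z, legSlope .posHor n = 3 →
              n ∈ dualCell a (legPt q .posVert (z.2 - (vert1 q).2)) := fun n hn h3 => by
            rw [hz']
            exact (isSlope_leg .posHor).mem_dualCell_of_top hn h3 hu.le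
          have h31' := hmem _ hz31 rfl
          have hall : ∀ n ∈ dualCell a (legPt q .posVert (z.2 - (vert1 q).2)), (n.1 : ℕ) = 3 := by
            intro n hn
            rw [hz'] at hn
            have h1 : 3 ≤ (n.1 : ℕ) := (isSlope_leg .posHor).mono (a := a) (v := z) hu (m := (3, 1))
              (m' := n) (by rwa [zero_smul, add_zero]) hn
            have := n.1.is_le
            omega
          obtain ⟨n, hn1, hn2, hn3⟩ := h.exists_ne_of_even ht0 (hmem _ hn rfl) (fun n hn => by
            have h1 := hall n hn
            have h2 : n ≠ (3, 3) := fun e => ha.notMem_of_mem h31' (e ▸ hn)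
            have h3 : (n.2 : ℕ) ≠ 3 := fun e => h2 (Prod.ext (Fin.ext h1) (Fin.ext e))
            have h4 := n.2.is_le
            change (n.2 : ℕ) ≤ 2
            omega) (by decide)
          exact hn2 (Prod.ext (Fin.ext (hall n hn1)) (Fin.ext hn3))
        · rcases ht.eq_or_lt with rfl | ht
          · rw [legPt_zero] at hm
            exact absurd hm (hne (n := (3, 1)) (n' := (2, 3)) hz31 hn (by decide))
          · exact hstart .posVert t m _ ht hn rfl hm
        · exact absurd hn (ha.notMem_of_mem hz31)
  · intro _ t ht ht' m hm
    have hsg : edgeSign (p, l) = true := decide_eq_true hl0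
    rw [hsg]
    rw [edgePt, hsg, vert0] at hm
    have := hdiag t ht (ht'.trans_eq (abs_of_nonneg hl0))
    rw [hm, Finset.mem_singleton] at this
    rw [← this]
    decide

/-- Neither a vertex in a corner nor special. -/
def IsGood (a : Expo 3 → ℝ) (q : Param) : Prop :=
  (∀ c : Bool × Bool, ¬ InCorner a q c.1 c.2) ∧ ∀ L, ¬ OnOppositeRay a q L

theorem legVertex_negHor (q : Param) :
    legVertex q .negHor = (q.1.1 + min q.2 0, q.1.2 - min q.2 0) := by
  rcases le_or_gt 0 q.2 with h | h
  · simp [legVertex, vert0, h]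
  · simp [legVertex, vert1, h.not_ge, h.le, abs_of_neg h, sub_eq_add_neg]

/-- Moving the vertex of the negative horizontal leg by `s` along this leg. -/
def push (a : Expo 3 → ℝ) (q : Param) (s : ℝ) : Param :=
  ((q.1.1 - s, q.1.2),
    -- On the ray this is `min (q.2 + s) (exitLength …)`. Clamping the change of length between `-s`
    -- and `s` makes the map the identity at `s = 0` for every `q`, in particular off the ray, while
    -- keeping it continuous.
    q.2 + max (-s) (min s (exitLength a (q.1.1 - s, q.1.2) - q.2)))

theorem push_zero (a : Expo 3 → ℝ) (q : Param) : push a q 0 = q := by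
  simp [push]

/-- A middle ray, with `(3,1)` and `(3,2)` active, violates parity: a vertical leg at the vertex
would leave it with slope two attained only once. The inequality then selects the lower of the two
outer rays. -/
theorem OnOppositeRay.cell_negHor {a : Expo 3 → ℝ} (ha : IsSmooth a) {q : Param} (h : Par a q)
    (hL : OnOppositeRay a q .negHor)
    (hle : monomialValue a (3, 2) (legVertex q .negHor) ≤
      monomialValue a (3, 1) (legVertex q .negHor)) :
    dualCell a (legVertex q .negHor) = {(3, 0), (3, 1)} := by
  obtain ⟨m, m', r, hne, e, e', -, hadj, hmem, -⟩ := hL.structure ha h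
  have hv := hmem 0 (onOppositeRay_iff.1 hL)
  rw [legPt_zero] at hv
  have hcases : (({m, m'} : Finset (Expo 3)) = {(3, 0), (3, 1)}) ∨
      (({m, m'} : Finset (Expo 3)) = {(3, 1), (3, 2)}) ∨
      (({m, m'} : Finset (Expo 3)) = {(3, 2), (3, 3)}) := by
    clear hv hmem
    revert m m'
    decide
  rcases hcases with h1 | h1 | h1 <;> rw [h1] at hv
  · exact hv
  · exfalso
    rcases le_or_gt 0 q.2 with hl | hl
    · have hv0 : legPt q .negVert 0 = legVertex q .negHor := by
        rw [legPt_zero, legVertex, legVertex, if_pos hl]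
      obtain ⟨n, hn, hn1, hn2⟩ := h.exists_ne_of_even (L := .negVert) (t := 0) le_rfl (m := (3, 1))
        (by rw [hv0, hv]; decide) (by rw [hv0, hv]; decide) (by decide)
      rw [hv0, hv] at hn
      revert n
      decide
    · have hv0 : legPt q .posVert 0 = legVertex q .negHor := by
        rw [legPt_zero, legVertex, legVertex, if_neg (not_le.2 hl)]
      obtain ⟨n, hn, hn1, hn2⟩ := h.exists_ne_of_even (L := .posVert) (t := 0) le_rfl (m := (3, 2))
        (by rw [hv0, hv]; decide) (by rw [hv0, hv]; decide) (by decide)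
      rw [hv0, hv] at hn
      revert n
      decide
  · exfalso
    have h32 : (3, 2) ∈ dualCell a (legVertex q .negHor) := by rw [hv]; decide
    have h31 : (3, 1) ∈ dualCell a (legVertex q .negHor) :=
      mem_dualCell_of_eq h32 (le_antisymm hle (mem_dualCell.1 h32 _))
    rw [hv] at h31
    revert h31
    decide

/-- A negative `q.2` would place the lowest vertex in the corner of `(3,0)`, by monotonicity of
slopes along the edge. Similarly, along an edge of slope `1` the slopes at the upper end are at
least four, and avoiding the corner of `(3,3)` forces slope four and a tie with `(3,1)`. -/
theorem OnOppositeRay.nonneg {a : Expo 3 → ℝ} {q : Param}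
    (hq : ∀ c : Bool × Bool, ¬ InCorner a q c.1 c.2)
    (hv : dualCell a (legVertex q .negHor) = {(3, 0), (3, 1)}) :
    0 ≤ q.2 ∧ (3, 1) ∈ dualCell a (vert1 q) := by
  have hl : 0 ≤ q.2 := by
    by_contra! hl
    rw [legVertex, if_neg (not_le.2 hl)] at hv
    refine hq (false, false) ⟨by simpa using hl, fun m hm => ?_⟩
    have hs : edgeSign q = false := by simp [edgeSign, hl]
    have := (isSlope_diag false).mono (a := a) (v := vert0 q) (abs_pos.2 hl.ne) (m := m)
      (m' := (3, 0)) (by rwa [zero_smul, add_zero]) (by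
        rw [← hs, ← edgePt, edgePt_abs, hv]; decide)
    exact this.trans (by decide)
  refine ⟨hl, ?_⟩
  rw [legVertex, if_pos hl] at hv
  have h31 : (3, 1) ∈ dualCell a (vert0 q) := by rw [hv]; decide
  rcases hl.eq_or_lt with hl | hl
  · rwa [vert1_eq_vert0.2 hl.symm]
  · have hs := edgeSign_of_pos hl
    obtain ⟨m, hm, hm5⟩ : ∃ m ∈ dualCell a (vert1 q), (m.1 : ℕ) + m.2 < 5 := by
      by_contra! hcon
      refine hq (true, true) ⟨by simpa using hl, fun m hm => ?_⟩
      have := hcon m hm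
      simp only [cornerSlope, if_true, diagSlope]
      omega
    have hv1 : vert1 q = vert0 q + |q.2| • edgeDir true := by rw [← hs, ← edgePt, edgePt_abs]
    have h4 : 4 ≤ diagSlope true m := (isSlope_diag true).mono (a := a) (v := vert0 q)
      (abs_pos.2 hl.ne') (m := (3, 1)) (m' := m) (by rwa [zero_smul, add_zero]) (by rwa [← hv1])
    have h4' : (m.1 : ℕ) + m.2 = 4 := by simp only [diagSlope] at h4; omega
    have h4'' : ((m.1 : ℕ) + (m.2 : ℕ) : ℝ) = 4 := by exact_mod_cast h4'
    have e := diag_sub a (vert0 q) |q.2| m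
    rw [← hv1, h4'', sub_self, mul_zero, add_zero] at e
    have h1 := mem_dualCell.1 h31 m
    have h2 := mem_dualCell.1 hm (3, 1)
    exact mem_dualCell_of_eq hm (by linarith)

/-- Throughout the move `(3,0)` and `(3,1)` remain active at the lowest vertex, so `par_of_ray`
applies. -/
theorem push_spec {a : Expo 3 → ℝ} (ha : IsSmooth a) {q : Param} (h : Par a q)
    (hL : OnOppositeRay a q .negHor)
    (hv : dualCell a (legVertex q .negHor) = {(3, 0), (3, 1)}) (hl : 0 ≤ q.2)
    (hv1 : (3, 1) ∈ dualCell a (vert1 q)) :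
    (∀ s, 0 ≤ s → s < root a (legSlope .negHor) 1 (legVertex q .negHor) → Par a (push a q s)) ∧
    IsGood a (push a q (root a (legSlope .negHor) 1 (legVertex q .negHor))) := by
  obtain ⟨m, m', r, hne, e, e', er, hadj, hmem, hcell⟩ := hL.structure ha h
  have hκ := onOppositeRay_iff.1 hL
  set κ := root a (legSlope .negHor) 1 (legVertex q .negHor)
  have hmm := hmem 0 hκ
  rw [legPt_zero, hv] at hmm
  have hvert : legVertex q .negHor = vert0 q := by rw [legVertex, if_pos hl]
  have hpt : ∀ s, legPt q .negHor s = (q.1.1 - s, q.1.2) := fun s => by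
    rw [legPt, hvert, vert0]
    ext <;> simp [legDir, sub_eq_add_neg]
  have hact : ∀ s ≤ κ, ∀ n, n = (3, 0) ∨ n = (3, 1) → n ∈ dualCell a (q.1.1 - s, q.1.2) := by
    intro s hs n hn
    have hn' : n ∈ ({m, m'} : Finset (Expo 3)) := by
      rw [← hmm]
      simpa using hn
    rw [← hpt]
    rcases hs.lt_or_eq with hs | rfl
    · rw [hmem s hs]; exact hn'
    · rw [hcell]
      simp only [Finset.mem_insert, Finset.mem_singleton] at hn' ⊢
      tauto
  have h31v : (3, 1) ∈ dualCell a (vert0 q) := by rw [← hvert, hv]; decide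
  have hexit0 : q.2 ≤ exitLength a (vert0 q) := by
    rw [le_exitLength_iff h31v hl]
    convert hv1 using 2
    ext <;> simp [vert0, vert1, edgeDir, abs_of_nonneg hl]
  have hlen : ∀ s, 0 ≤ s → s ≤ κ → 0 ≤ min (q.2 + s) (exitLength a (q.1.1 - s, q.1.2)) ∧
      push a q s = ((q.1.1 - s, q.1.2), min (q.2 + s) (exitLength a (q.1.1 - s, q.1.2))) := by
    intro s hs hsκ
    have h1 := exitLength_sub_le a q.1.1 q.1.2 hs
    have h2 : q.2 ≤ exitLength a (q.1.1, q.1.2) := hexit0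
    refine ⟨le_min (by linarith) ?_, ?_⟩
    · rw [le_exitLength_iff (hact s hsκ _ (Or.inr rfl)) le_rfl, zero_smul, add_zero]
      exact hact s hsκ _ (Or.inr rfl)
    · rw [push, max_eq_right (le_min (by linarith) (by linarith)), ← min_add_add_left,
        add_sub_cancel]
  constructor
  · intro s hs hsκ
    obtain ⟨h1, h2⟩ := hlen s hs hsκ.le
    rw [h2]
    exact par_of_ray ha h hl hv1 hs rfl (hact s hsκ.le _ (Or.inl rfl))
      (hact s hsκ.le _ (Or.inr rfl)) h1 rfl
  -- At the end of the ray `(3,1)` is active at both vertices. Its slopes exclude all corners and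
  -- every opposite ray except that of the pushed leg, which is excluded by the new exponent `r` of
  -- slope one.
  · obtain ⟨h1, h2⟩ := hlen κ hκ.le le_rfl
    have h31 := hact κ le_rfl _ (Or.inr rfl)
    have h0 : (3, 1) ∈ dualCell a (vert0 (push a q κ)) := h31
    have hl' : 0 ≤ (push a q κ).2 := by rw [h2]; exact h1
    have h1' : (3, 1) ∈ dualCell a (vert1 (push a q κ)) := by
      have h3 := (le_exitLength_iff h31 h1).1 (min_le_right _ _)
      rw [h2]
      convert h3 using 2
      ext <;> simp [vert1, edgeDir, abs_of_nonneg h1]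
    refine ⟨?_, ?_⟩
    · rintro ⟨b, top⟩ ⟨hb, hall⟩
      cases b
      · have : (push a q κ).2 < 0 := by simpa using hb
        exact absurd this (not_lt.2 hl')
      · cases top
        · exact absurd (hall _ h0) (by decide)
        · exact absurd (hall _ h1') (by decide)
    · intro L hL'
      cases L
      · have hr : r ∈ dualCell a (legVertex (push a q κ) .negHor) := by
          rw [legVertex, if_pos hl', h2, vert0, ← hpt, hcell]
          simp
        have := hL' r hr
        omega
      · exact absurd (hL' _ h0) (by decide)
      · exact absurd (hL' (3, 1) (by rw [legVertex, if_pos hl']; exact h1')) (by decide)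
      · exact absurd (hL' _ h1') (by decide)

/-- A deformation of the bounded members which turns those satisfying `T` into good ones. -/
def RayStep (a : Expo 3 → ℝ) (Ω : Set Param) (T : Param → Prop) : Prop :=
  ∃ f : Param → Param, ContinuousOn f (bounded a Ω) ∧ ∀ q ∈ bounded a Ω, f q ∈ bounded a Ω ∧
    (f q = q ∨ IsGood a (f q)) ∧ (IsGood a q → f q = q) ∧ (T q → IsGood a (f q))

/-- The vertex of the leg `L` lies on the ray of `Γ` opposite to `L` along which `m` is active. -/
def OnRay (a : Expo 3 → ℝ) (L : Leg) (m : Expo 3) (q : Param) : Prop :=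
  OnOppositeRay a q L ∧ m ∈ dualCell a (legVertex q L)

open Classical in
-- The comparison of `(3,2)` with `(3,1)` separates the lower outer ray from the upper one, so that
-- only members on the former are pushed.
theorem Admissible.rayStep {a : Expo 3 → ℝ} (ha : IsSmooth a) {Ω : Set Param}
    (h : Admissible a Ω) : RayStep a Ω (OnRay a .negHor (3, 1)) := by
  let κ : Param → ℝ := fun q => max (root a (legSlope .negHor) 1 (legVertex q .negHor)) 0
  have hvc : Continuous fun q => legVertex q .negHor := by
    simp only [legVertex_negHor]
    fun_prop
  have hκ : Continuous κ := ((continuous_root _ _ _).comp hvc).max continuous_const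
  have hpush : Continuous fun q => push a q (κ q) := by
    have := continuous_exitLength a
    unfold push
    fun_prop
  let A : Param → Prop := fun q => monomialValue a (3, 2) (legVertex q .negHor) ≤
    monomialValue a (3, 1) (legVertex q .negHor)
  have hκ0 : ∀ q, ¬ OnOppositeRay a q .negHor → push a q (κ q) = q := by
    intro q hq
    rw [onOppositeRay_iff, not_lt] at hq
    rw [show κ q = 0 from max_eq_right hq, push_zero]
  have hκ1 : ∀ q, OnOppositeRay a q .negHor →
      κ q = root a (legSlope .negHor) 1 (legVertex q .negHor) := by
    intro q hq
    exact max_eq_left (onOppositeRay_iff.1 hq).le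
  have hcell : ∀ q ∈ bounded a Ω, A q → OnOppositeRay a q .negHor →
      dualCell a (legVertex q .negHor) = {(3, 0), (3, 1)} := fun q hq hA hL =>
    hL.cell_negHor ha (h.par q hq.1) hA
  refine ⟨fun q => if A q then push a q (κ q) else q, ?_, ?_⟩
  -- On the dividing locus `(3,1)` and `(3,2)` have equal values, which rules out an opposite ray by
  -- the description of its dual cell. Hence `push` is the identity there and the two branches
  -- agree.
  · refine ContinuousOn.if ?_ hpush.continuousOn continuousOn_id
    rintro q ⟨hq, hfr⟩
    have heq := frontier_le_subset_eq ((continuous_monomialValue a (3, 2)).comp hvc)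
      ((continuous_monomialValue a (3, 1)).comp hvc) hfr
    have heq : monomialValue a (3, 2) (legVertex q .negHor) =
      monomialValue a (3, 1) (legVertex q .negHor) := heq
    refine hκ0 q fun hL => ?_
    have hv := hcell q hq heq.le hL
    have h31 : (3, 1) ∈ dualCell a (legVertex q .negHor) := by rw [hv]; decide
    have h32 := mem_dualCell_of_eq h31 heq.symm
    rw [hv] at h32
    revert h32
    decide
  · intro q hq
    dsimp only
    by_cases hA : A q
    swap
    · rw [if_neg hA]
      refine ⟨hq, Or.inl rfl, fun _ => rfl, fun hT => absurd ?_ hA⟩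
      exact mem_dualCell.1 hT.2 _
    rw [if_pos hA]
    by_cases hL : OnOppositeRay a q .negHor
    swap
    · rw [hκ0 q hL]
      exact ⟨hq, Or.inl rfl, fun _ => rfl, fun hT => absurd hT.1 hL⟩
    have hv := hcell q hq hA hL
    obtain ⟨hl, hv1⟩ := OnOppositeRay.nonneg hq.2 hv
    obtain ⟨h1, h2⟩ := push_spec ha (h.par q hq.1) hL hv hl hv1
    rw [← hκ1 q hL] at h1 h2
    have hpos : 0 < κ q := by rw [hκ1 q hL]; exact onOppositeRay_iff.1 hL
    refine ⟨⟨?_, h2.1⟩, Or.inr h2, fun hg => absurd hL (hg.2 _), fun _ => h2⟩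
    have := h.extend (fun t => push a q (t * κ q)) (by
      have := continuous_exitLength a
      unfold push
      fun_prop) (by rw [zero_mul, push_zero]; exact hq.1)
      fun t ht ht' => h1 _ (mul_nonneg ht hpos.le) (by nlinarith)
    rwa [one_mul] at this

theorem Symmetry.isGood_act (s : Symmetry) {a : Expo 3 → ℝ} {q : Param} :
    IsGood (a ∘ s.expo) (s.act q) ↔ IsGood a q := by
  constructor
  · rintro ⟨h1, h2⟩
    exact ⟨fun c => by rw [← s.inCorner_act]; exact h1 _,
      fun L => by rw [← s.onOppositeRay_act]; exact h2 _⟩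
  · rintro ⟨h1, h2⟩
    refine ⟨fun c => ?_, fun L => ?_⟩
    · rw [← s.corner_corner c, s.inCorner_act]; exact h1 _
    · rw [← s.leg_leg L, s.onOppositeRay_act]; exact h2 _

theorem Symmetry.onRay_act (s : Symmetry) {a : Expo 3 → ℝ} {q : Param} {L : Leg} {m : Expo 3} :
    OnRay (a ∘ s.expo) (s.leg L) (s.expo m) (s.act q) ↔ OnRay a L m q := by
  unfold OnRay
  rw [s.onOppositeRay_act, s.legVertex_act, s.mem_dualCell_pt, s.expo_expo]

theorem Symmetry.act_mem_bounded (s : Symmetry) {a : Expo 3 → ℝ} {Ω : Set Param} {q : Param}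
    (h : q ∈ bounded a Ω) : s.act q ∈ bounded (a ∘ s.expo) (s.act ⁻¹' Ω) := by
  refine ⟨by rw [mem_preimage, s.act_act]; exact h.1, fun c => ?_⟩
  rw [← s.corner_corner c, s.inCorner_act]
  exact h.2 _

theorem RayStep.act {a : Expo 3 → ℝ} {Ω : Set Param} (s : Symmetry) {L : Leg} {m : Expo 3}
    (h : RayStep (a ∘ s.expo) (s.act ⁻¹' Ω) (OnRay (a ∘ s.expo) (s.leg L) (s.expo m))) :
    RayStep a Ω (OnRay a L m) := by
  obtain ⟨f, hf, hstep⟩ := h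
  have hgood : ∀ q, IsGood a (s.act q) ↔ IsGood (a ∘ s.expo) q := fun q => by
    rw [← s.isGood_act, s.act_act]
  refine ⟨s.act ∘ f ∘ s.act, s.continuous_act.comp_continuousOn
    (hf.comp s.continuous_act.continuousOn fun q => s.act_mem_bounded), fun q hq => ?_⟩
  obtain ⟨h1, h2, h3, h4⟩ := hstep _ (s.act_mem_bounded hq)
  refine ⟨?_, ?_, fun h => ?_, fun h => ?_⟩
  · refine ⟨h1.1, fun c => ?_⟩
    rw [← s.inCorner_act]
    change ¬ InCorner _ (s.act (s.act _)) _ _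
    rw [s.act_act]
    exact h1.2 _
  · refine h2.imp (fun h => ?_) fun h => ?_
    · change s.act (f (s.act q)) = q
      rw [h, s.act_act]
    · exact (hgood _).2 h
  · change s.act (f (s.act q)) = q
    rw [h3 (s.isGood_act.2 h), s.act_act]
  · exact (hgood _).2 (h4 (s.onRay_act.2 h))

/-- The alternative that a step either fixes a member or makes it good is what permits composition:
the second step fixes good members, and acts on the original member otherwise. -/
theorem RayStep.or {a : Expo 3 → ℝ} {Ω : Set Param} {T T' : Param → Prop} (h : RayStep a Ω T)
    (h' : RayStep a Ω T') : RayStep a Ω fun q => T q ∨ T' q := by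
  obtain ⟨f, hf, hstep⟩ := h
  obtain ⟨g, hg, hstep'⟩ := h'
  refine ⟨g ∘ f, hg.comp hf fun q hq => (hstep q hq).1, fun q hq => ?_⟩
  obtain ⟨h1, h2, h3, h4⟩ := hstep q hq
  obtain ⟨g1, g2, g3, g4⟩ := hstep' _ h1
  have hfix : IsGood a (f q) → IsGood a (g (f q)) := fun h => by rwa [g3 h]
  refine ⟨g1, ?_, fun h => ?_, ?_⟩
  · rcases h2 with h2 | h2
    · change g (f q) = q ∨ _
      rw [h2] at g2 ⊢
      rcases g2 with g2 | g2
      · exact Or.inl g2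
      · refine Or.inr ?_
        change IsGood a (g (f q))
        rwa [h2]
    · exact Or.inr (hfix h2)
  · change g (f q) = q
    rw [h3 h] at g3 ⊢
    exact g3 h
  · rintro (h | h)
    · exact hfix (h4 h)
    · rcases h2 with h2 | h2
      · rw [h2] at g4
        change IsGood a (g (f q))
        rw [h2]
        exact g4 h
      · exact hfix h2

/-- The exponents in the interior of the side of slope `0`. -/
def sideMid : Leg → Bool → Expo 3
  | .negHor, b => (3, if b then 1 else 2)
  | .posHor, b => (0, if b then 1 else 2)
  | .negVert, b => (if b then 1 else 2, 3)
  | .posVert, b => (if b then 1 else 2, 0)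

/-- The symmetries generated by the two reflections act transitively on the eight pairs of a leg and
an inner exponent of the opposite side. -/
theorem rayStep {a : Expo 3 → ℝ} (ha : IsSmooth a) {Ω : Set Param} (h : Admissible a Ω) (L : Leg)
    (b : Bool) : RayStep a Ω (OnRay a L (sideMid L b)) := by
  have step : ∀ (s : Symmetry) (L : Leg) (m : Expo 3),
      (∀ (a : Expo 3 → ℝ) (Ω : Set Param), IsSmooth a → Admissible a Ω →
        RayStep a Ω (OnRay a L m)) → ∀ (a : Expo 3 → ℝ) (Ω : Set Param), IsSmooth a →
        Admissible a Ω → RayStep a Ω (OnRay a (s.leg L) (s.expo m)) := by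
    intro s L m h a Ω ha hΩ
    refine RayStep.act s ?_
    rw [s.leg_leg, s.expo_expo]
    exact h _ _ (s.isSmooth ha) (hΩ.act s)
  have h1 := step reflection .negHor (3, 1) fun a Ω ha h => h.rayStep ha
  have h2 := step swap .posHor (0, 1) h1
  have h3 := step reflection .posVert (1, 0) h2
  have h4 := step swap .posVert (2, 0) h3
  have h5 := step reflection .posHor (0, 2) h4
  have h6 := step swap .negHor (3, 1) fun a Ω ha h => h.rayStep ha
  have h7 := step reflection .negVert (1, 3) h6
  cases L <;> cases b
  · exact h5 a Ω ha h
  · exact h.rayStep ha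
  · exact h7 a Ω ha h
  · exact h6 a Ω ha h
  · exact h4 a Ω ha h
  · exact h1 a Ω ha h
  · exact h3 a Ω ha h
  · exact h2 a Ω ha h

/-- Of two neighbouring exponents on a side, at least one is not a corner of the square. -/
theorem OnOppositeRay.onRay {a : Expo 3 → ℝ} (ha : IsSmooth a) {q : Param} (h : Par a q) {L : Leg}
    (hL : OnOppositeRay a q L) : ∃ b, OnRay a L (sideMid L b) q := by
  obtain ⟨m, m', r, hne, e, e', -, hadj, hmem, -⟩ := hL.structure ha h
  have hv := hmem 0 (onOppositeRay_iff.1 hL)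
  rw [legPt_zero] at hv
  have hmid : ∃ b, sideMid L b = m ∨ sideMid L b = m' := by
    clear hv hmem hL
    revert m m'
    cases L <;> decide
  obtain ⟨b, hb⟩ := hmid
  refine ⟨b, hL, ?_⟩
  rw [hv, Finset.mem_insert, Finset.mem_singleton]
  exact hb

/-- The steps for all legs compose to a continuous map of the bounded members onto the good ones
that fixes the latter. -/
theorem isPathConnected_good {a : Expo 3 → ℝ} (ha : IsSmooth a) {Ω : Set Param}
    (h : Admissible a Ω) : IsPathConnected {q ∈ Ω | IsGood a q} := by
  have key : ∀ L, RayStep a Ω fun q => OnOppositeRay a q L ∧ q ∈ Ω := by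
    intro L
    obtain ⟨f, hf, hstep⟩ := (rayStep ha h L true).or (rayStep ha h L false)
    refine ⟨f, hf, fun q hq => ?_⟩
    obtain ⟨h1, h2, h3, h4⟩ := hstep q hq
    refine ⟨h1, h2, h3, fun hT => h4 ?_⟩
    obtain ⟨b, hb⟩ := hT.1.onRay ha (h.par q hT.2)
    cases b
    · exact Or.inr hb
    · exact Or.inl hb
  obtain ⟨f, hf, hstep⟩ := ((key .negHor).or (key .negVert)).or ((key .posHor).or (key .posVert))
  convert (isPathConnected_bounded h).image' hf using 1
  ext q
  constructor
  · rintro ⟨hq, hg⟩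
    have hb : q ∈ bounded a Ω := ⟨hq, hg.1⟩
    exact ⟨q, hb, (hstep q hb).2.2.1 hg⟩
  · rintro ⟨p, hp, rfl⟩
    obtain ⟨h1, h2, h3, h4⟩ := hstep p hp
    refine ⟨h1.1, ?_⟩
    by_cases hg : IsGood a p
    · rwa [h3 hg]
    · refine h4 ?_
      have : ∃ L, OnOppositeRay a p L := by
        by_contra! hcon
        exact hg ⟨hp.2, hcon⟩
      obtain ⟨L, hL⟩ := this
      cases L
      · exact Or.inl (Or.inl ⟨hL, hp.1⟩)
      · exact Or.inl (Or.inr ⟨hL, hp.1⟩)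
      · exact Or.inr (Or.inl ⟨hL, hp.1⟩)
      · exact Or.inr (Or.inr ⟨hL, hp.1⟩)

/-! ### Polyhedra -/

theorem IsPolyhedron.isClosed {D : Set Param} (h : IsPolyhedron D) : IsClosed D := by
  obtain ⟨H, rfl⟩ := h
  simp only [setOf_forall]
  exact isClosed_biInter fun h _ =>
    isClosed_le h.1.continuous_of_finiteDimensional continuous_const

theorem IsPolyhedron.convex {D : Set Param} (h : IsPolyhedron D) : Convex ℝ D := by
  obtain ⟨H, rfl⟩ := h
  simp only [setOf_forall]
  exact convex_iInter₂ fun h _ => convex_halfSpace_le h.1.isLinear _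

theorem exists_extension {D : Set Param} {q x : Param} (hq : q ∈ intrinsicInterior ℝ D)
    (hx : x ∈ D) : ∃ ε : ℝ, 0 < ε ∧ q + ε • (q - x) ∈ D := by
  obtain ⟨y, hy, rfl⟩ := mem_intrinsicInterior.1 hq
  let g : ℝ → affineSpan ℝ D := fun t =>
    ⟨AffineMap.lineMap (y : Param) x (-t), AffineMap.lineMap_mem _ y.2 (mem_affineSpan ℝ hx)⟩
  have hg : Continuous g := by
    refine Continuous.subtype_mk ?_ _
    simp only [AffineMap.lineMap_apply_module]
    fun_prop
  have h0 : g 0 = y := Subtype.ext (by simp [g])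
  have hev : ∀ᶠ t in 𝓝[>] (0 : ℝ), g t ∈ interior ((↑) ⁻¹' D : Set (affineSpan ℝ D)) :=
    (hg.continuousAt.eventually_mem (by rw [h0]; exact isOpen_interior.mem_nhds hy)).filter_mono
      nhdsWithin_le_nhds
  obtain ⟨t, ht, ht0⟩ := (hev.and self_mem_nhdsWithin).exists
  refine ⟨t, ht0, ?_⟩
  have : (g t : Param) ∈ D := (interior_subset ht : g t ∈ ((↑) ⁻¹' D : Set (affineSpan ℝ D)))
  convert this using 1
  simp only [g, AffineMap.lineMap_apply_module]
  module

/-- A segment ending at a relative interior point extends beyond it, so an inequality tight there is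
tight on all of `D`. Conversely, inequalities tight on `D` are equations on its affine span, and the
others have slack near `q`. -/
theorem mem_intrinsicInterior_iff {D : Set Param} {H : Finset ((Param →ₗ[ℝ] ℝ) × ℝ)}
    (hD : D = {x | ∀ h ∈ H, h.1 x ≤ h.2}) {q : Param} (hq : q ∈ D) :
    q ∈ intrinsicInterior ℝ D ↔ ∀ h ∈ H, h.1 q = h.2 → ∀ x ∈ D, h.1 x = h.2 := by
  have hle : ∀ x ∈ D, ∀ h ∈ H, h.1 x ≤ h.2 := fun x hx => by rw [hD] at hx; exact hx
  constructor
  · intro hq' h hh he x hx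
    obtain ⟨ε, hε, hmem⟩ := exists_extension hq' hx
    have h1 := hle _ hmem h hh
    have h2 := hle _ hx h hh
    rw [map_add, map_smul, map_sub, he, smul_eq_mul] at h1
    have h3 : ε * (h.2 - h.1 x) ≤ 0 := by linarith
    have h4 : h.2 - h.1 x ≤ 0 := nonpos_of_mul_nonpos_right h3 hε
    linarith
  · intro hact
    refine mem_intrinsicInterior.2 ⟨⟨q, mem_affineSpan ℝ hq⟩, ?_, rfl⟩
    rw [mem_interior_iff_mem_nhds]
    have hev : ∀ h ∈ H, ∀ᶠ y : affineSpan ℝ D in 𝓝 ⟨q, mem_affineSpan ℝ hq⟩, h.1 (y : Param) ≤ h.2 := by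
      intro h hh
      rcases (hle q hq h hh).lt_or_eq with hlt | heq
      · have hc : Continuous fun y : affineSpan ℝ D => h.1 (y : Param) :=
          h.1.continuous_of_finiteDimensional.comp continuous_subtype_val
        exact ((hc.tendsto ⟨q, mem_affineSpan ℝ hq⟩).eventually_lt_const hlt).mono
          fun y hy => hy.le
      · refine Eventually.of_forall fun y => ?_
        have hspan : affineSpan ℝ D ≤ (AffineSubspace.mk' h.2 (⊥ : Submodule ℝ ℝ)).comap h.1.toAffineMap := by
          refine affineSpan_le.2 fun x hx => ?_
          change h.1 x ∈ AffineSubspace.mk' h.2 (⊥ : Submodule ℝ ℝ)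
          rw [hact h hh heq x hx]
          exact AffineSubspace.self_mem_mk' _ _
        have h1 : h.1 (y : Param) ∈ AffineSubspace.mk' h.2 (⊥ : Submodule ℝ ℝ) := hspan y.2
        rw [AffineSubspace.mem_mk', Submodule.mem_bot, vsub_eq_sub, sub_eq_zero] at h1
        exact h1.le
    filter_upwards [(Filter.eventually_all_finset H).2 hev] with y hy
    exact hD.symm.subset (show (y : Param) ∈ {x | ∀ h ∈ H, h.1 x ≤ h.2} from hy)

theorem IsPolyhedron.segment_mem {D : Set Param} (h : IsPolyhedron D) {q x : Param}
    (hq : q ∈ intrinsicInterior ℝ D) (hx : x ∈ D) {t : ℝ} (ht : 0 ≤ t) (ht' : t < 1) :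
    q + t • (x - q) ∈ intrinsicInterior ℝ D := by
  have hqD := intrinsicInterior_subset hq
  have hmem : q + t • (x - q) ∈ D := by
    have := h.convex hqD hx (a := 1 - t) (b := t) (by linarith) ht (by ring)
    convert this using 1
    module
  obtain ⟨H, hD⟩ := h
  have hle : ∀ x ∈ D, ∀ h ∈ H, h.1 x ≤ h.2 := fun x hx => by rw [hD] at hx; exact hx
  rw [mem_intrinsicInterior_iff hD hmem]
  intro h hh he
  refine (mem_intrinsicInterior_iff hD hqD).1 hq h hh ?_
  have h1 := hle q hqD h hh
  have h2 := hle x hx h hh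
  rw [map_add, map_smul, map_sub, smul_eq_mul] at he
  nlinarith

/-- Take a minimal cell through `q`. An inequality tight at `q` cuts out a face, again a cell
through `q`, so by minimality it is tight everywhere. -/
theorem PolyComplex.exists_cell (K : PolyComplex) {q : Param} (hq : q ∈ support K.cells) :
    ∃ D ∈ K.cells, q ∈ intrinsicInterior ℝ D := by
  have hfin : {D ∈ K.cells | q ∈ D}.Finite := K.finite.subset fun D hD => hD.1
  obtain ⟨D₀, hD₀, hqD₀⟩ := hq
  obtain ⟨D, hD, hmin⟩ := hfin.exists_minimal ⟨D₀, hD₀, hqD₀⟩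
  obtain ⟨hDK, hqD⟩ : D ∈ K.cells ∧ q ∈ D := hD
  refine ⟨D, hDK, ?_⟩
  obtain ⟨H, hDH⟩ := K.polyhedron D hDK
  have hle : ∀ x ∈ D, ∀ h ∈ H, h.1 x ≤ h.2 := fun x hx => by rw [hDH] at hx; exact hx
  rw [mem_intrinsicInterior_iff hDH hqD]
  intro h hh he x hx
  let F : Set Param := {x ∈ D | h.1 x = h.2}
  have hF : F ∈ K.cells := by
    refine K.face_mem D hDK F ⟨q, hqD, he⟩ fun _ => ⟨⟨h.1, h.1.continuous_of_finiteDimensional⟩, ?_⟩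
    ext z
    constructor
    · rintro ⟨hz, hz'⟩
      refine ⟨hz, fun y hy => ?_⟩
      change h.1 y ≤ h.1 z
      rw [hz']
      exact hle y hy h hh
    · rintro ⟨hz, hz'⟩
      refine ⟨hz, le_antisymm (hle z hz h hh) ?_⟩
      have := hz' q hqD
      change h.1 q ≤ h.1 z at this
      rwa [he] at this
  exact (hmin (y := F) ⟨hF, hqD, he⟩ (fun z hz => hz.1) hx).2

theorem PolyComplex.isClosed_sUnion (K : PolyComplex) {S : Set (Set Param)} (h : S ⊆ K.cells) :
    IsClosed (⋃₀ S) := by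
  rw [sUnion_eq_biUnion]
  exact (K.finite.subset h).isClosed_biUnion fun D hD => (K.polyhedron D (h hD)).isClosed

theorem PolyComplex.isClosed_support (K : PolyComplex) : IsClosed (support K.cells) :=
  K.isClosed_sUnion subset_rfl

/-- The cells reached by paths from a point and the cells not reached form two finite closed unions.
They are disjoint because cells are convex, so connectedness leaves nothing unreached. -/
theorem PolyComplex.isPathConnected_support (K : PolyComplex)
    (h : IsConnected (support K.cells)) : IsPathConnected (support K.cells) := by
  obtain ⟨x, hx⟩ := h.nonempty
  refine ⟨x, hx, fun {y} hy => ?_⟩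
  let P : Set (Set Param) := {D ∈ K.cells | ∃ z ∈ D, JoinedIn (support K.cells) x z}
  let Q : Set (Set Param) := {D ∈ K.cells | ¬ ∃ z ∈ D, JoinedIn (support K.cells) x z}
  have hP : ∀ z ∈ ⋃₀ P, JoinedIn (support K.cells) x z := by
    rintro z ⟨D, ⟨hD, w, hw, hxw⟩, hz⟩
    have := ((K.polyhedron D hD).convex.isPathConnected ⟨w, hw⟩).joinedIn w hw z hz
    exact hxw.trans (this.mono (subset_sUnion_of_mem hD))
  by_contra hcon
  have hmem : ∀ z ∈ support K.cells, z ∈ ⋃₀ P ∨ z ∈ ⋃₀ Q := by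
    rintro z ⟨D, hD, hz⟩
    by_cases hw : ∃ z ∈ D, JoinedIn (support K.cells) x z
    · exact Or.inl ⟨D, ⟨hD, hw⟩, hz⟩
    · exact Or.inr ⟨D, ⟨hD, hw⟩, hz⟩
  have hxx := JoinedIn.refl hx
  obtain ⟨z, -, hz1, D, ⟨hD, hz2⟩, hzD⟩ := isPreconnected_closed_iff.1 h.isPreconnected (⋃₀ P) (⋃₀ Q)
    (K.isClosed_sUnion fun D hD => hD.1) (K.isClosed_sUnion fun D hD => hD.1)
    hmem (by
      obtain ⟨D, hD, hxD⟩ := hx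
      exact ⟨x, ⟨D, hD, hxD⟩, D, ⟨hD, x, hxD, hxx⟩, hxD⟩)
    ⟨y, hy, (hmem y hy).resolve_left fun hy' => hcon (hP y hy')⟩
  exact hz2 ⟨z, hzD, hP z hz1⟩

/-! ### Compatible complexes -/

/-- In a common chamber both horizontal legs would require odd slopes, but these slopes add up to
three. -/
theorem exists_mem_dualCell_ne {a : Expo 3 → ℝ} {q : Param} (h : Par a q)
    (hv : dualCell a (vert1 q) = dualCell a (vert0 q)) :
    ∃ m ∈ dualCell a (vert0 q), ∃ m' ∈ dualCell a (vert0 q), m ≠ m' := by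
  by_contra! hcon
  obtain ⟨m, hm⟩ := dualCell_nonempty a (vert0 q)
  have hs : dualCell a (vert0 q) = {m} :=
    (Finset.Nonempty.subset_singleton_iff ⟨m, hm⟩).1 fun n hn =>
      Finset.mem_singleton.2 (hcon n hn m hm)
  have hleg : ∀ L, Odd (legSlope L m) := fun L => by
    refine h.1 L 0 le_rfl m ?_
    rw [legPt_zero]
    rcases legVertex_eq q L with h | h <;> rw [h]
    · exact hs
    · rw [hv, hs]
  have h1 := hleg .negHor
  have h2 := hleg .posHor
  have h3 := m.1.is_le
  simp only [legSlope, Nat.odd_iff] at h1 h2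
  omega

theorem vert_sub {a : Expo 3 → ℝ} {q : Param} {m m' : Expo 3} (hm : m ∈ dualCell a (vert0 q))
    (hm' : m' ∈ dualCell a (vert0 q)) (h1 : m ∈ dualCell a (vert1 q))
    (h1' : m' ∈ dualCell a (vert1 q)) :
    ((m.1 : ℕ) - (m'.1 : ℕ) : ℝ) * q.2 + ((m.2 : ℕ) - (m'.2 : ℕ) : ℝ) * |q.2| = 0 := by
  have e0 := monomialValue_eq_of_mem hm hm'
  have e1 := monomialValue_eq_of_mem h1 h1'
  simp only [monomialValue, vert0, vert1] at e0 e1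
  linear_combination e1 - e0

/-- Compatibility fixes dual cells but not the sign of `ℓ`. If `ℓ` vanished at `q` and not at `q'`,
prolonging the segment past `q` would give members with both signs. Their vertices share two active
exponents, whose difference would be orthogonal to both `(1,1)` and `(-1,1)`. -/
theorem sign_constant {a : Expo 3 → ℝ} {D : Set Param} (hD : IsPolyhedron D)
    (hPar : ∀ q ∈ D, Par a q) (hconst : ∀ q ∈ intrinsicInterior ℝ D,
      ∀ q' ∈ intrinsicInterior ℝ D, dualCell a (vert0 q) = dualCell a (vert0 q') ∧
        dualCell a (vert1 q) = dualCell a (vert1 q')) {q q' : Param}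
    (hq : q ∈ intrinsicInterior ℝ D) (hq' : q' ∈ intrinsicInterior ℝ D) (h0 : q.2 = 0) :
    q'.2 = 0 := by
  by_contra hne
  obtain ⟨ε, hε, hmem⟩ := exists_extension hq (intrinsicInterior_subset hq')
  set q'' := q + (1 / 2 : ℝ) • ((q + ε • (q - q')) - q) with hq''
  have hmem'' : q'' ∈ intrinsicInterior ℝ D := hD.segment_mem hq hmem (by norm_num) (by norm_num)
  have hval : q''.2 = -(ε / 2) * q'.2 := by
    rw [hq'']
    simp only [Prod.snd_add, Prod.smul_snd, Prod.snd_sub, h0, smul_eq_mul]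
    ring
  have hvq : vert1 q = vert0 q := vert1_eq_vert0.2 h0
  have hall : ∀ p ∈ intrinsicInterior ℝ D, dualCell a (vert0 p) = dualCell a (vert0 q) ∧
      dualCell a (vert1 p) = dualCell a (vert0 q) := fun p hp => by
    obtain ⟨h1, h2⟩ := hconst p hp q hq
    rw [hvq] at h2
    exact ⟨h1, h2⟩
  obtain ⟨m, hm, m', hm', hmm⟩ := exists_mem_dualCell_ne (hPar q (intrinsicInterior_subset hq))
    (by rw [hvq])
  have key : ∀ p ∈ intrinsicInterior ℝ D,
      ((m.1 : ℕ) - (m'.1 : ℕ) : ℝ) * p.2 + ((m.2 : ℕ) - (m'.2 : ℕ) : ℝ) * |p.2| = 0 := by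
    intro p hp
    obtain ⟨h1, h2⟩ := hall p hp
    exact vert_sub (h1 ▸ hm) (h1 ▸ hm') (h2 ▸ hm) (h2 ▸ hm')
  have k1 := key q' hq'
  have k2 := key q'' hmem''
  rw [hval, abs_mul, abs_neg, abs_of_pos (half_pos hε)] at k2
  have habs : 0 < |q'.2| := abs_pos.2 hne
  have e1 : ((m.2 : ℕ) - (m'.2 : ℕ) : ℝ) * (ε * |q'.2|) = 0 := by
    linear_combination (ε / 2) * k1 + k2
  have e2 : ((m.1 : ℕ) - (m'.1 : ℕ) : ℝ) * (ε * q'.2) = 0 := by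
    linear_combination (ε / 2) * k1 - k2
  rw [mul_eq_zero, or_iff_left (mul_pos hε habs).ne', sub_eq_zero] at e1
  rw [mul_eq_zero, or_iff_left (mul_ne_zero hε.ne' hne), sub_eq_zero] at e2
  exact hmm (Prod.ext (Fin.ext (Nat.cast_injective e2)) (Fin.ext (Nat.cast_injective e1)))

/-- If the signs differed, `ℓ` would vanish at a point of the segment between the two members, and
hence everywhere. -/
theorem sign_constant' {a : Expo 3 → ℝ} {D : Set Param} (hD : IsPolyhedron D)
    (hPar : ∀ q ∈ D, Par a q) (hconst : ∀ q ∈ intrinsicInterior ℝ D,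
      ∀ q' ∈ intrinsicInterior ℝ D, dualCell a (vert0 q) = dualCell a (vert0 q') ∧
        dualCell a (vert1 q) = dualCell a (vert1 q')) {q q' : Param}
    (hq : q ∈ intrinsicInterior ℝ D) (hq' : q' ∈ intrinsicInterior ℝ D) :
    (0 < q.2 → 0 < q'.2) ∧ (q.2 < 0 → q'.2 < 0) := by
  have hzero := @sign_constant a D hD hPar hconst
  have hmix : q.2 * q'.2 < 0 → False := by
    intro hlt
    have hne : q.2 - q'.2 ≠ 0 := fun h => by
      have : q.2 = q'.2 := by linarith
      rw [this] at hlt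
      nlinarith
    have ht : 0 ≤ q.2 / (q.2 - q'.2) ∧ q.2 / (q.2 - q'.2) < 1 := by
      rcases lt_or_gt_of_ne hne with h | h
      · have h1 : q.2 < 0 := by by_contra! h1; nlinarith
        have h2 : 0 < q'.2 := by by_contra! h2; nlinarith
        exact ⟨div_nonneg_of_nonpos h1.le h.le, by rw [div_lt_one_of_neg h]; linarith⟩
      · have h1 : 0 < q.2 := by by_contra! h1; nlinarith
        have h2 : q'.2 < 0 := by by_contra! h2; nlinarith
        exact ⟨div_nonneg h1.le h.le, by rw [div_lt_one h]; linarith⟩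
    have hz := hD.segment_mem hq (intrinsicInterior_subset hq') ht.1 ht.2
    have := hzero hz hq (by
      simp only [Prod.snd_add, Prod.smul_snd, Prod.snd_sub, smul_eq_mul]
      field_simp
      ring)
    rw [this, zero_mul] at hlt
    exact lt_irrefl _ hlt
  constructor
  · intro h
    rcases lt_trichotomy q'.2 0 with h' | h' | h'
    · exact (hmix (mul_neg_of_pos_of_neg h h')).elim
    · exact absurd (hzero hq' hq h') h.ne'
    · exact h'
  · intro h
    rcases lt_trichotomy q'.2 0 with h' | h' | h'
    · exact h'
    · exact absurd (hzero hq' hq h') h.ne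
    · exact (hmix (mul_neg_of_neg_of_pos h h')).elim

/-- Goodness depends only on the two dual cells and the sign of `ℓ`. -/
theorem isGood_constant {a : Expo 3 → ℝ} {D : Set Param} (hD : IsPolyhedron D)
    (hPar : ∀ q ∈ D, Par a q) (hconst : ∀ q ∈ intrinsicInterior ℝ D,
      ∀ q' ∈ intrinsicInterior ℝ D, dualCell a (vert0 q) = dualCell a (vert0 q') ∧
        dualCell a (vert1 q) = dualCell a (vert1 q')) {q q' : Param}
    (hq : q ∈ intrinsicInterior ℝ D) (hq' : q' ∈ intrinsicInterior ℝ D) (hg : IsGood a q) :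
    IsGood a q' := by
  obtain ⟨c0, c1⟩ := hconst q hq q' hq'
  obtain ⟨s1, s2⟩ := sign_constant' hD hPar hconst hq' hq
  obtain ⟨s3, s4⟩ := sign_constant' hD hPar hconst hq hq'
  have hnn : 0 ≤ q.2 ↔ 0 ≤ q'.2 := by rw [← not_lt, ← not_lt, not_iff_not]; exact ⟨s4, s2⟩
  refine ⟨fun c hc => hg.1 c ⟨?_, fun m hm => hc.2 m ?_⟩, fun L hL => hg.2 L fun m hm => hL m ?_⟩
  · have := hc.1
    rcases c with ⟨b, t⟩
    cases b
    · simpa using s2 (by simpa using this)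
    · simpa using s1 (by simpa using this)
  · rcases c with ⟨b, t⟩
    cases t
    · exact c0 ▸ hm
    · exact c1 ▸ hm
  · cases L <;> simp only [legVertex, hnn] at hm ⊢ <;> (try split_ifs at hm ⊢) <;>
      first | exact c0 ▸ hm | exact c1 ▸ hm

theorem continuous_vert1 : Continuous vert1 := by unfold vert1; fun_prop

theorem continuous_legVertex (L : Leg) : Continuous fun q => legVertex q L := by
  have h : ∀ q, legVertex q .posHor = (q.1.1 + max q.2 0, q.1.2 + max q.2 0) := fun q => by
    rcases le_or_gt 0 q.2 with h | h
    · simp [legVertex, vert1, h, abs_of_nonneg h]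
    · simp [legVertex, vert0, h.not_ge, h.le]
  cases L
  · simp only [legVertex_negHor]; fun_prop
  · exact continuous_fst
  · simp only [h]; fun_prop
  · exact continuous_vert1

/-- Both exceptional conditions bound the slopes of all active exponents, which is open by upper
semicontinuity. The vertex of a leg depends continuously on the member, also across `ℓ = 0`. -/
theorem isClosed_isGood (a : Expo 3 → ℝ) : IsClosed {q | IsGood a q} := by
  have hcorner : ∀ c : Bool × Bool, IsOpen {q | InCorner a q c.1 c.2} := by
    rintro ⟨b, top⟩
    refine IsOpen.inter (s := {q : Param | if b then 0 < q.2 else q.2 < 0}) ?_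
      ((isOpen_dualCell_forall a fun m => cornerSlope b top m ≤ 1).preimage
        (f := fun q => cornerVertex q top) ?_)
    · cases b
      · simpa using isOpen_lt continuous_snd continuous_const
      · simpa using isOpen_lt continuous_const continuous_snd
    · cases top
      · exact continuous_fst
      · exact continuous_vert1
  have hray : ∀ L, IsOpen {q | OnOppositeRay a q L} := fun L =>
    (isOpen_dualCell_forall a fun m => legSlope L m = 0).preimage (continuous_legVertex L)
  have : {q | IsGood a q} = (⋂ c : Bool × Bool, {q | InCorner a q c.1 c.2}ᶜ) ∩
      ⋂ L, {q | OnOppositeRay a q L}ᶜ := by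
    ext q
    simp only [mem_inter_iff, mem_iInter]
    exact Iff.rfl
  rw [this]
  exact (isClosed_iInter fun c => (hcorner c).isClosed_compl).inter
    (isClosed_iInter fun L => (hray L).isClosed_compl)

theorem isGood_iff {a : Expo 3 → ℝ} (ha : IsSmooth a) {q : Param} (h : Par a q) :
    IsGood a q ↔ ¬ (InCornerChamber a q ∨ OnCornerEdge a q) ∧ ¬ IsSpecial a q := by
  rw [corner_iff ha h, isSpecial_iff ha h, not_exists]
  simp only [not_exists, IsGood, Prod.forall]

/-- A remaining cell is good in its relative interior and hence, by closedness, on its boundary.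
Conversely, the cell with a good member in its relative interior is good there throughout, so it is
not removed. -/
theorem PolyComplex.support_nonSpecialBoundedCells (K : PolyComplex) {a : Expo 3 → ℝ}
    (ha : IsSmooth a) (hPar : ∀ q ∈ support K.cells, Par a q) (hcomp : K.IsCompatible a) :
    support (K.nonSpecialBoundedCells a) = {q ∈ support K.cells | IsGood a q} := by
  have hParD : ∀ D ∈ K.cells, ∀ q ∈ D, Par a q := fun D hD q hq => hPar q ⟨D, hD, hq⟩
  ext x
  constructor
  · rintro ⟨D, ⟨⟨hD, hbd⟩, hsp⟩, hx⟩
    refine ⟨⟨D, hD, hx⟩, ?_⟩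
    have hpoly := K.polyhedron D hD
    have hgood : intrinsicInterior ℝ D ⊆ {q | IsGood a q} := fun q hq =>
      (isGood_iff ha (hParD D hD q (intrinsicInterior_subset hq))).2
        ⟨fun h => hbd ⟨q, hq, h⟩, fun h => hsp ⟨q, hq, h⟩⟩
    obtain ⟨q, hq⟩ := (K.nonempty D hD).intrinsicInterior hpoly.convex
    have hclos : x ∈ closure {q | IsGood a q} := by
      have hcont : Continuous fun t : ℝ => q + t • (x - q) := by fun_prop
      have htend : Tendsto (fun t : ℝ => q + t • (x - q)) (𝓝[<] 1) (𝓝 x) := by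
        have := (hcont.tendsto 1).mono_left (nhdsWithin_le_nhds (s := Iio 1))
        rwa [one_smul, add_sub_cancel] at this
      refine mem_closure_of_tendsto htend ?_
      filter_upwards [self_mem_nhdsWithin, (eventually_gt_nhds (zero_lt_one' ℝ)).filter_mono
        nhdsWithin_le_nhds] with t ht ht0
      exact hgood (hpoly.segment_mem hq hx ht0.le ht)
    rwa [(isClosed_isGood a).closure_eq] at hclos
  · rintro ⟨hx, hg⟩
    obtain ⟨D, hD, hxD⟩ := K.exists_cell hx
    have hgood : ∀ q ∈ intrinsicInterior ℝ D, IsGood a q := fun q hq =>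
      isGood_constant (K.polyhedron D hD) (hParD D hD) (hcomp D hD) hxD hq hg
    refine ⟨D, ⟨⟨hD, ?_⟩, ?_⟩, intrinsicInterior_subset hxD⟩
    · rintro ⟨q, hq, h⟩
      exact ((isGood_iff ha (hParD D hD q (intrinsicInterior_subset hq))).1 (hgood q hq)).1 h
    · rintro ⟨q, hq, h⟩
      exact ((isGood_iff ha (hParD D hD q (intrinsicInterior_subset hq))).1 (hgood q hq)).2 h

/-- A path satisfying `Par` stays in its connected component; its endpoint is a limit of members,
and the class is closed. -/
theorem IsTritangentClass.admissible {a : Expo 3 → ℝ} (ha : IsSmooth a) {Ω : Set Param}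
    (hΩ : IsTritangentClass a Ω) (hclosed : IsClosed Ω) (hconn : IsConnected Ω → IsPathConnected Ω) :
    Admissible a Ω := by
  obtain ⟨q₀, hq₀, rfl⟩ := hΩ
  refine ⟨fun q hq => IsTritangent.par ha (connectedComponentIn_subset {q' | IsTritangent a q'} q₀ hq),
    hconn (isConnected_connectedComponentIn_iff.2 hq₀), fun γ hγ h0 hp => ?_⟩
  have hsub : γ '' Ico 0 1 ⊆ connectedComponentIn {q' | IsTritangent a q'} q₀ := by
    rw [connectedComponentIn_eq h0]
    refine (isPreconnected_Ico.image _ hγ.continuousOn).subset_connectedComponentIn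
      ⟨0, ⟨le_rfl, zero_lt_one⟩, rfl⟩ ?_
    rintro _ ⟨t, ht, rfl⟩
    exact (hp t ht.1 ht.2).isTritangent ha
  have h1 : γ 1 ∈ closure (γ '' Ico 0 1) := by
    refine image_closure_subset_closure_image hγ ⟨1, ?_, rfl⟩
    rw [closure_Ico zero_ne_one]
    exact ⟨zero_le_one, le_rfl⟩
  have := closure_mono hsub h1
  rwa [hclosed.closure_eq] at this

end Tritangent

end

/-! ### The theorem -/

theorem mainTheorem7
    (a : Tritangent.Expo 3 → ℝ) (ha : Tritangent.IsSmooth a)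
    (Ω : Set Tritangent.Param) (hΩ : Tritangent.IsTritangentClass a Ω)
    (K : Tritangent.PolyComplex) (hK : Tritangent.support K.cells = Ω)
    (hcomp : K.IsCompatible a) :
    IsPathConnected (Tritangent.support (K.nonSpecialBoundedCells a)) := by
  subst hK
  have hadm := hΩ.admissible ha K.isClosed_support K.isPathConnected_support
  rw [K.support_nonSpecialBoundedCells ha hadm.par hcomp]
  exact Tritangent.isPathConnected_good ha hadm
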